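/- **Notation.** Let $\mathcal Q^+=[1,\infty)\times[0,\infty)$; for $(q,h)\in\mathcal Q^+$ put $p=1/q$. For $l\in\mathbb C$ let $[l]_q=\frac{q^l-1}{q-1}$ if $q\ne1$ and $[l]_1=l$. For $s\ge 0$ put $$x^{-[s]_{q,h}}=\prod_{k=0}^{s-1}\frac1{q^kx+h[k]_q}.$$ A *$(q,h)$-factorial series* is a (formal) series $\sum_{s\ge0}A_sx^{-[s]_{q,h}}$ with $A_s\in M_n(\mathbb C)$; it is identified with its expansion in powers of $1/x$. Let $$\delta Y(x)=p(x-h)\,\frac{Y(px-ph)-Y(x)}{(p-1)x-ph}\quad((q,h)\neq(1,0)),\qquad \delta Y=x\,Y'\quad((q,h)=(1,0)),$$ and $A^F(x)=F(px-ph)^{-1}\,[A(x)F(x)-\delta F(x)]$. For $l\in\mathbb C$, $V^{(q,h)}(l)$ is the set of $x\in\mathbb C$ with $|x|>|l|$ if $h=0$, with $\Re x>\Re l$ if $q=1,h>0$, and with $|x-\frac h{1-q}|>|l-\frac h{1-q}|$ if $q>1,h>0$. Fix a norm $\|\cdot\|$ on $M_n(\mathbb C)$. For $C,\lambda\ge0$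 and $\Lambda\subset\mathcal Q^+$, a family of $(q,h)$-factorial series $A^{(q,h)}(x)=\sum_sA^{(q,h)}_sx^{-[s]_{q,h}}$, $(q,h)\in\Lambda$, is *Fuchsian $(C,\lambda)$* if $\|A_s^{(q,h)}\|\le Cq^{s-1}\prod_{k=0}^{s-2}(q^k\lambda+h[k]_q)$ for all $s\ge1$ and $(q,h)\in\Lambda$. The family of systems $\delta Y=A^{(q,h)}Y$ is Fuchsian $(C,\lambda)$ if moreover $I+(1-q)A_0^{(q,h)}$ is invertible for all $(q,h)\in\Lambda$. A constant matrix $A_0$ is *non-resonant at $q$* if for every eigenvalue $c$ of $A_0$ and every integer $s\ne0$, $q^sc-[s]_q$ is not an eigenvalue of $A_0$; the family is non-resonant if $A_0^{(q,h)}$ is non-resonant at $q$ for all $(q,h)\in\Lambda$. Let $(x;p)_\infty=\prod_{j\ge0}(1-p^jx)$ and $\Theta_q(x)=\sum_{n\in\mathbb Z}(-1)^nq^{-n(n-1)/2}x^n$. The characters are $$e_c^{(q,h)}(x)=\begin{cases}\left(\frac h{1-p}\right)^c\dfrac{((1-p)\frac xh+p;p)_\infty}{(p^c((1-p)\frac xh+p);p)_\infty}&q>1,\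 h>0,\\[2mm] h^c\,\dfrac{\Gamma(1+c-\frac xh)}{\Gamma(1-\frac xh)}&q=1,\ h>0,\\[2mm] \Theta_q(x)/\Theta_q(q^{-c}x)&q>1,\ h=0,\\ (-x)^c&(q,h)=(1,0),\end{cases}$$ where in the last case a determination of the logarithm has been fixed (a continuous branch on an unbounded open set $D$, with $-x\in D$). Put $\ell_{c,k}^{(q,h)}=\frac1{k!}\partial_c^ke_c^{(q,h)}$. Let $N_r$ be the $r\times r$ matrix with ones just above the diagonal and zeros elsewhere, $\mathcal L^{(q,h)}_{c,r}(x)=\sum_{j=0}^{r-1}\ell^{(q,h)}_{c,j}(x)N_r^j$, and $A^{(q,h)}_{c,r}=-[-c]_qI_r+\frac{q^{-c}}{1-q}(q^{-N_r}-I_r)$, which means $cI_r+N_r$ if $q=1$. For fixed $c_1,\dots,c_m\in\mathbb C$ and integers $r_i\ge1$ with $r_1+\dots+r_m=n$ put, for all $(q,h)\in\mathcal Q^+$, $J_0^{(q,h)}=\mathrm{diag}(A^{(q,h)}_{c_1,r_1},\dots,A^{(q,h)}_{c_m,r_m})$ and $\mathcal E_{J_0^{(q,h)}}=\mathrm{diag}(\mathcal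 L^{(q,h)}_{c_1,r_1},\dots,\mathcal L^{(q,h)}_{c_m,r_m})$. A *fundamental matrix of solutions in $V^{(q,h)}(\lambda')$* is a matrix of meromorphic functions there (if $(q,h)=(1,0)$: on the part of $V^{(1,0)}(\lambda')$ where $(-x)^c$ is defined), with determinant not vanishing outside a set without accumulation point in the domain, and satisfying the equation, as an equality of meromorphic functions, wherever $x$ and $(x-h)/q$ both lie in the domain. **Theorem.** Let $\Lambda\subset\mathcal Q^+$ be bounded and let $\delta Y=A^{(q,h)}Y$, $(q,h)\in\Lambda$, be a non-resonant Fuchsian $(C,\lambda)$ family of systems. Let $c_1,\dots,c_m\in\mathbb C$ with $c_i-c_j\notin\mathbb Z\setminus\{0\}$ for all $i,j$, let $r_1,\dots,r_m\ge1$ be integers with sum $n$, and assume that $J_0^{(q,h)}$ is non-resonant at $q$ for every $(q,h)$ in the closure of $\Lambda$. Assume that for every $(q,h)\in\Lambda$ there is $P^{(q,h)}\in GL_n(\mathbb C)$ with $P^{(q,h)}J_0^{(q,h)}=A_0^{(q,h)}P^{(q,h)}$, such that the families $(P^{(q,h)})_{\Lambda}$ and $((P^{(q,h)})^{-1})_{\Lambda}$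 are bounded. Then: 1. For every $(q,h)\in\Lambda$ there is a unique formal $(q,h)$-factorial series $F^{(q,h)}(x)=I+\sum_{s\ge1}F_s^{(q,h)}x^{-[s]_{q,h}}$ such that $(A^{(q,h)})^{F^{(q,h)}}=A_0^{(q,h)}$. 2. There are $C'\ge0$ and $\lambda'\ge\lambda$ such that the family $(F^{(q,h)})_{(q,h)\in\Lambda}$ is Fuchsian $(C',\lambda')$; the series $F^{(q,h)}(x)$ converges in $V^{(q,h)}(\lambda')$. 3. With this $\lambda'$, for every $(q,h)\in\Lambda$: (a) for every $P\in GL_n(\mathbb C)$, $F^{(q,h)}(x)\,P\,\mathcal E_{J_0^{(q,h)}}(x)$ is a fundamental matrix of solutions of $\delta Y=A^{(q,h)}Y$ in $V^{(q,h)}(\lambda')$ if and only if $PJ_0^{(q,h)}=A_0^{(q,h)}P$; (b) for every $P\in GL_n(\mathbb C)$ with $PJ_0^{(q,h)}=A_0^{(q,h)}P$, the matrix $\mathcal X_{can}^{(q,h)}(x)=F^{(q,h)}(x)\,P\,\mathcal E_{J_0^{(q,h)}}(x)\,P^{-1}$ is a fundamental matrix of solutions in $V^{(q,h)}(\lambda')$;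 it does not depend on the choice of such a $P$, provided that, in case $h>0$, distinct $c_i$ give distinct eigenvalues $-[-c_i]_q$ (this is automatic if $q=1$). -/

import Mathlib

open Filter Topology

noncomputable section

namespace QHDiff

/-! ### The parameters and the `(q,h)`-factorial monomials -/

/-- The parameter set `[1,∞) × [0,∞)`, whose points are the pairs `(q,h)`. -/
def Qplus : Set (ℝ × ℝ) := Set.Ici 1 ×ˢ Set.Ici 0

/-- The number `[k]_q` for a natural number `k`, as a real number. -/
def qNat (q : ℝ) (k : ℕ) : ℝ := if q = 1 then (k : ℝ) else (q ^ k - 1) / (q - 1)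

/-- Jackson's `[l]_q = (q^l - 1)/(q - 1)` for a complex number `l`, with `[l]_1 = l`. -/
def qBracket (q : ℝ) (l : ℂ) : ℂ := if q = 1 then l else ((q : ℂ) ^ l - 1) / ((q : ℂ) - 1)

/-- The monomial `y^{-[s]} = 1 / (y (q y + h[1]_q) ⋯ (q^(s-1) y + h[s-1]_q))` at an element `y` of a
field containing `ℝ`. It is used for `y` a real or complex number, and for `y` a formal Laurent
series. -/
def qhMonomial {K : Type*} [Field K] [Algebra ℝ K] (q h : ℝ) (y : K) (s : ℕ) : K :=
  (∏ k ∈ Finset.range s, (algebraMap ℝ K (q ^ k) * y + algebraMap ℝ K (h * qNat q k)))⁻¹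

/-- The domain `V^{(q,h)}(l)`. -/
def V (q h : ℝ) (l : ℂ) : Set ℂ :=
  if h = 0 then {x | ‖l‖ < ‖x‖}
  else if q = 1 then {x | l.re < x.re}
  else {x | ‖l - (h : ℂ) / (1 - (q : ℂ))‖ < ‖x - (h : ℂ) / (1 - (q : ℂ))‖}

/-! ### Fuchsian and non-resonant families

A family of `(q,h)`-factorial series with matrix coefficients is given by its coefficients
`A q h s`, `s : ℕ`. -/

/-- The family of series `∑ A q h s • x^{-[s]}` is Fuchsian `(C, lam)` on `Lam`, with respect to
the norm `N`. -/
def IsFuchsianFamily {n : ℕ} (N : Seminorm ℂ (Matrix (Fin n) (Fin n) ℂ)) (C lam : ℝ)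
    (Lam : Set (ℝ × ℝ)) (A : ℝ → ℝ → ℕ → Matrix (Fin n) (Fin n) ℂ) : Prop :=
  ∀ q h : ℝ, (q, h) ∈ Lam → ∀ s : ℕ, 1 ≤ s →
    N (A q h s) ≤ C * q ^ (s - 1) * (qhMonomial q h lam (s - 1))⁻¹

/-- The family of systems with matrices `∑ A q h s • x^{-[s]}` is Fuchsian `(C, lam)` on `Lam`. -/
def IsFuchsianSystem {n : ℕ} (N : Seminorm ℂ (Matrix (Fin n) (Fin n) ℂ)) (C lam : ℝ)
    (Lam : Set (ℝ × ℝ)) (A : ℝ → ℝ → ℕ → Matrix (Fin n) (Fin n) ℂ) : Prop :=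
  (∀ q h : ℝ, (q, h) ∈ Lam → IsUnit (1 + (1 - (q : ℂ)) • A q h 0)) ∧
    IsFuchsianFamily N C lam Lam A

/-- Non-resonance at `q` of a constant matrix `A₀`: for every eigenvalue `c` of `A₀` and every
non-zero integer `s`, the number `q^s c - [s]_q` is not an eigenvalue of `A₀`. -/
def IsNonresonant {n : ℕ} (q : ℝ) (A₀ : Matrix (Fin n) (Fin n) ℂ) : Prop :=
  ∀ c : ℂ, Module.End.HasEigenvalue (Matrix.toLin' A₀) c → ∀ s : ℤ, s ≠ 0 →
    ¬ Module.End.HasEigenvalue (Matrix.toLin' A₀) ((q : ℂ) ^ s * c - qBracket q (s : ℂ))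

/-! ### Formal `(q,h)`-factorial series and formal gauge transformations

Formal computations take place in the field `LaurentSeries ℂ` of Laurent series in `t = 1/x`. -/

/-- The variable `x = t⁻¹`. -/
def formalX : LaurentSeries ℂ := HahnSeries.single (-1) 1

/-- The shifted variable `p x - p h = (x - h)/q`, where `p = 1/q`. -/
def formalShiftX (q h : ℝ) : LaurentSeries ℂ :=
  algebraMap ℝ (LaurentSeries ℂ) q⁻¹ * (formalX - algebraMap ℝ (LaurentSeries ℂ) h)

/-- The formal series `∑ a s • y^{-[s]}` expanded in powers of `t`, for `y` equal to `formalX` or to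
`formalShiftX q h`. Since `y^{-[s]}` then starts with `t^s`, only the terms with `s ≤ k` contribute
to the coefficient of `t^k`. -/
def formalSum {n : ℕ} (q h : ℝ) (a : ℕ → Matrix (Fin n) (Fin n) ℂ) (y : LaurentSeries ℂ) :
    Matrix (Fin n) (Fin n) (LaurentSeries ℂ) :=
  Matrix.of fun i j => HahnSeries.ofPowerSeries ℤ ℂ (PowerSeries.mk fun k =>
    ∑ s ∈ Finset.range (k + 1), a s i j * (qhMonomial q h y s).coeff (k : ℤ))

/-- The operator `δ = p (x - h) Δ_{q,h}` on formal `(q,h)`-factorial series, where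
`Δ_{q,h} f (x) = (f (p x - p h) - f (x)) / ((p - 1) x - p h)`; it is `x d/dx = - t d/dt` if
`(q,h) = (1,0)`. -/
def formalDelta {n : ℕ} (q h : ℝ) (a : ℕ → Matrix (Fin n) (Fin n) ℂ) :
    Matrix (Fin n) (Fin n) (LaurentSeries ℂ) :=
  Matrix.of fun i j =>
    if q = 1 ∧ h = 0 then
      -(HahnSeries.single 1 1 * LaurentSeries.hasseDeriv ℂ 1 (formalSum q h a formalX i j))
    else
      formalShiftX q h * ((formalSum q h a (formalShiftX q h) i j - formalSum q h a formalX i j) /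
        (formalShiftX q h - formalX))

/-- The formal gauge transform `A^F = F(p x - p h)⁻¹ (A(x) F(x) - δ F(x))`. -/
def formalGauge {n : ℕ} (q h : ℝ) (A F : ℕ → Matrix (Fin n) (Fin n) ℂ) :
    Matrix (Fin n) (Fin n) (LaurentSeries ℂ) :=
  (formalSum q h F (formalShiftX q h))⁻¹ *
    (formalSum q h A formalX * formalSum q h F formalX - formalDelta q h F)

/-- `F` is a formal gauge transformation, tangent to the identity and given by a `(q,h)`-factorial
series, which reduces the system of matrix `A` to the system of constant matrix `A 0`. -/
def IsReducingGauge {n : ℕ} (q h : ℝ) (A F : ℕ → Matrix (Fin n) (Fin n) ℂ) : Prop :=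
  F 0 = 1 ∧ formalGauge q h A F = (A 0).map (algebraMap ℂ (LaurentSeries ℂ))

/-! ### Sums of series, the operator `δ` on functions, fundamental matrices -/

/-- The sum of the `(q,h)`-factorial series with coefficients `a s` at a complex number `x`. -/
def qhSum {n : ℕ} (q h : ℝ) (a : ℕ → Matrix (Fin n) (Fin n) ℂ) (x : ℂ) :
    Matrix (Fin n) (Fin n) ℂ :=
  ∑' s : ℕ, qhMonomial q h x s • a s

/-- The map `x ↦ p x - p h = (x - h)/q`, inverse of `x ↦ q x + h`. -/
def shiftBack (q h : ℝ) (x : ℂ) : ℂ := (x - (h : ℂ)) / (q : ℂ)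

/-- The operator `δ = p (x - h) Δ_{q,h}` on functions, equal to `x d/dx` if `(q,h) = (1,0)`. -/
def delta (q h : ℝ) (f : ℂ → ℂ) (x : ℂ) : ℂ :=
  if q = 1 ∧ h = 0 then x * deriv f x
  else shiftBack q h x * ((f (shiftBack q h x) - f x) / (shiftBack q h x - x))

/-- `Y` is a fundamental matrix of (meromorphic) solutions in `W` of the system `δ Y = A Y`. As
usual, equalities between meromorphic functions are meant outside of a set without accumulation
point in `W`; the equation is required wherever both `x` and `(x - h)/q` are in `W`, that is, it is
the relation between `Y(q x + h)` and `Y(x)` for `x` and `q x + h` in `W`. -/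
structure IsFundamentalMatrix {n : ℕ} (q h : ℝ) (A : ℂ → Matrix (Fin n) (Fin n) ℂ) (W : Set ℂ)
    (Y : ℂ → Matrix (Fin n) (Fin n) ℂ) : Prop where
  meromorphic : ∀ i j, MeromorphicOn (fun x => Y x i j) W
  equation : ∀ᶠ x in codiscreteWithin {x | x ∈ W ∧ shiftBack q h x ∈ W},
    (Matrix.of fun i j => delta q h (fun t => Y t i j) x) = A x * Y x
  det_ne_zero : ∀ᶠ x in codiscreteWithin W, (Y x).det ≠ 0

/-! ### Characters, logarithms, and the normal form -/

/-- `(x;p)_∞`, for `0 < p < 1`. -/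
def pochhammerInf (p : ℝ) (x : ℂ) : ℂ := ∏' j : ℕ, (1 - (p : ℂ) ^ j * x)

/-- Jacobi's theta function `∑ (-1)^n q^{-n(n-1)/2} x^n` over the integers `n`. -/
def theta (q : ℝ) (x : ℂ) : ℂ :=
  ∑' n : ℤ, (-1 : ℂ) ^ n * (q : ℂ) ^ (-(n * (n - 1) / 2)) * x ^ n

/-- The character `e_c^{(q,h)}(x)`. The function `L` is the chosen determination of the logarithm;
it is only used for `(q,h) = (1,0)`, where `e_c(x) = (-x)^c`. -/
def qhChar (L : ℂ → ℂ) (q h : ℝ) (c x : ℂ) : ℂ :=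
  if 1 < q then
    if 0 < h then
      ((h / (1 - q⁻¹) : ℝ) : ℂ) ^ c *
        (pochhammerInf q⁻¹ ((1 - (q : ℂ)⁻¹) * (x / h) + (q : ℂ)⁻¹) /
          pochhammerInf q⁻¹ (((q⁻¹ : ℝ) : ℂ) ^ c * ((1 - (q : ℂ)⁻¹) * (x / h) + (q : ℂ)⁻¹)))
    else theta q x / theta q (((q : ℂ) ^ c)⁻¹ * x)
  else
    if 0 < h then
      (h : ℂ) ^ c * (Complex.Gamma (1 + c - x / h) / Complex.Gamma (1 - x / h))
    else Complex.exp (c * L (-x))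

/-- `ℓ_{c,k}^{(q,h)}(x) = (1/k!) ∂^k/∂c^k e_c^{(q,h)}(x)`. -/
def qhLog (L : ℂ → ℂ) (q h : ℝ) (c : ℂ) (k : ℕ) (x : ℂ) : ℂ :=
  ((k.factorial : ℂ))⁻¹ * iteratedDeriv k (fun b => qhChar L q h b x) c

/-- The nilpotent matrix `N_r` with ones just above the diagonal. -/
def nilBlock (r : ℕ) : Matrix (Fin r) (Fin r) ℂ :=
  Matrix.of fun i j => if (i : ℕ) + 1 = (j : ℕ) then 1 else 0

/-- `q^{-N_r} = exp (- (log q) N_r)`, a finite sum since `N_r ^ r = 0`. -/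
def qPowNegNil (q : ℝ) (r : ℕ) : Matrix (Fin r) (Fin r) ℂ :=
  ∑ j ∈ Finset.range r, ((-(Real.log q : ℂ)) ^ j / (j.factorial : ℂ)) • nilBlock r ^ j

/-- The block `A_{c,r} = -[-c]_q I + q^{-c}/(1-q) (q^{-N_r} - I)`, which is `c I + N_r` (the limit)
if `q = 1`. -/
def normalBlock (q : ℝ) (c : ℂ) (r : ℕ) : Matrix (Fin r) (Fin r) ℂ :=
  -(qBracket q (-c)) • (1 : Matrix (Fin r) (Fin r) ℂ) +
    if q = 1 then nilBlock r
    else ((q : ℂ) ^ (-c) / (1 - (q : ℂ))) • (qPowNegNil q r - 1)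

/-- The block `L_{c,r}(x) = ∑_{j < r} ℓ_{c,j}(x) N_r^j`. -/
def logBlock (L : ℂ → ℂ) (q h : ℝ) (c : ℂ) (r : ℕ) (x : ℂ) : Matrix (Fin r) (Fin r) ℂ :=
  ∑ j ∈ Finset.range r, qhLog L q h c j x • nilBlock r ^ j

/-- The block diagonal matrix `diag (B 0, …, B (m-1))`, where `B i` has size `r i` and the sizes add
up to `n`. -/
def blockDiag {n m : ℕ} {r : Fin m → ℕ} (hr : ∑ i, r i = n)
    (B : (i : Fin m) → Matrix (Fin (r i)) (Fin (r i)) ℂ) : Matrix (Fin n) (Fin n) ℂ :=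
  Matrix.reindex (finSigmaFinEquiv.trans (finCongr hr)) (finSigmaFinEquiv.trans (finCongr hr))
    (Matrix.blockDiagonal' B)

/-- The normal form `J₀ = diag (A_{c_1,r_1}, …, A_{c_m,r_m})`. -/
def normalForm {n m : ℕ} {r : Fin m → ℕ} (hr : ∑ i, r i = n) (c : Fin m → ℂ) (q : ℝ) :
    Matrix (Fin n) (Fin n) ℂ :=
  blockDiag hr fun i => normalBlock q (c i) (r i)

/-- The matrix `E_{J₀}(x) = diag (L_{c_1,r_1}(x), …, L_{c_m,r_m}(x))`. -/
def normalSol {n m : ℕ} {r : Fin m → ℕ} (hr : ∑ i, r i = n) (c : Fin m → ℂ) (L : ℂ → ℂ)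
    (q h : ℝ) (x : ℂ) : Matrix (Fin n) (Fin n) ℂ :=
  blockDiag hr fun i => logBlock L q h (c i) (r i) x

/-- The domain in which solutions are considered: `V^{(q,h)}(l)`, and for `(q,h) = (1,0)` the part
of it where `(-x)^c` is defined, if `D` is the domain of the determination of the logarithm. -/
def solDomain (D : Set ℂ) (q h : ℝ) (l : ℂ) : Set ℂ :=
  if q = 1 ∧ h = 0 then {x | x ∈ V q h l ∧ -x ∈ D} else V q h l

/-- The matrix `X_can(x) = F(x) E_{A₀}(x)`, where `E_{A₀} = P E_{J₀} P⁻¹` is computed with the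
conjugating matrix `P`. -/
def canonicalSol {n m : ℕ} {r : Fin m → ℕ} (hr : ∑ i, r i = n) (c : Fin m → ℂ) (L : ℂ → ℂ)
    (q h : ℝ) (F : ℕ → Matrix (Fin n) (Fin n) ℂ) (P : GL (Fin n) ℂ) (x : ℂ) :
    Matrix (Fin n) (Fin n) ℂ :=
  qhSum q h F x * ((P : Matrix (Fin n) (Fin n) ℂ) * normalSol hr c L q h x *
    ((P⁻¹ : GL (Fin n) ℂ) : Matrix (Fin n) (Fin n) ℂ))

end QHDiff

end

/-!
The equation `δ Y = A Y` is reduced to `δ Z = A₀ Z` by a gauge transformation `Y = F Z`, and the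
constant system is solved by the characters and their derivatives in the exponent.

**The formal gauge transformation.** The operator `δ` multiplies the monomial `x^{-[s]}` by
`-[s]_q` (`qhMonomial_shift`), and a product `x^{-[s]} x^{-[t]}` is again a factorial series, with
nonnegative coefficients `structCoeff`. The gauge equation is therefore equivalent to a recursion
`(A₀ + [s]) F_s - q^s F_s A₀ = …` whose right-hand side involves only the `F_t` with `t < s`
(`isReducingGauge_iff`, `isGaugeRecursion_iff`). The left-hand side `gaugeOp` is a Sylvester
operator, injective because of non-resonance (`gaugeOp_injective_of_isNonresonant`), so the series
`F` exists and is unique.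

**Uniform bounds.** The operators `gaugeOp` are bounded below by `κ [s]_q` with the same `κ` for
the whole family (`exists_gaugeOp_lower_bound`). This is proved first for the normal form `J₀`,
which depends continuously on `q` in a compact set: by non-resonance for each small `s`, and for
large `s` because `gaugeOp / [s]_q` tends to `X ↦ X (I + (1-q) J₀)`, which is invertible.
Boundedness of the conjugating matrices and of their inverses transfers the bound to `A₀`. Since
the structure coefficients are nonnegative, the recursion can be majorized by a scalar one, and
the identity `M / (x-l) * (1 + M / (x-l-M)) = M / (x-l-M)` provides its solution
(`qNat_mul_norm_le`, `exists_uniform_bound`): the Fuchsian bound is a bound by the coefficients of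
the factorial series of a simple pole.

**Convergence.** On `V(μ)` the monomials are bounded by their values at `μ`
(`norm_qhMonomial_le`). Expanding `1 / (x-l)` and products of monomials leaves remainders which
are controlled by quotients of monomials at two real points, and these tend to zero as the
harmonic series diverges (`tendsto_prod_node_mul_monomial`). Hence the formal identities hold for
the sums of the series (`hasSum_qhConv`, `delta_qhSum_gauge`), and for large `μ` the sum `F` is
close to the identity, thus invertible (`isUnit_qhSum`).

**Solutions.** In each of the four cases the character `e_c` is a quotient of functions that are
jointly analytic in `c` and `x`, and satisfies `δ e_c = -[-c]_q e_c` (`CharQuotient`).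
Differentiating this equation in `c` shows that the logarithms form Jordan chains, that is,
`δ E = J₀ E` for the matrix `E = E_{J₀}` (`CharQuotient.delta_qhLog`,
`deltaMatrix_normalSol_eventually`). By the twisted Leibniz rule `F Q E` satisfies the equation up
to the defect `F((x-h)/q) (Q J₀ - A₀ Q) E` (`deltaMatrix_gauge_mul_normalSol`), whose outer
factors are invertible at generic points; so it is a solution if and only if `Q J₀ = A₀ Q`.

**Independence of the conjugation.** Two admissible `Q` differ by a matrix commuting with `J₀`.
Between two blocks of `J₀` with the same eigenvalue, an intertwiner of the blocks intertwines the
nilpotent matrices, hence also the blocks of `E` (`nilEval_comm`); between blocks with distinct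
eigenvalues it is zero. So the matrix commutes with `E` (`commute_normalSol`), and `Q E Q⁻¹` does
not depend on `Q`.
-/

noncomputable section

namespace QHDiff

section

/-! ### The numbers `[k]_q` and the iterates of `x ↦ q x + h` -/

/-- The value at `l` of the `k`-th iterate of `x ↦ q x + h`. -/
def qhNode (q h l : ℝ) (k : ℕ) : ℝ := q ^ k * l + h * qNat q k

lemma qNat_zero (q : ℝ) : qNat q 0 = 0 := by simp [qNat]

lemma qNat_succ (q : ℝ) (k : ℕ) : qNat q (k + 1) = q ^ k + qNat q k := by
  unfold qNat
  split_ifs with hq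
  · subst hq; push_cast; simp; ring
  · have : q - 1 ≠ 0 := sub_ne_zero.mpr hq
    field_simp
    ring

lemma qNat_succ' (q : ℝ) (k : ℕ) : qNat q (k + 1) = 1 + q * qNat q k := by
  induction k with
  | zero => simp [qNat_succ, qNat_zero]
  | succ k ih => rw [qNat_succ, ih]; rw [qNat_succ] at ih; linear_combination q * ih

lemma qNat_nonneg {q : ℝ} (hq : 1 ≤ q) (k : ℕ) : 0 ≤ qNat q k := by
  induction k with
  | zero => simp [qNat_zero]
  | succ k ih => rw [qNat_succ]; positivity

lemma qNat_add (q : ℝ) (i j : ℕ) : qNat q (i + j) = q ^ j * qNat q i + qNat q j := by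
  induction j with
  | zero => simp [qNat_zero]
  | succ k ih => rw [← add_assoc, qNat_succ', ih, qNat_succ' q k]; ring

lemma le_qNat {q : ℝ} (hq : 1 ≤ q) (k : ℕ) : (k : ℝ) ≤ qNat q k := by
  induction k with
  | zero => simp [qNat_zero]
  | succ k ih => rw [qNat_succ]; push_cast; linarith [one_le_pow₀ hq (n := k)]

lemma one_le_qNat {q : ℝ} (hq : 1 ≤ q) {k : ℕ} (hk : 1 ≤ k) : 1 ≤ qNat q k :=
  le_trans (by exact_mod_cast hk) (le_qNat hq k)

lemma pow_eq_qNat (q : ℝ) (k : ℕ) : q ^ k = 1 + (q - 1) * qNat q k := by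
  have h1 := qNat_succ q k
  have h2 := qNat_succ' q k
  linarith

lemma qNat_le_mul_pow {q : ℝ} (hq : 1 ≤ q) (k : ℕ) : qNat q k ≤ k * q ^ k := by
  induction k with
  | zero => simp [qNat_zero]
  | succ k ih =>
    rw [qNat_succ]
    have := one_le_pow₀ hq (n := k)
    push_cast
    have h2 : q ^ k ≤ q ^ (k + 1) := pow_le_pow_right₀ hq (by omega)
    nlinarith [(Nat.cast_nonneg k : (0:ℝ) ≤ k)]

lemma qhNode_nonneg {q h l : ℝ} (hq : 1 ≤ q) (hh : 0 ≤ h) (hl : 0 ≤ l) (k : ℕ) :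
    0 ≤ qhNode q h l k := by
  have := qNat_nonneg hq k
  unfold qhNode; positivity

lemma qhNode_pos {q h l : ℝ} (hq : 1 ≤ q) (hh : 0 ≤ h) (hl : 0 < l) (k : ℕ) :
    0 < qhNode q h l k := by
  have := qNat_nonneg hq k
  unfold qhNode; positivity

lemma qhNode_mono {q h l l' : ℝ} (hq : 1 ≤ q) (hl : l ≤ l') (k : ℕ) :
    qhNode q h l k ≤ qhNode q h l' k := by
  unfold qhNode; gcongr

/-- For real `y` the inverse of the monomial `y^{-[s]}` is a product of nodes. -/
lemma qhMonomial_real (q h l : ℝ) (s : ℕ) :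
    qhMonomial q h l s = (∏ k ∈ Finset.range s, qhNode q h l k)⁻¹ := rfl

/-! ### Products of factorial monomials -/

/-- Coefficients of the iterated rewriting of `x^{-[s]} x^{-[t]}`: after `k` steps this product is
the sum of monomials already obtained and of the terms with coefficient `transferCoeff q h s k i`
times `x^{-[s+k]}` times the inverses of the factors `i, …, t-1` of the second monomial. -/
def transferCoeff (q h : ℝ) (s : ℕ) : ℕ → ℕ → ℝ
  | 0, 0 => 1
  | 0, _ + 1 => 0
  | k + 1, 0 => h * qNat q (s + k) * transferCoeff q h s k 0
  | k + 1, i + 1 => h * qNat q (s + k - (i + 1)) * transferCoeff q h s k (i + 1) +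
      q ^ (s + k - i) * transferCoeff q h s k i

/-- The coefficient of `x^{-[j]}` in the product `x^{-[s]} x^{-[t]}`. It vanishes for `j < s + t`,
and for `t = 0` the product is the single monomial `x^{-[s]}`. -/
def structCoeff (q h : ℝ) (s t j : ℕ) : ℝ :=
  if s + t ≤ j then
    match t with
    | 0 => if j = s then 1 else 0
    | t' + 1 => q ^ (j - 1 - t') * transferCoeff q h s (j - 1 - s) t'
  else 0

lemma transferCoeff_eq_zero (q h : ℝ) (s : ℕ) : ∀ k i : ℕ, k < i → transferCoeff q h s k i = 0
  | 0, 0, hi => absurd hi (by simp)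
  | 0, _ + 1, _ => rfl
  | k + 1, 0, hi => absurd hi (by simp)
  | k + 1, i + 1, hi => by
    rw [transferCoeff, transferCoeff_eq_zero q h s k (i + 1) (by omega),
      transferCoeff_eq_zero q h s k i (by omega)]
    simp

lemma transferCoeff_nonneg {q h : ℝ} (hq : 1 ≤ q) (hh : 0 ≤ h) (s : ℕ) :
    ∀ k i : ℕ, 0 ≤ transferCoeff q h s k i
  | 0, 0 => zero_le_one
  | 0, _ + 1 => le_rfl
  | k + 1, 0 => by
    rw [transferCoeff]
    exact mul_nonneg (mul_nonneg hh (qNat_nonneg hq _)) (transferCoeff_nonneg hq hh s k 0)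
  | k + 1, i + 1 => by
    rw [transferCoeff]
    exact add_nonneg
      (mul_nonneg (mul_nonneg hh (qNat_nonneg hq _)) (transferCoeff_nonneg hq hh s k (i + 1)))
      (mul_nonneg (by positivity) (transferCoeff_nonneg hq hh s k i))

lemma structCoeff_nonneg {q h : ℝ} (hq : 1 ≤ q) (hh : 0 ≤ h) (s t j : ℕ) :
    0 ≤ structCoeff q h s t j := by
  by_cases hj : s + t ≤ j
  · rw [structCoeff.eq_def, if_pos hj]
    cases t with
    | zero => positivity
    | succ t => exact mul_nonneg (by positivity) (transferCoeff_nonneg hq hh _ _ _)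
  · rw [structCoeff.eq_def, if_neg hj]

lemma structCoeff_eq_zero {q h : ℝ} {s t j : ℕ} (hj : j < s + t) : structCoeff q h s t j = 0 := by
  unfold structCoeff; rw [if_neg (by omega)]

lemma structCoeff_zero_right (q h : ℝ) (s k : ℕ) :
    structCoeff q h s 0 (s + k) = if k = 0 then 1 else 0 := by
  simp [structCoeff]

lemma structCoeff_zero_left (q h : ℝ) (j : ℕ) (s : ℕ) :
    structCoeff q h s 0 j = if j = s then 1 else 0 := by
  unfold structCoeff
  by_cases h1 : s ≤ j
  · simp [h1]
  · rw [if_neg (by omega), if_neg (by omega)]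

lemma structCoeff_succ_right (q h : ℝ) (s t k : ℕ) :
    structCoeff q h s (t + 1) (s + (k + 1)) = q ^ (s + k - t) * transferCoeff q h s k t := by
  by_cases hk : s + (t + 1) ≤ s + (k + 1)
  · rw [structCoeff.eq_def, if_pos hk]
    have e : s + (k + 1) - 1 - s = k := by omega
    have e' : s + (k + 1) - 1 - t = s + k - t := by omega
    simp only [e, e']
  · rw [structCoeff.eq_def, if_neg hk, transferCoeff_eq_zero _ _ _ _ _ (by omega), mul_zero]

section Ring

variable {R : Type*} [CommRing R] [Algebra ℝ R]

/-- The relations between the inverses `u k` of the iterates `q^k x + h[k]_q` of `x`: the `j`-th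
iterate is `q^(j-i)` times the `i`-th one plus `h[j-i]_q`. They are all that is needed to expand
products of monomials, both in power series in `1/x` and at points of the plane. -/
def IsNodeInverse (q h : ℝ) (u : ℕ → R) : Prop :=
  ∀ i j, i ≤ j → u i = q ^ (j - i) • u j + (h * qNat q (j - i)) • (u j * u i)

/-- The remainder in the expansion of `x^{-[s]} x^{-[t]}` truncated at order `s + k`. -/
def prodRemainder (q h : ℝ) (u : ℕ → R) (s t k : ℕ) : R :=
  ∑ i ∈ Finset.range t, transferCoeff q h s k i •
    ((∏ l ∈ Finset.range (s + k), u l) * ∏ l ∈ Finset.Ico i t, u l)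

/-- One step of the expansion: in each term of the remainder the first factor `u i` of the second
monomial is rewritten in terms of `u (s + k)` and `u (s + k) * u i`. -/
lemma prodRemainder_succ {q h : ℝ} {u : ℕ → R} (hu : IsNodeInverse q h u) (s t k : ℕ) :
    prodRemainder q h u s t k =
      structCoeff q h s t (s + (k + 1)) • (∏ l ∈ Finset.range (s + (k + 1)), u l) +
        prodRemainder q h u s t (k + 1) := by
  cases t with
  | zero => simp [prodRemainder, structCoeff_zero_right]
  | succ t =>
    have key : ∀ i ∈ Finset.range (t + 1), transferCoeff q h s k i •
        ((∏ l ∈ Finset.range (s + k), u l) * ∏ l ∈ Finset.Ico i (t + 1), u l) =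
        (q ^ (s + k - i) * transferCoeff q h s k i) •
          ((∏ l ∈ Finset.range (s + (k + 1)), u l) * ∏ l ∈ Finset.Ico (i + 1) (t + 1), u l) +
        (h * qNat q (s + k - i) * transferCoeff q h s k i) •
          ((∏ l ∈ Finset.range (s + (k + 1)), u l) * ∏ l ∈ Finset.Ico i (t + 1), u l) := by
      intro i hi
      rw [Finset.mem_range] at hi
      by_cases hik : i ≤ k
      · rw [Finset.prod_eq_prod_Ico_succ_bot hi, ← add_assoc, Finset.prod_range_succ]
        conv_lhs => rw [hu i (s + k) (by omega)]
        simp only [Algebra.smul_def, map_mul]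
        ring
      · rw [transferCoeff_eq_zero _ _ _ _ _ (by omega)]
        simp
    unfold prodRemainder
    rw [Finset.sum_congr rfl key, Finset.sum_add_distrib, Finset.sum_range_succ,
      structCoeff_succ_right, Finset.sum_range_succ' (n := t), Finset.sum_range_succ' (n := t)]
    simp only [transferCoeff, add_smul, Finset.sum_add_distrib, Finset.Ico_self, Finset.prod_empty,
      mul_one, Nat.sub_zero]
    abel

/-- Expansion of a product of monomials, with remainder. -/
lemma prod_mul_prod_eq {q h : ℝ} {u : ℕ → R} (hu : IsNodeInverse q h u) (s t K : ℕ) :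
    (∏ l ∈ Finset.range s, u l) * (∏ l ∈ Finset.range t, u l) =
      ∑ j ∈ Finset.range (s + K + 1), structCoeff q h s t j • (∏ l ∈ Finset.range j, u l) +
        prodRemainder q h u s t K := by
  induction K with
  | zero =>
    rw [add_zero, Finset.sum_range_succ, Finset.sum_eq_zero, zero_add]
    · cases t with
      | zero => simp [prodRemainder, structCoeff_zero_left]
      | succ t =>
        rw [structCoeff_eq_zero (by omega), prodRemainder, Finset.sum_range_succ',
          Finset.sum_eq_zero]
        · simp [transferCoeff]
        · intro i _
          rw [transferCoeff_eq_zero _ _ _ _ _ (by omega), zero_smul]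
    · intro j hj
      rw [Finset.mem_range] at hj
      rw [structCoeff_eq_zero (by omega), zero_smul]
  | succ K ih =>
    rw [ih, prodRemainder_succ hu, ← add_assoc (Finset.sum _ _), ← add_assoc s K 1,
      Finset.sum_range_succ _ (s + K + 1)]

/-- The coefficients of the factorial series of `1 / (x - l)`. Up to a constant they are the bounds
in the definition of Fuchsian families. -/
def poleCoeff (q h l : ℝ) : ℕ → ℝ
  | 0 => 0
  | s + 1 => q ^ s * ∏ k ∈ Finset.range s, qhNode q h l k

/-- Expansion of `v = 1 / (x - l)`, with remainder. -/
lemma pole_eq_sum {q h l : ℝ} {u : ℕ → R} {v : R}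
    (hv : ∀ s, v = q ^ s • u s + qhNode q h l s • (u s * v)) (K : ℕ) :
    v = ∑ s ∈ Finset.range (K + 1), poleCoeff q h l s • (∏ k ∈ Finset.range s, u k) +
      (∏ k ∈ Finset.range K, qhNode q h l k) • ((∏ k ∈ Finset.range K, u k) * v) := by
  induction K with
  | zero => simp [poleCoeff]
  | succ K ih =>
    rw [Finset.sum_range_succ, add_assoc]
    conv_lhs => rw [ih]
    congr 1
    conv_lhs => rw [hv K]
    rw [poleCoeff, Finset.prod_range_succ _ K, Finset.prod_range_succ _ K]
    simp only [Algebra.smul_def, map_mul]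
    ring

end Ring

lemma poleCoeff_nonneg {q h l : ℝ} (hq : 1 ≤ q) (hh : 0 ≤ h) (hl : 0 ≤ l) (s : ℕ) :
    0 ≤ poleCoeff q h l s := by
  cases s with
  | zero => exact le_rfl
  | succ s =>
    exact mul_nonneg (by positivity) (Finset.prod_nonneg fun k _ => qhNode_nonneg hq hh hl k)

lemma poleCoeff_mono {q h l l' : ℝ} (hq : 1 ≤ q) (hh : 0 ≤ h) (hl : 0 ≤ l) (hl' : l ≤ l') (s : ℕ) :
    poleCoeff q h l s ≤ poleCoeff q h l' s := by
  cases s with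
  | zero => exact le_rfl
  | succ s =>
    exact mul_le_mul_of_nonneg_left (Finset.prod_le_prod (fun k _ => qhNode_nonneg hq hh hl k)
      fun k _ => qhNode_mono hq hl' k) (by positivity)

/-- The product of two `(q,h)`-factorial series, on coefficients. -/
def qhConv {M : Type*} [NonUnitalNonAssocSemiring M] [Module ℝ M] (q h : ℝ) (a b : ℕ → M) (j : ℕ) :
    M :=
  ∑ s ∈ Finset.range (j + 1), ∑ t ∈ Finset.range (j + 1), structCoeff q h s t j • (a s * b t)

end

section

/-! ### Monomials and the shift `x ↦ (x - h)/q` in a field -/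

section Field

variable {K : Type*} [Field K] [Algebra ℝ K]

lemma qhMonomial_succ (q h : ℝ) (x : K) (s : ℕ) :
    qhMonomial q h x (s + 1) = qhMonomial q h x s *
      (algebraMap ℝ K (q ^ s) * x + algebraMap ℝ K (h * qNat q s))⁻¹ := by
  rw [qhMonomial, Finset.prod_range_succ, mul_inv, ← qhMonomial]

lemma qhMonomial_eq_prod (q h : ℝ) (x : K) (s : ℕ) :
    qhMonomial q h x s = ∏ k ∈ Finset.range s,
      (algebraMap ℝ K (q ^ k) * x + algebraMap ℝ K (h * qNat q k))⁻¹ := by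
  rw [qhMonomial, Finset.prod_inv_distrib]

/-- The nodes at `y = (x - h)/q` are those at `x` with the index lowered by one. -/
lemma node_shift {q : ℝ} (hq : q ≠ 0) (h : ℝ) (x : K) (k : ℕ) :
    algebraMap ℝ K (q ^ (k + 1)) * (algebraMap ℝ K q⁻¹ * (x - algebraMap ℝ K h)) +
        algebraMap ℝ K (h * qNat q (k + 1)) =
      algebraMap ℝ K (q ^ k) * x + algebraMap ℝ K (h * qNat q k) := by
  have e : algebraMap ℝ K (q ^ (k + 1)) * algebraMap ℝ K q⁻¹ = algebraMap ℝ K (q ^ k) := by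
    rw [← map_mul, pow_succ, mul_assoc, mul_inv_cancel₀ hq, mul_one]
  rw [← mul_assoc, e, qNat_succ]
  simp only [map_mul, map_add]
  ring

lemma qhMonomial_shift_succ {q : ℝ} (hq : q ≠ 0) (h : ℝ) (x : K) (s : ℕ) :
    qhMonomial q h (algebraMap ℝ K q⁻¹ * (x - algebraMap ℝ K h)) (s + 1) =
      (algebraMap ℝ K q⁻¹ * (x - algebraMap ℝ K h))⁻¹ * qhMonomial q h x s := by
  rw [qhMonomial_eq_prod, Finset.prod_range_succ', mul_comm, qhMonomial_eq_prod]
  congr 1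
  · simp [qNat_zero]
  · exact Finset.prod_congr rfl fun k _ => by rw [node_shift hq]

lemma shift_ratio {q : ℝ} (hq : q ≠ 0) {h : ℝ} {x : K} (hx : x - algebraMap ℝ K h ≠ 0) :
    (algebraMap ℝ K q⁻¹ * (x - algebraMap ℝ K h) - x) /
        (algebraMap ℝ K q⁻¹ * (x - algebraMap ℝ K h)) =
      algebraMap ℝ K (1 - q) - algebraMap ℝ K (q * h) * (x - algebraMap ℝ K h)⁻¹ := by
  have hq' : algebraMap ℝ K q ≠ 0 := by simpa using hq
  simp only [map_inv₀, map_sub, map_mul, map_one]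
  field_simp
  ring

/-- The effect of the shift on monomials; equivalently, `δ x^{-[s]} = -[s] x^{-[s]}`. -/
lemma qhMonomial_shift {q : ℝ} (hq : q ≠ 0) {h : ℝ} {x : K} (hx : x - algebraMap ℝ K h ≠ 0)
    (hn : ∀ k, algebraMap ℝ K (q ^ k) * x + algebraMap ℝ K (h * qNat q k) ≠ 0) (s : ℕ) :
    qhMonomial q h (algebraMap ℝ K q⁻¹ * (x - algebraMap ℝ K h)) s =
      qhMonomial q h x s - algebraMap ℝ K (qNat q s) * qhMonomial q h x s *
        ((algebraMap ℝ K q⁻¹ * (x - algebraMap ℝ K h) - x) /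
          (algebraMap ℝ K q⁻¹ * (x - algebraMap ℝ K h))) := by
  cases s with
  | zero => simp [qhMonomial, qNat_zero]
  | succ s =>
    rw [qhMonomial_shift_succ hq, shift_ratio hq hx, qhMonomial_succ]
    have hns := hn s
    have hq' : algebraMap ℝ K q ≠ 0 := by simpa using hq
    have e := congrArg (algebraMap ℝ K) (qNat_succ q s)
    have e' := congrArg (algebraMap ℝ K) (qNat_succ' q s)
    simp only [map_inv₀, map_sub, map_mul, map_one, map_add, map_pow] at *
    generalize algebraMap ℝ K q = Q at *
    generalize algebraMap ℝ K h = H at *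
    generalize algebraMap ℝ K (qNat q s) = S at *
    generalize algebraMap ℝ K (qNat q (s + 1)) = S' at *
    generalize hz : Q ^ s * x + H * S = z at *
    have : (Q⁻¹ * (x - H))⁻¹ = z⁻¹ - S' * z⁻¹ * (1 - Q - Q * H * (x - H)⁻¹) := by
      field_simp
      subst hz e
      linear_combination (x - H) * e'
    rw [mul_comm, this]
    ring

end Field

/-! ### Formal factorial series as power series in `1/x` -/

open PowerSeries

/-- The expansion of `1 / (q^k x + h[k]_q)` in powers of `X = 1/x`. -/
def formalNodeInv (q h : ℝ) (k : ℕ) : PowerSeries ℂ :=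
  X * (C ((q ^ k : ℝ) : ℂ) + C ((h * qNat q k : ℝ) : ℂ) * X)⁻¹

/-- The expansion of `1 / (x - l)` in powers of `X = 1/x`. -/
def formalPole (l : ℝ) : PowerSeries ℂ := X * (1 - C (l : ℂ) * X)⁻¹

lemma formalNode_mul_inv {q : ℝ} (hq : q ≠ 0) (h : ℝ) (k : ℕ) :
    (C ((q ^ k : ℝ) : ℂ) + C ((h * qNat q k : ℝ) : ℂ) * X) *
      (C ((q ^ k : ℝ) : ℂ) + C ((h * qNat q k : ℝ) : ℂ) * X)⁻¹ = (1 : PowerSeries ℂ) :=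
  PowerSeries.mul_inv_cancel _ (by simp [hq])

lemma formalPole_den_mul_inv (l : ℝ) :
    (1 - C (l : ℂ) * X) * (1 - C (l : ℂ) * X)⁻¹ = (1 : PowerSeries ℂ) :=
  PowerSeries.mul_inv_cancel _ (by simp)

lemma powerSeries_algebraMap (r : ℝ) : algebraMap ℝ (PowerSeries ℂ) r = C (r : ℂ) := by
  rw [PowerSeries.algebraMap_apply]; rfl

lemma isNodeInverse_formal {q : ℝ} (hq : q ≠ 0) (h : ℝ) :
    IsNodeInverse q h (formalNodeInv q h) := by
  intro i j hij
  obtain ⟨d, rfl⟩ := Nat.exists_eq_add_of_le hij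
  have hi := formalNode_mul_inv hq h i
  have hj := formalNode_mul_inv hq h (i + d)
  have e : (C ((q ^ (i + d) : ℝ) : ℂ) + C ((h * qNat q (i + d) : ℝ) : ℂ) * X : PowerSeries ℂ) =
      C ((q ^ d : ℝ) : ℂ) * (C ((q ^ i : ℝ) : ℂ) + C ((h * qNat q i : ℝ) : ℂ) * X) +
        C ((h * qNat q d : ℝ) : ℂ) * X := by
    rw [qNat_add, pow_add]; push_cast; simp only [map_mul, map_add, map_pow]; ring
  simp only [formalNodeInv, Algebra.smul_def, powerSeries_algebraMap, Nat.add_sub_cancel_left]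
  generalize (C ((q ^ (i + d) : ℝ) : ℂ) + C ((h * qNat q (i + d) : ℝ) : ℂ) * X :
    PowerSeries ℂ) = Dj at *
  generalize (C ((q ^ i : ℝ) : ℂ) + C ((h * qNat q i : ℝ) : ℂ) * X : PowerSeries ℂ) = Di at *
  subst e
  linear_combination (-(X * Di⁻¹)) * hj + X * C ((q ^ d : ℝ) : ℂ) * (C ((q ^ d : ℝ) : ℂ) * Di +
        C ((h * qNat q d : ℝ) : ℂ) * X)⁻¹ * hi

lemma formalPole_rec {q : ℝ} (hq : q ≠ 0) (h l : ℝ) (s : ℕ) :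
    formalPole l = q ^ s • formalNodeInv q h s +
      qhNode q h l s • (formalNodeInv q h s * formalPole l) := by
  have hi := formalNode_mul_inv hq h s
  have hj := formalPole_den_mul_inv l
  simp only [formalNodeInv, formalPole, Algebra.smul_def, powerSeries_algebraMap, qhNode]
  generalize hE : (C ((q ^ s : ℝ) : ℂ) + C ((h * qNat q s : ℝ) : ℂ) * X : PowerSeries ℂ)⁻¹ = E at *
  generalize (1 - C (l : ℂ) * X : PowerSeries ℂ)⁻¹ = G at *
  push_cast at *
  simp only [map_mul, map_add, map_pow] at *
  linear_combination (-(X * G)) * hi + X * C (q : ℂ) ^ s * E * hj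

/-- The expansion of `x^{-[s]}` in powers of `1/x`. -/
def formalMonomial (q h : ℝ) (s : ℕ) : PowerSeries ℂ :=
  ∏ k ∈ Finset.range s, formalNodeInv q h k

lemma X_pow_dvd_formalMonomial (q h : ℝ) (s : ℕ) : X ^ s ∣ formalMonomial q h s := by
  unfold formalMonomial
  induction s with
  | zero => simp
  | succ s ih =>
    rw [Finset.prod_range_succ, pow_succ]
    exact mul_dvd_mul ih ⟨_, rfl⟩

lemma coeff_formalMonomial_self {q : ℝ} (hq : q ≠ 0) (h : ℝ) (s : ℕ) :
    coeff s (formalMonomial q h s) ≠ 0 := by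
  have : formalMonomial q h s = X ^ s * ∏ k ∈ Finset.range s,
      (C ((q ^ k : ℝ) : ℂ) + C ((h * qNat q k : ℝ) : ℂ) * X)⁻¹ := by
    simp only [formalMonomial, formalNodeInv]
    rw [Finset.prod_mul_distrib, Finset.prod_const, Finset.card_range]
  have h2 := PowerSeries.coeff_X_pow_mul (∏ k ∈ Finset.range s,
      (C ((q ^ k : ℝ) : ℂ) + C ((h * qNat q k : ℝ) : ℂ) * X)⁻¹) s 0
  rw [zero_add] at h2
  rw [this, h2, coeff_zero_eq_constantCoeff_apply, map_prod, Finset.prod_ne_zero_iff]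
  intro k _
  simp [hq]

/-- The sum of the formal series `∑ a s • g s`, when `X ^ s` divides `g s`. -/
def formalSeries (g : ℕ → PowerSeries ℂ) (a : ℕ → ℂ) : PowerSeries ℂ :=
  PowerSeries.mk fun k => ∑ s ∈ Finset.range (k + 1), a s * coeff k (g s)

lemma eq_of_forall_X_pow_dvd_sub {f g : PowerSeries ℂ} (hfg : ∀ K, X ^ K ∣ f - g) : f = g := by
  ext k
  have := X_pow_dvd_iff.mp (hfg (k + 1)) k (by omega)
  rw [map_sub] at this
  exact sub_eq_zero.mp this

lemma formalSeries_sub_sum_dvd {g : ℕ → PowerSeries ℂ} (hg : ∀ s, X ^ s ∣ g s) (a : ℕ → ℂ)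
    (K : ℕ) : X ^ K ∣ formalSeries g a - ∑ s ∈ Finset.range K, C (a s) * g s := by
  rw [X_pow_dvd_iff]
  intro k hk
  rw [map_sub, formalSeries, coeff_mk, map_sum, sub_eq_zero]
  simp only [coeff_C_mul]
  refine Finset.sum_subset (by intro s; simp; omega) fun s _ hs => ?_
  rw [X_pow_dvd_iff.mp (hg s) k (by simpa using hs), mul_zero]

lemma formalSeries_eq {g : ℕ → PowerSeries ℂ} (hg : ∀ s, X ^ s ∣ g s) {a : ℕ → ℂ}
    {f : PowerSeries ℂ} (hf : ∀ K, X ^ K ∣ f - ∑ s ∈ Finset.range K, C (a s) * g s) :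
    f = formalSeries g a := by
  refine eq_of_forall_X_pow_dvd_sub fun K => ?_
  have := dvd_sub (hf K) (formalSeries_sub_sum_dvd hg a K)
  simpa using this

lemma mul_formalSeries {g : ℕ → PowerSeries ℂ} (hg : ∀ s, X ^ s ∣ g s) (a : ℕ → ℂ)
    (f : PowerSeries ℂ) : f * formalSeries g a = formalSeries (fun s => f * g s) a := by
  refine formalSeries_eq (fun s => (hg s).mul_left f) fun K => ?_
  have := (formalSeries_sub_sum_dvd hg a K).mul_left f
  rw [mul_sub, Finset.mul_sum] at this
  convert this using 3
  ext; ring_nf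

lemma formalSeries_add_left (g g' : ℕ → PowerSeries ℂ) (a : ℕ → ℂ) :
    formalSeries (fun s => g s + g' s) a = formalSeries g a + formalSeries g' a := by
  ext k; simp [formalSeries, mul_add, Finset.sum_add_distrib]

lemma formalSeries_add (g : ℕ → PowerSeries ℂ) (a b : ℕ → ℂ) :
    formalSeries g (a + b) = formalSeries g a + formalSeries g b := by
  ext k; simp [formalSeries, add_mul, Finset.sum_add_distrib]

lemma formalSeries_smul (g : ℕ → PowerSeries ℂ) (z : ℂ) (a : ℕ → ℂ) :
    formalSeries g (z • a) = C z * formalSeries g a := by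
  ext k; simp [formalSeries, Finset.mul_sum, mul_assoc]

lemma formalSeries_sum {ι : Type*} (g : ℕ → PowerSeries ℂ) (S : Finset ι) (a : ι → ℕ → ℂ) :
    formalSeries g (fun s => ∑ i ∈ S, a i s) = ∑ i ∈ S, formalSeries g (a i) := by
  ext k
  simp only [formalSeries, coeff_mk, map_sum, Finset.sum_mul]
  exact Finset.sum_comm

/-- Expansions in factorial series are unique. -/
lemma formalSeries_injective {g : ℕ → PowerSeries ℂ} (hg : ∀ s, coeff s (g s) ≠ 0) :
    Function.Injective (formalSeries g) := by
  intro a b hab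
  funext s
  induction s using Nat.strong_induction_on with
  | _ s ih =>
    have := congrArg (coeff s) hab
    simp only [formalSeries, coeff_mk, Finset.sum_range_succ] at this
    rw [Finset.sum_congr rfl fun t ht => by rw [ih t (Finset.mem_range.mp ht)]] at this
    exact mul_right_cancel₀ (hg s) (add_left_cancel this)

lemma formalMonomial_mul_dvd {q : ℝ} (hq : q ≠ 0) (h : ℝ) (s t K : ℕ) :
    X ^ K ∣ formalMonomial q h s * formalMonomial q h t -
      ∑ j ∈ Finset.range K, C (structCoeff q h s t j : ℂ) * formalMonomial q h j := by
  have e : ∑ j ∈ Finset.range (s + K + 1), structCoeff q h s t j • formalMonomial q h j =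
      ∑ j ∈ Finset.range K, C (structCoeff q h s t j : ℂ) * formalMonomial q h j +
        ∑ j ∈ Finset.Ico K (s + K + 1), structCoeff q h s t j • formalMonomial q h j := by
    rw [← Finset.sum_range_add_sum_Ico _ (by omega : K ≤ s + K + 1)]
    simp only [Algebra.smul_def, powerSeries_algebraMap]
  have := prod_mul_prod_eq (isNodeInverse_formal hq h) s t K
  simp only [← formalMonomial.eq_def] at this
  rw [this, e, add_assoc, add_sub_cancel_left]
  have hsm : ∀ (r : ℝ) {f : PowerSeries ℂ}, X ^ K ∣ f → X ^ K ∣ r • f := fun r f hf => by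
    rw [Algebra.smul_def]; exact hf.mul_left _
  refine dvd_add (Finset.dvd_sum fun j hj => hsm _ ?_) (Finset.dvd_sum fun j hj => hsm _ ?_)
  · exact (pow_dvd_pow _ (Finset.mem_Ico.mp hj).1).trans (X_pow_dvd_formalMonomial q h j)
  · exact Dvd.dvd.mul_right ((pow_dvd_pow _ (by omega)).trans
      (X_pow_dvd_formalMonomial q h (s + K))) _

/-- The product of formal factorial series is given by `qhConv`. -/
lemma formalSeries_mul {q : ℝ} (hq : q ≠ 0) (h : ℝ) (a b : ℕ → ℂ) :
    formalSeries (formalMonomial q h) a * formalSeries (formalMonomial q h) b =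
      formalSeries (formalMonomial q h) (qhConv q h a b) := by
  refine formalSeries_eq (X_pow_dvd_formalMonomial q h) fun K => ?_
  have ha := formalSeries_sub_sum_dvd (X_pow_dvd_formalMonomial q h) a K
  have hb := formalSeries_sub_sum_dvd (X_pow_dvd_formalMonomial q h) b K
  set f := formalSeries (formalMonomial q h) a
  set g := formalSeries (formalMonomial q h) b
  set f' := ∑ s ∈ Finset.range K, C (a s) * formalMonomial q h s with hf'
  set g' := ∑ s ∈ Finset.range K, C (b s) * formalMonomial q h s with hg'
  have h1 : X ^ K ∣ f' * g' -
      ∑ s ∈ Finset.range K, C (qhConv q h a b s) * formalMonomial q h s := by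
    have e : ∑ j ∈ Finset.range K, C (qhConv q h a b j) * formalMonomial q h j =
        ∑ s ∈ Finset.range K, ∑ t ∈ Finset.range K, C (a s) * C (b t) *
          ∑ j ∈ Finset.range K, C (structCoeff q h s t j : ℂ) * formalMonomial q h j := by
      simp only [Finset.mul_sum]
      rw [Finset.sum_congr rfl fun s _ => Finset.sum_comm, Finset.sum_comm]
      refine Finset.sum_congr rfl fun j hj => ?_
      rw [Finset.mem_range] at hj
      have e2 : qhConv q h a b j = ∑ s ∈ Finset.range K, ∑ t ∈ Finset.range K,
          structCoeff q h s t j • (a s * b t) := by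
        unfold qhConv
        rw [← Finset.sum_subset (Finset.range_subset_range.mpr (by omega : j + 1 ≤ K))]
        · refine Finset.sum_congr rfl fun s _ => ?_
          refine Finset.sum_subset (Finset.range_subset_range.mpr (by omega)) fun t _ ht => ?_
          rw [structCoeff_eq_zero (by simp at ht; omega), zero_smul]
        · intro s _ hs
          refine Finset.sum_eq_zero fun t _ => ?_
          rw [structCoeff_eq_zero (by simp at hs; omega), zero_smul]
      rw [e2, map_sum, Finset.sum_mul]
      refine Finset.sum_congr rfl fun s _ => ?_
      rw [map_sum, Finset.sum_mul]
      refine Finset.sum_congr rfl fun t _ => ?_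
      rw [Complex.real_smul, map_mul, map_mul]
      ring
    rw [e, hf', hg', Finset.sum_mul_sum, ← Finset.sum_sub_distrib]
    refine Finset.dvd_sum fun s _ => ?_
    rw [← Finset.sum_sub_distrib]
    refine Finset.dvd_sum fun t _ => ?_
    have := (formalMonomial_mul_dvd hq h s t K).mul_left (C (a s) * C (b t))
    convert this using 1
    ring
  have h2 : f * g - ∑ s ∈ Finset.range K, C (qhConv q h a b s) * formalMonomial q h s =
      (f - f') * g + f' * (g - g') + (f' * g' -
        ∑ s ∈ Finset.range K, C (qhConv q h a b s) * formalMonomial q h s) := by ring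
  rw [h2]
  exact dvd_add (dvd_add (ha.mul_right _) (hb.mul_left _)) h1

lemma formalPole_eq_formalSeries {q : ℝ} (hq : q ≠ 0) (h l : ℝ) :
    formalPole l = formalSeries (formalMonomial q h) (fun s => (poleCoeff q h l s : ℂ)) := by
  refine formalSeries_eq (X_pow_dvd_formalMonomial q h) fun K => ?_
  have e := pole_eq_sum (formalPole_rec hq h l) K
  simp only [← formalMonomial.eq_def] at e
  have e2 : ∑ s ∈ Finset.range (K + 1), poleCoeff q h l s • formalMonomial q h s =
      ∑ s ∈ Finset.range K, C (poleCoeff q h l s : ℂ) * formalMonomial q h s +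
        C (poleCoeff q h l K : ℂ) * formalMonomial q h K := by
    rw [Finset.sum_range_succ]; simp only [Algebra.smul_def, powerSeries_algebraMap]
  rw [e2] at e
  conv_rhs => rw [e]
  rw [add_assoc, add_sub_cancel_left]
  refine dvd_add ((X_pow_dvd_formalMonomial q h K).mul_left _) ?_
  rw [Algebra.smul_def]
  exact ((X_pow_dvd_formalMonomial q h K).mul_right _).mul_left _

end

section

open PowerSeries

/-! ### The formal gauge equation on coefficients -/

local notation "ι" => HahnSeries.ofPowerSeries ℤ ℂ

lemma ofPowerSeries_C_ofReal (r : ℝ) :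
    ι (C (r : ℂ)) = algebraMap ℝ (LaurentSeries ℂ) r := by
  rw [← powerSeries_algebraMap]; rfl

lemma laurent_algebraMap_real (r : ℝ) :
    algebraMap ℝ (LaurentSeries ℂ) r = HahnSeries.C (r : ℂ) := by
  rw [← ofPowerSeries_C_ofReal, HahnSeries.ofPowerSeries_C]

lemma laurent_algebraMap (z : ℂ) : algebraMap ℂ (LaurentSeries ℂ) z = ι (C z) := by
  rw [HahnSeries.algebraMap_apply', PowerSeries.algebraMap_apply]; rfl

lemma X_mul_formalX : ι X * formalX = 1 := by
  rw [HahnSeries.ofPowerSeries_X, formalX, HahnSeries.single_mul_single]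
  simp

lemma formalNode_mul (q h : ℝ) (hq : q ≠ 0) (k : ℕ) :
    ι (formalNodeInv q h k) * (algebraMap ℝ (LaurentSeries ℂ) (q ^ k) * formalX +
      algebraMap ℝ (LaurentSeries ℂ) (h * qNat q k)) = 1 := by
  have h1 := congrArg ι (formalNode_mul_inv hq h k)
  rw [map_mul, map_add, map_mul, map_one, ofPowerSeries_C_ofReal, ofPowerSeries_C_ofReal] at h1
  rw [formalNodeInv, map_mul]
  linear_combination h1 + ι (C ((q ^ k : ℝ) : ℂ) + C ((h * qNat q k : ℝ) : ℂ) * X)⁻¹ *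
    algebraMap ℝ (LaurentSeries ℂ) (q ^ k) * X_mul_formalX

lemma formalPole_mul (l : ℝ) :
    ι (formalPole l) * (formalX - algebraMap ℝ (LaurentSeries ℂ) l) = 1 := by
  have h1 := congrArg ι (formalPole_den_mul_inv l)
  rw [map_mul, map_sub, map_mul, map_one, ofPowerSeries_C_ofReal] at h1
  rw [formalPole, map_mul]
  linear_combination h1 + ι (1 - C (l : ℂ) * X)⁻¹ * X_mul_formalX

lemma qhMonomial_formalX {q : ℝ} (hq : q ≠ 0) (h : ℝ) (s : ℕ) :
    qhMonomial q h formalX s = ι (formalMonomial q h s) := by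
  rw [qhMonomial_eq_prod, formalMonomial, map_prod]
  refine Finset.prod_congr rfl fun k _ => ?_
  exact (eq_inv_of_mul_eq_one_left (formalNode_mul q h hq k)).symm

/-- The expansion of `(y - x)/y`, where `y = (x - h)/q`. -/
def formalRatio (q h : ℝ) : PowerSeries ℂ :=
  C ((1 - q : ℝ) : ℂ) - C ((q * h : ℝ) : ℂ) * formalPole h

/-- The expansion of the monomial `y^{-[s]}` at `y = (x - h)/q`. -/
def formalShiftMonomial (q h : ℝ) (s : ℕ) : PowerSeries ℂ :=
  formalMonomial q h s + formalRatio q h * (C ((-qNat q s : ℝ) : ℂ) * formalMonomial q h s)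

lemma formalX_sub_ne_zero (h : ℝ) : formalX - algebraMap ℝ (LaurentSeries ℂ) h ≠ 0 :=
  right_ne_zero_of_mul_eq_one (formalPole_mul h)

lemma formalShiftX_ne_zero {q : ℝ} (hq : q ≠ 0) (h : ℝ) : formalShiftX q h ≠ 0 :=
  mul_ne_zero (by simpa using hq) (formalX_sub_ne_zero h)

lemma ofPowerSeries_formalRatio {q : ℝ} (hq : q ≠ 0) (h : ℝ) :
    ι (formalRatio q h) = (formalShiftX q h - formalX) / formalShiftX q h := by
  rw [formalShiftX, shift_ratio hq (formalX_sub_ne_zero h), formalRatio, map_sub, map_mul,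
    ofPowerSeries_C_ofReal, ofPowerSeries_C_ofReal,
    eq_inv_of_mul_eq_one_left (formalPole_mul h)]

lemma qhMonomial_formalShiftX {q : ℝ} (hq : q ≠ 0) (h : ℝ) (s : ℕ) :
    qhMonomial q h (formalShiftX q h) s = ι (formalShiftMonomial q h s) := by
  rw [formalShiftMonomial, map_add, map_mul, map_mul, ofPowerSeries_C_ofReal,
    ofPowerSeries_formalRatio hq, ← qhMonomial_formalX hq, formalShiftX,
    qhMonomial_shift hq (formalX_sub_ne_zero h)
      (fun k => right_ne_zero_of_mul_eq_one (formalNode_mul q h hq k)), map_neg]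
  ring

variable {n : ℕ}

/-- The matrix of power series with factorial coefficients `a s`. -/
def formalMatrix (q h : ℝ) (a : ℕ → Matrix (Fin n) (Fin n) ℂ) :
    Matrix (Fin n) (Fin n) (PowerSeries ℂ) :=
  Matrix.of fun i j => formalSeries (formalMonomial q h) fun s => a s i j

lemma formalSum_eq_of_monomial {q h : ℝ} (a : ℕ → Matrix (Fin n) (Fin n) ℂ)
    {y : LaurentSeries ℂ} {g : ℕ → PowerSeries ℂ} (hy : ∀ s, qhMonomial q h y s = ι (g s)) :
    formalSum q h a y = (Matrix.of fun i j => formalSeries g fun s => a s i j).map ι := by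
  ext1 i j
  simp only [formalSum, Matrix.of_apply, Matrix.map_apply, formalSeries]
  congr 2
  funext k
  refine Finset.sum_congr rfl fun s _ => ?_
  rw [hy, HahnSeries.ofPowerSeries_apply_coeff]

lemma formalSum_formalX {q : ℝ} (hq : q ≠ 0) (h : ℝ) (a : ℕ → Matrix (Fin n) (Fin n) ℂ) :
    formalSum q h a formalX = (formalMatrix q h a).map ι :=
  formalSum_eq_of_monomial a (qhMonomial_formalX hq h)

/-- The coefficients of `-δ` of a factorial series. -/
def qNatSMul (q : ℝ) (a : ℕ → Matrix (Fin n) (Fin n) ℂ) (s : ℕ) : Matrix (Fin n) (Fin n) ℂ :=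
  (qNat q s : ℂ) • a s

lemma formalShiftSeries_eq (q h : ℝ) (a : ℕ → ℂ) :
    formalSeries (formalShiftMonomial q h) a = formalSeries (formalMonomial q h) a -
      formalRatio q h * formalSeries (formalMonomial q h) (fun s => (qNat q s : ℂ) * a s) := by
  have e : formalShiftMonomial q h = fun s => formalMonomial q h s +
    formalRatio q h * (C ((-qNat q s : ℝ) : ℂ) * formalMonomial q h s) := rfl
  rw [e, formalSeries_add_left, ← mul_formalSeries
    (fun s => (X_pow_dvd_formalMonomial q h s).mul_left _), sub_eq_add_neg, ← mul_neg]
  congr 2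
  ext k
  simp only [formalSeries, coeff_mk, coeff_C_mul, map_neg, ← Finset.sum_neg_distrib]
  refine Finset.sum_congr rfl fun s _ => ?_
  push_cast
  ring

lemma formalSum_formalShiftX {q : ℝ} (hq : q ≠ 0) (h : ℝ) (a : ℕ → Matrix (Fin n) (Fin n) ℂ) :
    formalSum q h a (formalShiftX q h) =
      (formalMatrix q h a - formalRatio q h • formalMatrix q h (qNatSMul q a)).map ι := by
  rw [formalSum_eq_of_monomial a (qhMonomial_formalShiftX hq h)]
  congr 1
  ext1 i j
  simp [formalShiftSeries_eq, formalMatrix, qNatSMul]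

lemma formalShiftX_sub_ne_zero {q h : ℝ} (hq : q ≠ 0) (hqh : ¬(q = 1 ∧ h = 0)) :
    formalShiftX q h - formalX ≠ 0 := by
  intro H
  have e : ((q⁻¹ - 1 : ℝ) : ℂ) • formalX = algebraMap ℝ (LaurentSeries ℂ) (q⁻¹ * h) := by
    have : algebraMap ℝ (LaurentSeries ℂ) (q⁻¹ - 1) * formalX =
        algebraMap ℝ (LaurentSeries ℂ) (q⁻¹ * h) := by
      rw [formalShiftX] at H
      simp only [map_sub, map_one, map_mul] at *
      linear_combination H
    rw [← this, laurent_algebraMap_real, HahnSeries.C_mul_eq_smul]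
  rw [laurent_algebraMap_real] at e
  have h1 := congrArg (fun f => f.coeff (-1)) e
  have h2 := congrArg (fun f => f.coeff 0) e
  simp [formalX, HahnSeries.C_apply, hq] at h1 h2
  rw [sub_eq_zero, inv_eq_one] at h1
  exact hqh ⟨by exact_mod_cast h1, h2⟩

lemma formalMonomial_one_zero (s : ℕ) : formalMonomial 1 0 s = X ^ s := by
  have : ∀ k, formalNodeInv 1 0 k = X := by
    intro k
    have := formalNode_mul_inv (q := 1) one_ne_zero 0 k
    simp only [one_pow, zero_mul, Complex.ofReal_one, Complex.ofReal_zero, map_one, map_zero,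
      add_zero, one_mul] at this
    simp [formalNodeInv, this]
  simp [formalMonomial, this]

/-- On formal series too, `δ` multiplies the coefficients by `-[s]_q`. -/
lemma formalDelta_eq {q : ℝ} (hq : q ≠ 0) (h : ℝ) (a : ℕ → Matrix (Fin n) (Fin n) ℂ) :
    formalDelta q h a = (-formalMatrix q h (qNatSMul q a)).map ι := by
  ext1 i j
  simp only [formalDelta, Matrix.of_apply]
  split_ifs with hqh
  · obtain ⟨rfl, rfl⟩ := hqh
    rw [formalSum_formalX one_ne_zero]
    simp only [Matrix.map_apply, formalMatrix, Matrix.neg_apply, Matrix.of_apply, map_neg, neg_inj]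
    have key : ∀ b : ℕ → ℂ, ∀ k, coeff k (formalSeries (formalMonomial 1 0) b) = b k := by
      intro b k
      rw [formalSeries, coeff_mk, Finset.sum_range_succ, Finset.sum_eq_zero]
      · simp [formalMonomial_one_zero]
      · intro s hs
        rw [Finset.mem_range] at hs
        simp [formalMonomial_one_zero, coeff_X_pow, hs.ne']
    ext k
    have : (k : ℤ) = (k - 1) + 1 := by ring
    rw [this, HahnSeries.coeff_single_mul_add, one_mul, LaurentSeries.hasseDeriv_coeff, ← this]
    push_cast
    rw [sub_add_cancel, Ring.choose_one_right]
    rcases le_or_gt 0 k with hk | hk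
    · obtain ⟨m, rfl⟩ := Int.eq_ofNat_of_zero_le hk
      rw [HahnSeries.ofPowerSeries_apply_coeff, HahnSeries.ofPowerSeries_apply_coeff, key, key]
      simp [qNatSMul, qNat]
    · rw [HahnSeries.ofPowerSeries_apply, HahnSeries.ofPowerSeries_apply,
        HahnSeries.embDomain_of_notMem_range, HahnSeries.embDomain_of_notMem_range, smul_zero]
      all_goals
        rintro ⟨m, hm⟩
        have : (m : ℤ) = k := hm
        omega
  · rw [formalSum_formalX hq, formalSum_formalShiftX hq]
    have h1 := formalShiftX_ne_zero hq h
    have h2 := formalShiftX_sub_ne_zero hq hqh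
    simp only [Matrix.map_apply, Matrix.sub_apply, Matrix.smul_apply, Matrix.neg_apply, map_sub,
      smul_eq_mul, map_mul, map_neg, ofPowerSeries_formalRatio hq]
    field_simp
    ring

lemma formalMatrix_mul {q : ℝ} (hq : q ≠ 0) (h : ℝ) (a b : ℕ → Matrix (Fin n) (Fin n) ℂ) :
    formalMatrix q h a * formalMatrix q h b = formalMatrix q h (qhConv q h a b) := by
  ext1 i j
  simp only [formalMatrix, Matrix.mul_apply, Matrix.of_apply, formalSeries_mul hq]
  rw [← formalSeries_sum]
  congr 1
  funext s
  simp only [qhConv, Matrix.sum_apply, Matrix.smul_apply, Matrix.mul_apply, Finset.smul_sum]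
  rw [Finset.sum_comm]
  refine Finset.sum_congr rfl fun s _ => ?_
  rw [Finset.sum_comm]

lemma formalMatrix_mul_const (q h : ℝ) (a : ℕ → Matrix (Fin n) (Fin n) ℂ)
    (B : Matrix (Fin n) (Fin n) ℂ) :
    formalMatrix q h a * B.map C = formalMatrix q h (fun s => a s * B) := by
  ext1 i j
  simp only [formalMatrix, Matrix.mul_apply, Matrix.of_apply, Matrix.map_apply]
  rw [formalSeries_sum]
  refine Finset.sum_congr rfl fun l _ => ?_
  rw [mul_comm, ← formalSeries_smul]
  congr 1
  funext s
  simp [mul_comm]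

lemma formalMatrix_add (q h : ℝ) (a b : ℕ → Matrix (Fin n) (Fin n) ℂ) :
    formalMatrix q h (a + b) = formalMatrix q h a + formalMatrix q h b := by
  ext1 i j
  exact formalSeries_add _ _ _

lemma formalMatrix_smul (q h : ℝ) (z : ℂ) (a : ℕ → Matrix (Fin n) (Fin n) ℂ) :
    formalMatrix q h (z • a) = C z • formalMatrix q h a := by
  ext1 i j
  exact formalSeries_smul _ _ _

lemma formalMatrix_injective {q : ℝ} (hq : q ≠ 0) (h : ℝ) :
    Function.Injective (formalMatrix (n := n) q h) := by
  intro a b hab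
  funext s
  ext i j
  exact congrFun (formalSeries_injective (coeff_formalMonomial_self hq h)
    (congrFun (congrFun hab i) j)) s

/-- The scalar series `1 / (x - l)`, as a series of matrices. -/
def poleMatrix (q h l : ℝ) (s : ℕ) : Matrix (Fin n) (Fin n) ℂ :=
  (poleCoeff q h l s : ℂ) • (1 : Matrix (Fin n) (Fin n) ℂ)

lemma formalMatrix_pole {q : ℝ} (hq : q ≠ 0) (h l : ℝ) :
    formalMatrix (n := n) q h (poleMatrix q h l) = formalPole l • 1 := by
  ext1 i j
  rw [formalPole_eq_formalSeries hq h]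
  by_cases hij : i = j
  · subst hij; simp [formalMatrix, poleMatrix]
  · simp [formalMatrix, poleMatrix, hij]
    ext k; simp [formalSeries]

/-- The gauge equation `A F - δ F = F((x - h)/q) A₀` on the coefficients. -/
def IsGaugeRecursion (q h : ℝ) (A F : ℕ → Matrix (Fin n) (Fin n) ℂ) : Prop :=
  ∀ s, qhConv q h A F s + (qNat q s : ℂ) • F s =
    F s * A 0 - ((1 - q : ℝ) : ℂ) • ((qNat q s : ℂ) • F s * A 0) +
      ((q * h : ℝ) : ℂ) • (qhConv q h (poleMatrix q h h) (qNatSMul q F) s * A 0)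

/-- The gauge equation between matrices of power series, `-δ F` being the series with coefficients
`[s]_q F s`, amounts to the recursion: `formalRatio q h` is `1 - q - q h / (x - h)`, and products
are expanded by `qhConv`. -/
lemma formal_eq_iff {q : ℝ} (hq : q ≠ 0) (h : ℝ) (A F : ℕ → Matrix (Fin n) (Fin n) ℂ) :
    formalMatrix q h A * formalMatrix q h F + formalMatrix q h (qNatSMul q F) =
      (formalMatrix q h F - formalRatio q h • formalMatrix q h (qNatSMul q F)) * (A 0).map C ↔
      IsGaugeRecursion q h A F := by
  have e1 : formalMatrix q h A * formalMatrix q h F + formalMatrix q h (qNatSMul q F) =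
      formalMatrix q h (qhConv q h A F + qNatSMul q F) := by
    rw [formalMatrix_add, formalMatrix_mul hq]
  have e2 : (formalMatrix q h F - formalRatio q h • formalMatrix q h (qNatSMul q F)) *
      (A 0).map C = formalMatrix q h ((fun s => F s * A 0) +
        ((-((1 - q : ℝ) : ℂ)) • (fun s => (qNat q s : ℂ) • F s * A 0) + ((q * h : ℝ) : ℂ) •
          (fun s => qhConv q h (poleMatrix q h h) (qNatSMul q F) s * A 0))) := by
    rw [formalMatrix_add, formalMatrix_add, formalMatrix_smul, formalMatrix_smul,
      ← formalMatrix_mul_const, ← formalMatrix_mul_const, ← formalMatrix_mul_const,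
      ← formalMatrix_mul hq, formalMatrix_pole hq, formalRatio]
    change _ = _ + (_ • (formalMatrix q h (qNatSMul q F) * _) + _)
    simp only [sub_mul, smul_mul_assoc, one_mul, sub_smul, map_neg, neg_smul, mul_smul]
    abel
  rw [e1, e2, (formalMatrix_injective hq h).eq_iff, funext_iff]
  refine forall_congr' fun s => ?_
  simp only [Pi.add_apply, Pi.smul_apply, qNatSMul, neg_smul, sub_eq_add_neg, add_assoc,
    Pi.neg_apply]

/-- The matrix `F((x - h)/q)` is invertible since its constant term is the identity, hence the
gauge equation may be written without the inverse. -/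
lemma isReducingGauge_iff {q : ℝ} (hq : q ≠ 0) (h : ℝ) (A F : ℕ → Matrix (Fin n) (Fin n) ℂ) :
    IsReducingGauge q h A F ↔ F 0 = 1 ∧ IsGaugeRecursion q h A F := by
  refine and_congr_right fun hF0 => ?_
  rw [← formal_eq_iff hq h, formalGauge, formalSum_formalX hq, formalSum_formalX hq,
    formalDelta_eq hq, formalSum_formalShiftX hq]
  set G := formalMatrix q h F - formalRatio q h • formalMatrix q h (qNatSMul q F) with hG
  have hGdet : IsUnit (G.map ι).det := by
    rw [isUnit_iff_ne_zero]
    intro H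
    have H' : ι G.det = 0 := by rw [← H]; exact RingHom.map_det _ _
    rw [map_eq_zero_iff _ HahnSeries.ofPowerSeries_injective] at H'
    have h1 := RingHom.map_det (constantCoeff (R := ℂ)) G
    rw [H', map_zero] at h1
    have h2 : (constantCoeff (R := ℂ)).mapMatrix G = 1 := by
      ext i j
      simp [hG, formalMatrix, qNatSMul, formalSeries, qNat_zero, hF0, formalMonomial]
    rw [h2, Matrix.det_one] at h1
    exact zero_ne_one h1
  have hA0 : (A 0).map (algebraMap ℂ (LaurentSeries ℂ)) = ((A 0).map C).map ι := by
    ext1 i j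
    rw [Matrix.map_apply, Matrix.map_apply, Matrix.map_apply, laurent_algebraMap]
  have hmul : ∀ M N : Matrix (Fin n) (Fin n) (PowerSeries ℂ), (M * N).map ι = M.map ι * N.map ι :=
    fun M N => Matrix.map_mul
  have hsub : (formalMatrix q h A).map ι * (formalMatrix q h F).map ι -
      (-formalMatrix q h (qNatSMul q F)).map ι =
      (formalMatrix q h A * formalMatrix q h F + formalMatrix q h (qNatSMul q F)).map ι := by
    ext1 i j
    simp [Matrix.mul_apply, Matrix.map_apply]
  have hinj : Function.Injective
      (fun M : Matrix (Fin n) (Fin n) (PowerSeries ℂ) => M.map ι) :=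
    Matrix.map_injective HahnSeries.ofPowerSeries_injective
  rw [hsub, hA0, ← hinj.eq_iff]
  simp only [hmul]
  constructor
  · intro H
    rw [← H, Matrix.mul_nonsing_inv_cancel_left _ _ hGdet]
  · intro H
    rw [H, Matrix.nonsing_inv_mul_cancel_left _ _ hGdet]

end

section

/-! ### Polynomials in a nilpotent block -/

/-- The polynomial `∑_{j<r} a j N_r^j`. -/
def nilPoly (r : ℕ) (a : ℕ → ℂ) : Matrix (Fin r) (Fin r) ℂ :=
  ∑ j ∈ Finset.range r, a j • nilBlock r ^ j

lemma nilBlock_pow_apply (r j : ℕ) (i k : Fin r) :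
    (nilBlock r ^ j) i k = if (i : ℕ) + j = k then 1 else 0 := by
  induction j generalizing k with
  | zero => simp [Matrix.one_apply, Fin.ext_iff]
  | succ j ih =>
    have e : ∀ l : Fin r, (nilBlock r ^ j) i l * nilBlock r l k =
        if (i : ℕ) + j = l ∧ (l : ℕ) + 1 = k then 1 else 0 := by
      intro l
      rw [ih, nilBlock, Matrix.of_apply, ite_and]
      split_ifs <;> simp
    rw [pow_succ, Matrix.mul_apply, Finset.sum_congr rfl fun l _ => e l]
    by_cases h : (i : ℕ) + (j + 1) = k
    · have hl : (i : ℕ) + j < r := by have := k.2; omega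
      rw [if_pos h, Finset.sum_eq_single (⟨i + j, hl⟩ : Fin r)]
      · rw [if_pos ⟨rfl, by simp only; omega⟩]
      · intro l _ hl'
        exact if_neg fun h' => hl' (Fin.ext h'.1.symm)
      · simp
    · rw [if_neg h, Finset.sum_eq_zero]
      intro l _
      exact if_neg (by omega)

lemma nilBlock_pow_eq_zero {r j : ℕ} (hj : r ≤ j) : nilBlock r ^ j = 0 := by
  ext i k
  have := k.2
  rw [nilBlock_pow_apply, if_neg (by omega), Matrix.zero_apply]

lemma nilPoly_apply (r : ℕ) (a : ℕ → ℂ) (i k : Fin r) :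
    nilPoly r a i k = if (i : ℕ) ≤ k then a (k - i) else 0 := by
  rw [nilPoly, Matrix.sum_apply]
  simp only [Matrix.smul_apply, nilBlock_pow_apply, smul_eq_mul, mul_ite, mul_one, mul_zero]
  split_ifs with h
  · rw [Finset.sum_eq_single ((k : ℕ) - i)]
    · simp [h]
    · intro j _ hj; rw [if_neg (by omega)]
    · intro hk; have := k.2; simp at hk; omega
  · exact Finset.sum_eq_zero fun j _ => by rw [if_neg (by omega)]

lemma det_nilPoly (r : ℕ) (a : ℕ → ℂ) : (nilPoly r a).det = a 0 ^ r := by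
  rw [Matrix.det_of_isUpperTriangular]
  · simp [nilPoly_apply]
  · intro i k hik
    rw [nilPoly_apply, if_neg (by simpa using hik)]

lemma nilPoly_mul (r : ℕ) (a b : ℕ → ℂ) :
    nilPoly r a * nilPoly r b =
      nilPoly r fun k => ∑ i ∈ Finset.range (k + 1), a i * b (k - i) := by
  have h1 : nilPoly r a * nilPoly r b = ∑ i ∈ Finset.range r, ∑ k ∈ Finset.range r,
      if i ≤ k then (a i * b (k - i)) • nilBlock r ^ k else 0 := by
    rw [nilPoly, nilPoly, Finset.sum_mul_sum]
    refine Finset.sum_congr rfl fun i hi => ?_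
    rw [Finset.mem_range] at hi
    have h2 : ∀ j, (a i • nilBlock r ^ i) * (b j • nilBlock r ^ j) =
        (a i * b j) • nilBlock r ^ (i + j) := by
      intro j; rw [smul_mul_smul_comm, pow_add]
    simp only [h2]
    rw [← Finset.sum_filter]
    have h3 : ∑ j ∈ Finset.range r, (a i * b j) • nilBlock r ^ (i + j) =
        ∑ j ∈ Finset.range (r - i), (a i * b j) • nilBlock r ^ (i + j) := by
      refine (Finset.sum_subset (by intro j; simp; omega) fun j _ hj => ?_).symm
      rw [nilBlock_pow_eq_zero (by simp at hj; omega), smul_zero]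
    rw [h3]
    refine Finset.sum_nbij' (fun j => i + j) (fun k => k - i) ?_ ?_ ?_ ?_ ?_
    · intro j; simp; omega
    · intro k; simp; omega
    · intro j _; simp
    · intro k hk; simp at hk; omega
    · intro j _; simp
  rw [h1, Finset.sum_comm, nilPoly]
  refine Finset.sum_congr rfl fun k hk => ?_
  rw [Finset.mem_range] at hk
  rw [← Finset.sum_filter, Finset.sum_smul]
  refine Finset.sum_congr ?_ fun _ _ => rfl
  ext i; simp; omega

/-- The coefficients of the block `A_{c,r}` as a polynomial in `N_r`. -/
def normalCoeff (q : ℝ) (c : ℂ) : ℕ → ℂ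
  | 0 => -(qBracket q (-c))
  | j + 1 => if q = 1 then (if j = 0 then 1 else 0) else
      (q : ℂ) ^ (-c) / (1 - (q : ℂ)) * ((-(Real.log q : ℂ)) ^ (j + 1) / ((j + 1).factorial : ℂ))

lemma normalBlock_eq (q : ℝ) (c : ℂ) {r : ℕ} (hr : 0 < r) :
    normalBlock q c r = nilPoly r (normalCoeff q c) := by
  obtain ⟨r, rfl⟩ := Nat.exists_eq_succ_of_ne_zero hr.ne'
  rw [normalBlock, nilPoly, Finset.sum_range_succ', add_comm]
  congr 1
  · split_ifs with hq
    · cases r with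
      | zero =>
        ext i j
        simp [nilBlock]
      | succ r =>
        rw [Finset.sum_range_succ', Finset.sum_eq_zero]
        · simp [normalCoeff, hq]
        · intro i _; simp [normalCoeff, hq]
    · rw [qPowNegNil, Finset.sum_range_succ']
      simp only [pow_zero, Nat.factorial_zero, Nat.cast_one, div_one, one_smul,
        add_sub_cancel_right, Finset.smul_sum, smul_smul]
      exact Finset.sum_congr rfl fun j _ => by rw [normalCoeff, if_neg hq]

/-- The entries of the normal form are continuous at `q = 1` too, being expressed by the
divided differences at `1` of `q ↦ q^{-c}` and of the logarithm. -/
lemma continuousOn_normalCoeff (c : ℂ) (j : ℕ) :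
    ContinuousOn (fun q => normalCoeff q c j) (Set.Ioi (0 : ℝ)) := by
  have hpow : ∀ q : ℝ, 0 < q → HasDerivAt (fun t : ℝ => (t : ℂ) ^ (-c))
      (-c * (q : ℂ) ^ (-c - 1)) q := by
    intro q hq
    have h1 : HasDerivAt (fun z : ℂ => z ^ (-c)) (-c * (q : ℂ) ^ (-c - 1) * 1) (q : ℂ) :=
      (hasDerivAt_id _).cpow_const (Complex.ofReal_mem_slitPlane.mpr hq)
    simpa using h1.comp_ofReal
  have hcont : ContinuousOn (fun t : ℝ => (t : ℂ) ^ (-c)) (Set.Ioi 0) := fun q hq =>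
    (hpow q hq).continuousAt.continuousWithinAt
  have hnhds : Set.Ioi (0 : ℝ) ∈ 𝓝 (1 : ℝ) := Ioi_mem_nhds one_pos
  cases j with
  | zero =>
    have e : Set.EqOn (fun q => normalCoeff q c 0)
        (fun q => -dslope (fun t : ℝ => (t : ℂ) ^ (-c)) 1 q) (Set.Ioi 0) := by
      intro q _
      by_cases hq : q = 1
      · subst hq
        simp [normalCoeff, qBracket, dslope_same, (hpow 1 one_pos).deriv]
      · simp only [normalCoeff, qBracket, if_neg hq]
        rw [dslope_of_ne _ hq, slope, vsub_eq_sub, Complex.real_smul]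
        push_cast
        rw [Complex.one_cpow]
        ring
    refine ContinuousOn.congr ?_ e
    exact ((continuousOn_dslope hnhds).mpr ⟨hcont, (hpow 1 one_pos).differentiableAt⟩).neg
  | succ j =>
    have hlog : HasDerivAt Real.log 1 1 := by simpa using Real.hasDerivAt_log one_ne_zero
    have hlogc : ContinuousOn Real.log (Set.Ioi 0) :=
      Real.continuousOn_log.mono fun q hq => (ne_of_gt hq : q ≠ 0)
    have e : Set.EqOn (fun q => normalCoeff q c (j + 1))
        (fun q => (q : ℂ) ^ (-c) * ((-(Real.log q : ℂ)) ^ j / ((j + 1).factorial : ℂ)) *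
          (dslope Real.log 1 q : ℝ)) (Set.Ioi 0) := by
      intro q _
      by_cases hq : q = 1
      · subst hq
        cases j <;> simp [normalCoeff, dslope_same, hlog.deriv]
      · simp only [normalCoeff, if_neg hq]
        rw [dslope_of_ne _ hq, slope, vsub_eq_sub, smul_eq_mul, Real.log_one, sub_zero]
        have h1 : (q : ℂ) - 1 ≠ 0 := sub_ne_zero.mpr (by exact_mod_cast hq)
        have h2 : 1 - (q : ℂ) ≠ 0 := sub_ne_zero.mpr (by exact_mod_cast Ne.symm hq)
        push_cast
        field_simp
        ring
    refine ContinuousOn.congr ?_ e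
    have h3 : ContinuousOn (fun q => dslope Real.log 1 q) (Set.Ioi 0) :=
      (continuousOn_dslope hnhds).mpr ⟨hlogc, hlog.differentiableAt⟩
    have h4 : ContinuousOn (fun q => ((Real.log q : ℝ) : ℂ)) (Set.Ioi 0) :=
      Complex.continuous_ofReal.comp_continuousOn hlogc
    exact (hcont.mul ((h4.neg.pow j).div_const _)).mul
      (Complex.continuous_ofReal.comp_continuousOn h3)

section BlockDiag

variable {n m : ℕ} {r : Fin m → ℕ}

lemma blockDiag_mul (hr : ∑ i, r i = n) (B B' : (i : Fin m) → Matrix (Fin (r i)) (Fin (r i)) ℂ) :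
    blockDiag hr B * blockDiag hr B' = blockDiag hr fun i => B i * B' i := by
  simp only [blockDiag, Matrix.reindex_apply]
  rw [Matrix.submatrix_mul_equiv, ← Matrix.blockDiagonal'_mul]

lemma det_blockDiag (hr : ∑ i, r i = n) (B : (i : Fin m) → Matrix (Fin (r i)) (Fin (r i)) ℂ) :
    (blockDiag hr B).det = ∏ i, (B i).det := by
  rw [blockDiag, Matrix.det_reindex_self, (Matrix.blockTriangular_blockDiagonal' B).det_fintype]
  refine Finset.prod_congr rfl fun i _ => ?_
  rw [← Matrix.det_submatrix_equiv_self (Equiv.sigmaSubtype (β := fun i => Fin (r i)) i) (B i)]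
  congr 1
  ext ⟨⟨j, a⟩, ha⟩ ⟨⟨k, b⟩, hb⟩
  obtain rfl : j = i := ha
  obtain rfl : k = j := hb
  simp [Matrix.toSquareBlock_def]

lemma blockDiag_one (hr : ∑ i, r i = n) :
    blockDiag hr (fun i => (1 : Matrix (Fin (r i)) (Fin (r i)) ℂ)) = 1 := by
  have : Matrix.blockDiagonal' (fun i => (1 : Matrix (Fin (r i)) (Fin (r i)) ℂ)) = 1 :=
    Matrix.blockDiagonal'_one
  rw [blockDiag, this, Matrix.reindex_apply, Matrix.submatrix_one_equiv]

lemma blockDiag_apply (hr : ∑ i, r i = n) (B : (i : Fin m) → Matrix (Fin (r i)) (Fin (r i)) ℂ)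
    (u v : (i : Fin m) × Fin (r i)) :
    blockDiag hr B ((finSigmaFinEquiv.trans (finCongr hr)) u)
      ((finSigmaFinEquiv.trans (finCongr hr)) v) = Matrix.blockDiagonal' B u v := by
  rw [blockDiag, Matrix.reindex_apply, Matrix.submatrix_apply, Equiv.symm_apply_apply,
    Equiv.symm_apply_apply]

lemma normalForm_eq (hr : ∑ i, r i = n) (hrpos : ∀ i, 0 < r i) (c : Fin m → ℂ) (q : ℝ) :
    normalForm hr c q = blockDiag hr fun i => nilPoly (r i) (normalCoeff q (c i)) := by
  rw [normalForm]; congr; funext i; rw [normalBlock_eq _ _ (hrpos i)]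

lemma continuousOn_normalForm (hr : ∑ i, r i = n) (hrpos : ∀ i, 0 < r i) (c : Fin m → ℂ) :
    ContinuousOn (normalForm hr c) (Set.Ioi 0) := by
  have e : normalForm hr c = fun q => blockDiag hr fun i => nilPoly (r i) (normalCoeff q (c i)) :=
    funext (normalForm_eq hr hrpos c)
  rw [e]
  refine continuousOn_pi.mpr fun u => continuousOn_pi.mpr fun v => ?_
  obtain ⟨⟨i, a⟩, rfl⟩ := (finSigmaFinEquiv.trans (finCongr hr)).surjective u
  obtain ⟨⟨j, b⟩, rfl⟩ := (finSigmaFinEquiv.trans (finCongr hr)).surjective v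
  simp only [blockDiag_apply]
  by_cases hij : i = j
  · subst hij
    simp only [Matrix.blockDiagonal'_apply_eq, nilPoly_apply]
    split_ifs
    · exact continuousOn_normalCoeff _ _
    · exact continuousOn_const
  · simp only [Matrix.blockDiagonal'_apply_ne _ _ _ hij]
    exact continuousOn_const

/-- The matrix `I + (1-q) J₀ = q^{-c} q^{-N}` is invertible. -/
lemma isUnit_one_add_normalForm (hr : ∑ i, r i = n) (hrpos : ∀ i, 0 < r i) (c : Fin m → ℂ) {q : ℝ}
    (hq : 1 ≤ q) : IsUnit (1 + (1 - (q : ℂ)) • normalForm hr c q) := by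
  have e : 1 + (1 - (q : ℂ)) • normalForm hr c q = blockDiag hr fun i =>
      nilPoly (r i) fun j => (if j = 0 then 1 else 0) + (1 - (q : ℂ)) * normalCoeff q (c i) j := by
    rw [normalForm_eq hr hrpos, ← blockDiag_one hr]
    ext u v
    obtain ⟨⟨i, a⟩, rfl⟩ := (finSigmaFinEquiv.trans (finCongr hr)).surjective u
    obtain ⟨⟨j, b⟩, rfl⟩ := (finSigmaFinEquiv.trans (finCongr hr)).surjective v
    simp only [Matrix.add_apply, Matrix.smul_apply, blockDiag_apply]
    by_cases hij : i = j
    · subst hij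
      simp only [Matrix.blockDiagonal'_apply_eq, nilPoly_apply, Matrix.one_apply, Fin.ext_iff]
      have := a.2
      have := b.2
      split_ifs <;> first | omega | simp
    · simp [Matrix.blockDiagonal'_apply_ne _ _ _ hij]
  rw [e, Matrix.isUnit_iff_isUnit_det, det_blockDiag, isUnit_iff_ne_zero, Finset.prod_ne_zero_iff]
  intro i _
  rw [det_nilPoly]
  refine pow_ne_zero _ ?_
  simp only [if_true, normalCoeff, qBracket]
  split_ifs with h
  · simp [h]
  · have h1 : (q : ℂ) - 1 ≠ 0 := sub_ne_zero.mpr (by exact_mod_cast h)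
    have h2 : (q : ℂ) ≠ 0 := by exact_mod_cast (by linarith : q ≠ 0)
    have : 1 + (1 - (q : ℂ)) * -(((q : ℂ) ^ (-c i) - 1) / ((q : ℂ) - 1)) = (q : ℂ) ^ (-c i) := by
      field_simp; ring
    rw [this]
    simp [Complex.cpow_eq_zero_iff, h2]

end BlockDiag

end

section

/-! ### Solving the recursion -/

lemma transferCoeff_zero_left (q h : ℝ) :
    ∀ k i : ℕ, transferCoeff q h 0 k i = if i = k then 1 else 0
  | 0, 0 => rfl
  | 0, _ + 1 => rfl
  | k + 1, 0 => by
    rw [transferCoeff, transferCoeff_zero_left q h k 0]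
    by_cases hk : k = 0
    · subst hk; simp [qNat_zero]
    · rw [if_neg (Ne.symm hk), if_neg (by omega), mul_zero]
  | k + 1, i + 1 => by
    rw [transferCoeff, transferCoeff_zero_left q h k (i + 1), transferCoeff_zero_left q h k i]
    by_cases h1 : i = k
    · subst h1; simp
    · by_cases h2 : i + 1 = k
      · subst h2; simp [qNat_zero]
      · rw [if_neg h1, if_neg h2, if_neg (by omega)]; simp

lemma structCoeff_left_zero (q h : ℝ) (t j : ℕ) :
    structCoeff q h 0 t j = if t = j then 1 else 0 := by
  cases t with
  | zero => rw [structCoeff_zero_left]; simp [eq_comm]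
  | succ t =>
    cases j with
    | zero => rw [structCoeff_eq_zero (by omega), if_neg (by omega)]
    | succ j =>
      have := structCoeff_succ_right q h 0 t j
      rw [zero_add, zero_add] at this
      rw [this, transferCoeff_zero_left]
      by_cases hj : t = j
      · subst hj; simp
      · simp [hj]

section Conv

variable {M : Type*} [Ring M] [Module ℝ M]

/-- A sequence with its term of index zero removed. -/
def dropZero (a : ℕ → M) (s : ℕ) : M := if s = 0 then 0 else a s

lemma qhConv_eq_add (q h : ℝ) (a b : ℕ → M) (j : ℕ) :
    qhConv q h a b j = a 0 * b j + qhConv q h (dropZero a) b j := by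
  have h0 : ∀ a : ℕ → M, ∑ t ∈ Finset.range (j + 1), structCoeff q h 0 t j • (a 0 * b t) =
      a 0 * b j := by
    intro a
    rw [Finset.sum_eq_single j]
    · simp [structCoeff_left_zero]
    · intro t _ ht; rw [structCoeff_left_zero, if_neg ht, zero_smul]
    · simp
  unfold qhConv
  rw [Finset.sum_range_succ', h0, Finset.sum_range_succ', h0]
  simp [dropZero, add_comm]

lemma qhConv_congr {q h : ℝ} {a b b' : ℕ → M} {j : ℕ} (ha : a 0 = 0)
    (hb : ∀ t < j, b t = b' t) : qhConv q h a b j = qhConv q h a b' j := by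
  unfold qhConv
  refine Finset.sum_congr rfl fun s _ => Finset.sum_congr rfl fun t _ => ?_
  cases s with
  | zero => simp [ha]
  | succ s =>
    by_cases ht : t < j
    · rw [hb t ht]
    · rw [structCoeff_eq_zero (by omega), zero_smul, zero_smul]

end Conv

/-- A recursion in which each term depends on the preceding ones has a unique solution. -/
lemma existsUnique_of_recursion {M : Type*} [Zero M] (G : ℕ → (ℕ → M) → M)
    (hG : ∀ j f g, (∀ t < j, f t = g t) → G j f = G j g) : ∃! F : ℕ → M, ∀ j, F j = G j F := by
  classical
  let F : ℕ → M := Nat.lt_wfRel.wf.fix fun j ih => G j fun t => if ht : t < j then ih t ht else 0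
  have hF : ∀ j, F j = G j F := by
    intro j
    have : F j = G j fun t => if ht : t < j then F t else 0 :=
      Nat.lt_wfRel.wf.fix_eq (fun j ih => G j fun t => if ht : t < j then ih t ht else 0) j
    rw [this]
    exact hG j _ _ fun t ht => by simp [ht]
  refine ⟨F, hF, fun F' hF' => funext fun j => ?_⟩
  induction j using Nat.strong_induction_on with
  | _ j ih => rw [hF', hF]; exact hG j _ _ ih

variable {n : ℕ}

/-- The linear operator `X ↦ (A₀ + [s]) X - q^s X A₀`. -/
def gaugeOp (q : ℝ) (s : ℕ) (A₀ : Matrix (Fin n) (Fin n) ℂ) :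
    Matrix (Fin n) (Fin n) ℂ →ₗ[ℂ] Matrix (Fin n) (Fin n) ℂ where
  toFun X := A₀ * X + (qNat q s : ℂ) • X - ((q ^ s : ℝ) : ℂ) • (X * A₀)
  map_add' X Y := by simp only [mul_add, add_mul, smul_add]; abel
  map_smul' z X := by
    simp only [mul_smul_comm, smul_mul_assoc, RingHom.id_apply, smul_sub, smul_add,
      smul_comm z]

lemma gaugeOp_apply (q : ℝ) (s : ℕ) (A₀ X : Matrix (Fin n) (Fin n) ℂ) :
    gaugeOp q s A₀ X = A₀ * X + (qNat q s : ℂ) • X - ((q ^ s : ℝ) : ℂ) • (X * A₀) := rfl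

lemma gaugeOp_one_zero (q : ℝ) (A₀ : Matrix (Fin n) (Fin n) ℂ) : gaugeOp q 0 A₀ 1 = 0 := by
  simp [gaugeOp_apply, qNat_zero]

/-- The right-hand side of the recursion `gaugeOp q s A₀ (F s) = gaugeRhs q h A F s`. -/
def gaugeRhs (q h : ℝ) (A F : ℕ → Matrix (Fin n) (Fin n) ℂ) (s : ℕ) : Matrix (Fin n) (Fin n) ℂ :=
  -qhConv q h (dropZero A) F s +
    ((q * h : ℝ) : ℂ) • (qhConv q h (poleMatrix q h h) (qNatSMul q F) s * A 0)

lemma isGaugeRecursion_iff (q h : ℝ) (A F : ℕ → Matrix (Fin n) (Fin n) ℂ) :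
    IsGaugeRecursion q h A F ↔ ∀ s, gaugeOp q s (A 0) (F s) = gaugeRhs q h A F s := by
  refine forall_congr' fun s => ?_
  rw [gaugeOp_apply, gaugeRhs, qhConv_eq_add]
  have e : ((q ^ s : ℝ) : ℂ) = 1 - ((1 - q : ℝ) : ℂ) * (qNat q s : ℂ) := by
    rw [pow_eq_qNat]; push_cast; ring
  rw [e, sub_smul, one_smul, mul_smul, ← smul_mul_assoc (qNat q s : ℂ)]
  constructor
  · intro H
    rw [← sub_eq_zero] at H ⊢
    rw [← H]; abel
  · intro H
    rw [← sub_eq_zero] at H ⊢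
    rw [← H]; abel

lemma gaugeRhs_congr {q h : ℝ} {A F F' : ℕ → Matrix (Fin n) (Fin n) ℂ} {s : ℕ}
    (hF : ∀ t < s, F t = F' t) : gaugeRhs q h A F s = gaugeRhs q h A F' s := by
  unfold gaugeRhs
  rw [qhConv_congr (a := dropZero A) (by simp [dropZero]) hF,
    qhConv_congr (a := poleMatrix q h h) (b' := qNatSMul q F') (by simp [poleMatrix, poleCoeff])
    fun t ht => by rw [qNatSMul, qNatSMul, hF t ht]]

lemma gaugeRhs_zero {q h : ℝ} {A F : ℕ → Matrix (Fin n) (Fin n) ℂ} : gaugeRhs q h A F 0 = 0 := by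
  simp [gaugeRhs, qhConv, dropZero, poleMatrix, poleCoeff]

/-- Existence and uniqueness of the formal gauge transformation. -/
lemma existsUnique_isReducingGauge {q : ℝ} (hq : q ≠ 0) (h : ℝ)
    (A : ℕ → Matrix (Fin n) (Fin n) ℂ)
    (hinj : ∀ s, 1 ≤ s → Function.Injective (gaugeOp q s (A 0))) :
    ∃! F : ℕ → Matrix (Fin n) (Fin n) ℂ, IsReducingGauge q h A F := by
  -- for `s ≥ 1` the recursion determines `F s`; at `s = 0` it reads `0 = 0`
  have hsurj : ∀ s, 1 ≤ s → Function.Surjective (gaugeOp q s (A 0)) := fun s hs =>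
    LinearMap.injective_iff_surjective.mp (hinj s hs)
  choose! S hS using fun s (hs : 1 ≤ s) => hsurj s hs
  have hS' : ∀ s, 1 ≤ s → ∀ X Y, gaugeOp q s (A 0) X = Y ↔ X = S s Y := fun s hs X Y =>
    ⟨fun H => hinj s hs (H.trans (hS s hs Y).symm), fun H => H ▸ hS s hs Y⟩
  have key : ∀ F : ℕ → Matrix (Fin n) (Fin n) ℂ, IsReducingGauge q h A F ↔
      ∀ j, F j = (fun j F => if j = 0 then 1 else S j (gaugeRhs q h A F j)) j F := by
    intro F
    rw [isReducingGauge_iff hq, isGaugeRecursion_iff]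
    constructor
    · rintro ⟨h0, hF⟩ j
      by_cases hj : j = 0
      · simp [hj, h0]
      · simpa [hj] using (hS' j (by omega) _ _).mp (hF j)
    · intro hF
      have h0 : F 0 = 1 := by simpa using hF 0
      refine ⟨h0, fun j => ?_⟩
      by_cases hj : j = 0
      · subst hj; rw [h0, gaugeOp_one_zero, gaugeRhs_zero]
      · exact (hS' j (by omega) _ _).mpr (by simpa [hj] using hF j)
  simp only [key]
  refine existsUnique_of_recursion _ fun j f g hfg => ?_
  by_cases hj : j = 0
  · simp [hj]
  · simp only [hj, if_false]; rw [gaugeRhs_congr hfg]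

/-! ### Sylvester equations and non-resonance -/

/-- A Sylvester equation between matrices with disjoint spectra has only the trivial solution: the
characteristic polynomial of `B` kills `B`, while its value at `C` is invertible. -/
lemma eq_zero_of_sylvester {B C X : Matrix (Fin n) (Fin n) ℂ} (hX : B * X = X * C)
    (hBC : ∀ z : ℂ, Module.End.HasEigenvalue (Matrix.toLin' B) z →
      ¬ Module.End.HasEigenvalue (Matrix.toLin' C) z) : X = 0 := by
  by_contra hne
  have hpow : ∀ p : Polynomial ℂ, Polynomial.aeval B p * X = X * Polynomial.aeval C p := by
    intro p
    induction p using Polynomial.induction_on' with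
    | add p r hp hr => simp [add_mul, mul_add, hp, hr]
    | monomial k a =>
      have : B ^ k * X = X * C ^ k := by
        induction k with
        | zero => simp
        | succ k ih => rw [pow_succ, mul_assoc, hX, ← mul_assoc, ih, mul_assoc, ← pow_succ]
      rw [Polynomial.aeval_monomial, Polynomial.aeval_monomial, mul_assoc, this, ← mul_assoc,
        Algebra.commutes, mul_assoc]
  have h0 := hpow B.charpoly
  rw [Matrix.aeval_self_charpoly, zero_mul] at h0
  have hsplit := IsAlgClosed.splits B.charpoly
  have hnu : ¬ IsUnit (Polynomial.aeval C
      (Multiset.map (fun z => Polynomial.X - Polynomial.C z) B.charpoly.roots).prod) := by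
    intro hu
    rw [← hsplit.eq_prod_roots_of_monic B.charpoly_monic] at hu
    obtain ⟨u, hu⟩ := hu
    rw [← hu] at h0
    apply hne
    rw [← mul_one X, ← Units.mul_inv u, ← mul_assoc, ← h0, zero_mul]
  obtain ⟨z, hz, hz'⟩ := spectrum.exists_mem_of_not_isUnit_aeval_prod hnu
  rw [← Matrix.spectrum_toLin', ← Module.End.hasEigenvalue_iff_mem_spectrum] at hz
  refine hBC z ?_ hz
  rw [Module.End.hasEigenvalue_iff_mem_spectrum, Matrix.spectrum_toLin',
    Matrix.mem_spectrum_iff_isRoot_charpoly]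
  exact hz'

lemma qBracket_natCast (q : ℝ) (s : ℕ) :
    qBracket q ((s : ℤ) : ℂ) = (qNat q s : ℂ) := by
  unfold qBracket qNat
  split_ifs
  · simp
  · push_cast
    rw [Complex.cpow_natCast]

lemma hasEigenvalue_toLin'_iff {B : Matrix (Fin n) (Fin n) ℂ} {z : ℂ} :
    Module.End.HasEigenvalue (Matrix.toLin' B) z ↔ ∃ v : Fin n → ℂ, v ≠ 0 ∧ B.mulVec v = z • v := by
  constructor
  · intro h
    obtain ⟨v, hv⟩ := h.exists_hasEigenvector
    exact ⟨v, hv.2, by simpa using hv.apply_eq_smul⟩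
  · rintro ⟨v, hv, hBv⟩
    exact Module.End.hasEigenvalue_of_hasEigenvector (x := v)
      ⟨Module.End.mem_eigenspace_iff.mpr (by simpa using hBv), hv⟩

/-- Non-resonance makes the operators of the recursion injective. -/
lemma gaugeOp_injective_of_isNonresonant {q : ℝ} (hq : 1 ≤ q) {A₀ : Matrix (Fin n) (Fin n) ℂ}
    (hA : IsNonresonant q A₀) {s : ℕ} (hs : 1 ≤ s) : Function.Injective (gaugeOp q s A₀) := by
  rw [injective_iff_map_eq_zero]
  intro X hX
  have hq0 : ((q ^ s : ℝ) : ℂ) ≠ 0 := by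
    exact_mod_cast (pow_pos (by linarith : (0:ℝ) < q) s).ne'
  -- the kernel equation reads `(A₀ + [s]) X = X (q^s A₀)`
  refine eq_zero_of_sylvester (B := A₀ + (qNat q s : ℂ) • 1) (C := ((q ^ s : ℝ) : ℂ) • A₀) ?_ ?_
  · rw [gaugeOp_apply, sub_eq_zero] at hX
    rw [add_mul, smul_mul_assoc, one_mul, hX, mul_smul_comm]
  · intro z hB hC
    rw [hasEigenvalue_toLin'_iff] at hB hC
    obtain ⟨v, hv, hBv⟩ := hB
    obtain ⟨w, hw, hCw⟩ := hC
    have h1 : Module.End.HasEigenvalue (Matrix.toLin' A₀) (((q ^ s : ℝ) : ℂ)⁻¹ * z) := by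
      rw [hasEigenvalue_toLin'_iff]
      refine ⟨w, hw, ?_⟩
      rw [Matrix.smul_mulVec] at hCw
      rw [mul_smul, ← hCw, smul_smul, inv_mul_cancel₀ hq0, one_smul]
    refine hA _ h1 (s : ℤ) (by omega) ?_
    rw [hasEigenvalue_toLin'_iff]
    refine ⟨v, hv, ?_⟩
    rw [qBracket_natCast, zpow_natCast, ← Complex.ofReal_pow,
      mul_inv_cancel_left₀ hq0, sub_smul, ← hBv, Matrix.add_mulVec, Matrix.smul_mulVec,
      Matrix.one_mulVec, add_sub_cancel_right]

/-- The operators of the recursion for conjugate constant matrices are conjugate. -/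
lemma gaugeOp_conj (q : ℝ) (s : ℕ) {P A₀ J : Matrix (Fin n) (Fin n) ℂ}
    {P' : Matrix (Fin n) (Fin n) ℂ}
    (hPP' : P * P' = 1) (hP'P : P' * P = 1) (hP : P * J = A₀ * P) (X : Matrix (Fin n) (Fin n) ℂ) :
    gaugeOp q s J (P' * X * P) = P' * gaugeOp q s A₀ X * P := by
  have hJ : J = P' * A₀ * P := by rw [mul_assoc, ← hP, ← mul_assoc, hP'P, one_mul]
  simp only [gaugeOp_apply, mul_add, mul_sub, add_mul, sub_mul, mul_smul_comm, smul_mul_assoc]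
  congr 2
  · rw [hJ]
    calc P' * A₀ * P * (P' * X * P) = P' * A₀ * (P * P') * X * P := by noncomm_ring
      _ = _ := by rw [hPP']; noncomm_ring
  · rw [hJ]
    have : P' * X * P * (P' * A₀ * P) = P' * (X * A₀) * P := by
      calc _ = P' * X * (P * P') * A₀ * P := by noncomm_ring
        _ = _ := by rw [hPP']; noncomm_ring
    rw [this]

end

section

open scoped Matrix.Norms.Operator

/-! ### Uniform bounds for the operators of the recursion -/

/-- A continuous family of injective homogeneous maps over a compact set is uniformly bounded
below. -/
lemma exists_pos_mul_norm_le {E : Type*} [NormedAddCommGroup E] [NormedSpace ℝ E] [ProperSpace E]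
    {K : Set ℝ} (hK : IsCompact K) (T : ℝ → E → E)
    (hT : ContinuousOn (fun p : ℝ × E => T p.1 p.2) (K ×ˢ Set.univ))
    (hsmul : ∀ q (a : ℝ) X, T q (a • X) = a • T q X) (hinj : ∀ q ∈ K, ∀ X, T q X = 0 → X = 0) :
    ∃ κ > 0, ∀ q ∈ K, ∀ X, κ * ‖X‖ ≤ ‖T q X‖ := by
  have hcomp : IsCompact (K ×ˢ Metric.sphere (0 : E) 1) := hK.prod (isCompact_sphere 0 1)
  obtain ⟨κ, hκ, hb⟩ : ∃ κ > 0, ∀ p ∈ K ×ˢ Metric.sphere (0 : E) 1, κ ≤ ‖T p.1 p.2‖ := by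
    rcases (K ×ˢ Metric.sphere (0 : E) 1).eq_empty_or_nonempty with he | hne
    · exact ⟨1, one_pos, by simp [he]⟩
    · obtain ⟨p, hp, hmin⟩ := hcomp.exists_isMinOn hne
        ((hT.mono (Set.prod_mono le_rfl (Set.subset_univ _))).norm)
      refine ⟨_, norm_pos_iff.mpr fun h0 => ?_, fun p' hp' => hmin hp'⟩
      have h1 := hinj _ hp.1 _ h0
      have h2 := hp.2
      rw [h1] at h2
      simp at h2
  refine ⟨κ, hκ, fun q hq X => ?_⟩
  by_cases hX : X = 0
  · simp [hX]
  · have hX' : ‖X‖ ≠ 0 := norm_ne_zero_iff.mpr hX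
    have h1 := hb (q, ‖X‖⁻¹ • X) ⟨hq, by simp [norm_smul, hX']⟩
    simp only [hsmul, norm_smul, norm_inv, norm_norm] at h1
    rw [mul_comm, ← le_inv_mul_iff₀ (by positivity)]
    exact h1

variable {n : ℕ}

lemma norm_one_le : ‖(1 : Matrix (Fin n) (Fin n) ℂ)‖ ≤ 1 := by
  cases n with
  | zero => rw [Subsingleton.elim (1 : Matrix (Fin 0) (Fin 0) ℂ) 0, norm_zero]; exact zero_le_one
  | succ n => rw [norm_one]

lemma gaugeOp_eq (q : ℝ) (s : ℕ) (J X : Matrix (Fin n) (Fin n) ℂ) :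
    gaugeOp q s J X =
      (qNat q s : ℂ) • (X + (1 - (q : ℂ)) • (X * J)) + (J * X - X * J) := by
  rw [gaugeOp_apply, pow_eq_qNat]
  push_cast
  module

/-- The operators of the recursion are bounded below, uniformly, by a multiple of `[s]_q`. For large
`s` this comes from the limit operator `X ↦ X (I + (1-q) J)`. -/
lemma exists_gaugeOp_lower_bound {K : Set ℝ} (hK : IsCompact K) (hK1 : K ⊆ Set.Ici 1)
    (J : ℝ → Matrix (Fin n) (Fin n) ℂ) (hJ : ContinuousOn J K)
    (hres : ∀ q ∈ K, IsNonresonant q (J q))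
    (hunit : ∀ q ∈ K, IsUnit (1 + (1 - (q : ℂ)) • J q)) :
    ∃ κ > 0, ∀ q ∈ K, ∀ s, 1 ≤ s → ∀ X : Matrix (Fin n) (Fin n) ℂ,
      κ * (qNat q s * ‖X‖) ≤ ‖gaugeOp q s (J q) X‖ := by
  have hJ1 : ContinuousOn (fun p : ℝ × Matrix (Fin n) (Fin n) ℂ => J p.1) (K ×ˢ Set.univ) :=
    hJ.comp continuousOn_fst fun p hp => hp.1
  have hq1 : ContinuousOn (fun p : ℝ × Matrix (Fin n) (Fin n) ℂ => (p.1 : ℂ)) (K ×ˢ Set.univ) :=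
    (Complex.continuous_ofReal.comp continuous_fst).continuousOn
  have hX1 : ContinuousOn (fun p : ℝ × Matrix (Fin n) (Fin n) ℂ => p.2) (K ×ˢ Set.univ) :=
    continuousOn_snd
  obtain ⟨κ₀, hκ₀, hb₀⟩ := exists_pos_mul_norm_le hK (fun q X => X + (1 - (q : ℂ)) • (X * J q))
    (hX1.add ((continuousOn_const.sub hq1).smul (hX1.mul hJ1)))
    (fun q a X => by simp only [smul_mul_assoc, smul_add, smul_comm a])
    (fun q hq X hX => by
      obtain ⟨u, hu⟩ := hunit q hq
      have : X * (u : Matrix (Fin n) (Fin n) ℂ) = 0 := by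
        rw [hu, mul_add, mul_one, mul_smul_comm]; exact hX
      exact (Units.mul_left_eq_zero u).mp this)
  obtain ⟨B, hB⟩ := hK.exists_bound_of_continuousOn hJ
  obtain ⟨R, hR⟩ := hK.isBounded.exists_norm_le
  -- the operator is `[s]_q (X + (1-q) X J)` up to the commutator `J X - X J`, which is bounded
  -- independently of `s`
  have hlarge : ∀ q ∈ K, ∀ s : ℕ, 4 * B / κ₀ ≤ s → ∀ X : Matrix (Fin n) (Fin n) ℂ,
      κ₀ / 2 * (qNat q s * ‖X‖) ≤ ‖gaugeOp q s (J q) X‖ := by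
    intro q hq s hs X
    have hq' : 1 ≤ q := hK1 hq
    have h1 := hb₀ q hq X
    have h2 : ‖J q * X - X * J q‖ ≤ 2 * B * ‖X‖ := by
      calc _ ≤ ‖J q * X‖ + ‖X * J q‖ := norm_sub_le _ _
        _ ≤ ‖J q‖ * ‖X‖ + ‖X‖ * ‖J q‖ := add_le_add (norm_mul_le _ _) (norm_mul_le _ _)
        _ ≤ B * ‖X‖ + ‖X‖ * B := by gcongr <;> exact hB q hq
        _ = _ := by ring
    have h3 : ‖(qNat q s : ℂ) • (X + (1 - (q : ℂ)) • (X * J q))‖ - ‖J q * X - X * J q‖ ≤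
        ‖gaugeOp q s (J q) X‖ := by
      rw [gaugeOp_eq]
      have := norm_sub_norm_le ((qNat q s : ℂ) • (X + (1 - (q : ℂ)) • (X * J q)))
        (-(J q * X - X * J q))
      rwa [norm_neg, sub_neg_eq_add] at this
    rw [norm_smul, Complex.norm_real, Real.norm_of_nonneg (qNat_nonneg hq' s)] at h3
    have h4 : 4 * B ≤ κ₀ * qNat q s := by
      rw [div_le_iff₀ hκ₀] at hs
      have := le_qNat hq' s
      nlinarith
    have h5 := mul_le_mul_of_nonneg_left h1 (qNat_nonneg hq' s)
    nlinarith [norm_nonneg X]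
  -- for each of the finitely many remaining `s`, non-resonance on the compact set `K` gives a
  -- constant, and `[s]_q` is bounded on `K`
  have hsmall : ∀ S : ℕ, ∃ κ > 0, ∀ q ∈ K, ∀ s, 1 ≤ s → s < S →
      ∀ X : Matrix (Fin n) (Fin n) ℂ, κ * (qNat q s * ‖X‖) ≤ ‖gaugeOp q s (J q) X‖ := by
    intro S
    induction S with
    | zero => exact ⟨1, one_pos, fun q _ s _ hs => absurd hs (by simp)⟩
    | succ S ih =>
      obtain ⟨κ, hκ, hb⟩ := ih
      rcases Nat.eq_zero_or_pos S with hS | hS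
      · exact ⟨1, one_pos, fun q _ s _ hs => by omega⟩
      have hinj : ∀ q ∈ K, ∀ X, gaugeOp q S (J q) X = 0 → X = 0 := fun q hq X hX =>
        (injective_iff_map_eq_zero _).mp
          (gaugeOp_injective_of_isNonresonant (hK1 hq) (hres q hq) hS) X hX
      have hqN : ContinuousOn (fun p : ℝ × Matrix (Fin n) (Fin n) ℂ => (qNat p.1 S : ℂ))
          (K ×ˢ Set.univ) := by
        have : ∀ k, Continuous fun q => qNat q k := by
          intro k
          induction k with
          | zero => simp only [qNat_zero]; exact continuous_const
          | succ k ih => simp only [qNat_succ]; exact (continuous_pow k).add ih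
        exact (Complex.continuous_ofReal.comp ((this S).comp continuous_fst)).continuousOn
      obtain ⟨κ', hκ', hb'⟩ := exists_pos_mul_norm_le hK (fun q X => gaugeOp q S (J q) X)
        (by
          simp only [gaugeOp_eq]
          exact (hqN.smul (hX1.add ((continuousOn_const.sub hq1).smul (hX1.mul hJ1)))).add
            ((hJ1.mul hX1).sub (hX1.mul hJ1)))
        (fun q a X => by
          rw [← Complex.coe_smul, ← Complex.coe_smul, map_smul]) hinj
      have hRS : 0 < 1 + S * |R| ^ S := by positivity
      refine ⟨min κ (κ' / (1 + S * |R| ^ S)), lt_min hκ (by positivity), fun q hq s hs hsS X => ?_⟩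
      have hq' : 1 ≤ q := hK1 hq
      have hnn : 0 ≤ qNat q s * ‖X‖ := mul_nonneg (qNat_nonneg hq' s) (norm_nonneg X)
      rcases Nat.lt_succ_iff_lt_or_eq.mp hsS with h | rfl
      · exact (mul_le_mul_of_nonneg_right (min_le_left _ _) hnn).trans (hb q hq s hs h X)
      · refine (mul_le_mul_of_nonneg_right (min_le_right _ _) hnn).trans ?_
        refine le_trans ?_ (hb' q hq X)
        rw [div_mul_eq_mul_div, div_le_iff₀ hRS]
        have h1 : qNat q s ≤ 1 + s * |R| ^ s := by
          refine (qNat_le_mul_pow hq' s).trans ?_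
          have : q ≤ |R| := ((le_abs_self q).trans (hR q hq)).trans (le_abs_self R)
          have : q ^ s ≤ |R| ^ s := pow_le_pow_left₀ (by linarith) this s
          nlinarith [(Nat.cast_nonneg s : (0:ℝ) ≤ s)]
        have h2 : 0 ≤ κ' * ‖X‖ := by positivity
        nlinarith
  obtain ⟨κ, hκ, hb⟩ := hsmall ⌈4 * B / κ₀⌉₊
  refine ⟨min κ (κ₀ / 2), lt_min hκ (by positivity), fun q hq s hs X => ?_⟩
  have hnn : 0 ≤ qNat q s * ‖X‖ := mul_nonneg (qNat_nonneg (hK1 hq) s) (norm_nonneg X)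
  rcases lt_or_ge s ⌈4 * B / κ₀⌉₊ with h | h
  · exact (mul_le_mul_of_nonneg_right (min_le_left _ _) hnn).trans (hb q hq s hs h X)
  · exact (mul_le_mul_of_nonneg_right (min_le_right _ _) hnn).trans
      (hlarge q hq s (Nat.ceil_le.mp h) X)

/-! ### Majorants -/

lemma ofReal_qhConv (q h : ℝ) (a b : ℕ → ℝ) (j : ℕ) :
    ((qhConv q h a b j : ℝ) : ℂ) = qhConv q h (fun s => (a s : ℂ)) (fun s => (b s : ℂ)) j := by
  simp [qhConv]

/-- Since the structure coefficients are nonnegative, products of factorial series are majorized by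
products of majorants. As the first factor has no constant term, only the preceding coefficients of
the second one intervene. -/
lemma norm_qhConv_le {q h : ℝ} (hq : 1 ≤ q) (hh : 0 ≤ h) {a b : ℕ → Matrix (Fin n) (Fin n) ℂ}
    {α β : ℕ → ℝ} {j : ℕ} (ha : ∀ s, ‖a s‖ ≤ α s) (hα : α 0 = 0) (hb : ∀ t < j, ‖b t‖ ≤ β t) :
    ‖qhConv q h a b j‖ ≤ qhConv q h α β j := by
  unfold qhConv
  refine (norm_sum_le _ _).trans (Finset.sum_le_sum fun s _ =>
    (norm_sum_le _ _).trans (Finset.sum_le_sum fun t _ => ?_))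
  rw [norm_smul, Real.norm_of_nonneg (structCoeff_nonneg hq hh _ _ _), smul_eq_mul]
  by_cases hst : s + t ≤ j
  · refine mul_le_mul_of_nonneg_left ?_ (structCoeff_nonneg hq hh _ _ _)
    rcases Nat.eq_zero_or_pos s with rfl | hs
    · have h0 : ‖a 0‖ = 0 := le_antisymm (hα ▸ ha 0) (norm_nonneg _)
      rw [norm_eq_zero.mp h0, hα]; simp
    · exact (norm_mul_le _ _).trans (mul_le_mul (ha s) (hb t (by omega)) (norm_nonneg _)
        ((norm_nonneg _).trans (ha s)))
  · rw [structCoeff_eq_zero (by omega), zero_mul, zero_mul]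

lemma qhConv_smul_left (q h z : ℝ) (a b : ℕ → ℝ) (j : ℕ) :
    qhConv q h (fun s => z * a s) b j = z * qhConv q h a b j := by
  simp only [qhConv, Finset.mul_sum, smul_eq_mul]
  exact Finset.sum_congr rfl fun s _ => Finset.sum_congr rfl fun t _ => by ring

/-- The coefficients of `1 + M / (x - l - M)`. -/
def majorantCoeff (q h l M : ℝ) (s : ℕ) : ℝ :=
  if s = 0 then 1 else M * poleCoeff q h (l + M) s

open PowerSeries in
/-- The identity `M / (x - l) * (1 + M / (x - l - M)) = M / (x - l - M)` on coefficients. -/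
lemma qhConv_majorantCoeff {q : ℝ} (hq : q ≠ 0) (h l M : ℝ) (s : ℕ) :
    M * qhConv q h (poleCoeff q h l) (majorantCoeff q h l M) s = M * poleCoeff q h (l + M) s := by
  have hX := X_pow_dvd_formalMonomial q h
  have h1 : formalSeries (formalMonomial q h) (fun s => (majorantCoeff q h l M s : ℂ)) =
      1 + C (M : ℂ) * formalPole (l + M) := by
    have e : (fun s => (majorantCoeff q h l M s : ℂ)) =
        (fun s => if s = 0 then (1 : ℂ) else 0) +
          (M : ℂ) • fun s => (poleCoeff q h (l + M) s : ℂ) := by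
      funext s
      cases s with
      | zero => simp [majorantCoeff, poleCoeff]
      | succ s => simp [majorantCoeff]
    rw [e, formalSeries_add, formalSeries_smul, ← formalPole_eq_formalSeries hq h]
    congr 1
    ext k
    rw [formalSeries, coeff_mk, Finset.sum_range_succ', Finset.sum_eq_zero]
    · simp [formalMonomial]
    · intro i _; simp
  have h2 : C (M : ℂ) * (formalPole l * (1 + C (M : ℂ) * formalPole (l + M))) =
      C (M : ℂ) * formalPole (l + M) := by
    have e1 := formalPole_den_mul_inv l
    have e2 := formalPole_den_mul_inv (l + M)
    simp only [formalPole]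
    generalize (1 - C (l : ℂ) * X : PowerSeries ℂ)⁻¹ = G at *
    generalize (1 - C ((l + M : ℝ) : ℂ) * X : PowerSeries ℂ)⁻¹ = H at *
    push_cast at *
    simp only [map_add] at *
    linear_combination C (M : ℂ) * X * H * e1 - C (M : ℂ) * X * G * e2
  rw [← h1, formalPole_eq_formalSeries hq h, formalSeries_mul hq, ← formalSeries_smul,
    formalPole_eq_formalSeries hq h, ← formalSeries_smul] at h2
  have h3 := congrFun (formalSeries_injective (coeff_formalMonomial_self hq h) h2) s
  simp only [Pi.smul_apply, smul_eq_mul] at h3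
  rw [← ofReal_qhConv] at h3
  exact_mod_cast h3

/-- The majorant estimate: the coefficients of the gauge transformation are bounded by those of
`M / (x - l - M)`. The factor `[s]_q` on the left is gained from the lower bound `hop`, and is what
allows the induction to absorb the term of the recursion which contains `δ F`. -/
lemma qNat_mul_norm_le {q h l C₁ B κ M : ℝ} (hq : 1 ≤ q) (hh : 0 ≤ h) (hl : h ≤ l) (hC₁ : 0 ≤ C₁)
    (hB : 0 ≤ B) (hκ : 0 < κ) (hM : C₁ + q * h * B ≤ κ * M) {A F : ℕ → Matrix (Fin n) (Fin n) ℂ}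
    (hA : ∀ s, 1 ≤ s → ‖A s‖ ≤ C₁ * poleCoeff q h l s) (hA0 : ‖A 0‖ ≤ B)
    (hop : ∀ s, 1 ≤ s → ∀ X, κ * (qNat q s * ‖X‖) ≤ ‖gaugeOp q s (A 0) X‖)
    (hF0 : F 0 = 1) (hF : ∀ s, gaugeOp q s (A 0) (F s) = gaugeRhs q h A F s) :
    ∀ s, 1 ≤ s → qNat q s * ‖F s‖ ≤ M * poleCoeff q h (l + M) s := by
  have hM0 : 0 ≤ M := by
    by_contra hneg
    have : 0 ≤ q * h * B := by positivity
    nlinarith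
  intro s
  induction s using Nat.strong_induction_on with
  | _ s ih =>
    intro hs
    have hmaj : ∀ t < s, qNat q t * ‖F t‖ ≤ majorantCoeff q h l M t := by
      intro t ht
      unfold majorantCoeff
      split_ifs with h0
      · subst h0; simp [qNat_zero]
      · exact ih t ht (by omega)
    have hFt : ∀ t < s, ‖F t‖ ≤ majorantCoeff q h l M t := by
      intro t ht
      rcases Nat.eq_zero_or_pos t with rfl | h0
      · simp [majorantCoeff, hF0, norm_one_le]
      · refine le_trans ?_ (hmaj t ht)
        have := one_le_qNat hq h0
        nlinarith [norm_nonneg (F t)]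
    have h1 : ‖qhConv q h (dropZero A) F s‖ ≤
        C₁ * qhConv q h (poleCoeff q h l) (majorantCoeff q h l M) s := by
      rw [← qhConv_smul_left]
      refine norm_qhConv_le hq hh (fun t => ?_) (by simp [poleCoeff]) hFt
      unfold dropZero
      split_ifs with h0
      · subst h0; simp [poleCoeff]
      · exact hA t (by omega)
    -- `1 / (x - h)` is majorized by `1 / (x - l)` because `h ≤ l`
    have h2 : ‖qhConv q h (poleMatrix q h h) (qNatSMul q F) s‖ ≤
        qhConv q h (poleCoeff q h l) (majorantCoeff q h l M) s := by
      refine norm_qhConv_le hq hh (fun t => ?_) (by simp [poleCoeff]) fun t ht => ?_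
      · rw [poleMatrix, norm_smul, Complex.norm_real,
          Real.norm_of_nonneg (poleCoeff_nonneg hq hh hh t)]
        have h3 := poleCoeff_mono hq hh hh hl t
        have h4 := poleCoeff_nonneg hq hh hh t
        have h5 : ‖(1 : Matrix (Fin n) (Fin n) ℂ)‖ ≤ 1 := norm_one_le
        nlinarith
      · rw [qNatSMul, norm_smul, Complex.norm_real, Real.norm_of_nonneg (qNat_nonneg hq t)]
        exact hmaj t ht
    set φ := qhConv q h (poleCoeff q h l) (majorantCoeff q h l M) s
    have hφ0 : 0 ≤ φ := (norm_nonneg _).trans h2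
    have h3 : ‖gaugeRhs q h A F s‖ ≤ (C₁ + q * h * B) * φ := by
      unfold gaugeRhs
      refine (norm_add_le _ _).trans ?_
      rw [norm_neg, norm_smul, Complex.norm_real, Real.norm_of_nonneg (by positivity), add_mul]
      refine add_le_add h1 ?_
      rw [mul_assoc (q * h) B φ, mul_comm B φ]
      refine mul_le_mul_of_nonneg_left ?_ (by positivity : 0 ≤ q * h)
      refine (norm_mul_le _ _).trans ?_
      exact mul_le_mul h2 hA0 (norm_nonneg _) hφ0
    have h4 := hop s hs (F s)
    rw [hF] at h4
    rw [← qhConv_majorantCoeff (by linarith)]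
    have h5 : κ * (qNat q s * ‖F s‖) ≤ κ * (M * φ) := by
      rw [← mul_assoc κ M]
      exact (h4.trans h3).trans (mul_le_mul_of_nonneg_right hM hφ0)
    exact le_of_mul_le_mul_left h5 hκ

/-! ### Comparison of norms -/

lemma norm_entry_le (M : Matrix (Fin n) (Fin n) ℂ) (i j : Fin n) : ‖M i j‖ ≤ ‖M‖ := by
  rw [Matrix.linfty_opNorm_def]
  have h1 : ‖M i j‖₊ ≤ ∑ j, ‖M i j‖₊ :=
    Finset.single_le_sum (f := fun j => ‖M i j‖₊) (fun _ _ => by positivity) (Finset.mem_univ j)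
  exact_mod_cast h1.trans (Finset.le_sup (f := fun i => ∑ j, ‖M i j‖₊) (Finset.mem_univ i))

lemma exists_seminorm_le (N : Seminorm ℂ (Matrix (Fin n) (Fin n) ℂ)) :
    ∃ k > 0, ∀ M, N M ≤ k * ‖M‖ := by
  refine ⟨1 + ∑ i, ∑ j, N (Matrix.single i j 1), ?_, fun M => ?_⟩
  · exact add_pos_of_pos_of_nonneg one_pos
      (Finset.sum_nonneg fun i _ => Finset.sum_nonneg fun j _ => apply_nonneg N _)
  · have hsum : ∀ f : Fin n → Matrix (Fin n) (Fin n) ℂ, N (∑ i, f i) ≤ ∑ i, N (f i) := fun f =>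
      Finset.le_sum_of_subadditive N (map_zero N).le (fun x y => map_add_le_add N x y) _ f
    have h1 : N M ≤ ∑ i, ∑ j, N (Matrix.single i j 1) * ‖M‖ := by
      conv_lhs => rw [Matrix.matrix_eq_sum_single M]
      refine (hsum _).trans (Finset.sum_le_sum fun i _ =>
        (hsum _).trans (Finset.sum_le_sum fun j _ => ?_))
      have : Matrix.single i j (M i j) = M i j • Matrix.single i j (1 : ℂ) := by
        rw [Matrix.smul_single, smul_eq_mul, mul_one]
      rw [this, map_smul_eq_mul, mul_comm]
      exact mul_le_mul_of_nonneg_left (norm_entry_le M i j) (apply_nonneg N _)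
    refine h1.trans ?_
    simp only [← Finset.sum_mul]
    nlinarith [norm_nonneg M]

lemma exists_norm_le_seminorm (N : Seminorm ℂ (Matrix (Fin n) (Fin n) ℂ))
    (hN : ∀ M, N M = 0 → M = 0) : ∃ k > 0, ∀ M, ‖M‖ ≤ k * N M := by
  obtain ⟨k, hk, hNk⟩ := exists_seminorm_le N
  have hcont : Continuous N := by
    refine (LipschitzWith.of_dist_le_mul (K := ⟨k, hk.le⟩) fun x y => ?_).continuous
    rw [Real.dist_eq, dist_eq_norm]
    exact (abs_sub_map_le_sub N x y).trans (hNk _)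
  obtain ⟨κ, hκ, hb⟩ : ∃ κ > 0, ∀ M ∈ Metric.sphere (0 : Matrix (Fin n) (Fin n) ℂ) 1, κ ≤ N M := by
    rcases (Metric.sphere (0 : Matrix (Fin n) (Fin n) ℂ) 1).eq_empty_or_nonempty with he | hne
    · exact ⟨1, one_pos, by simp [he]⟩
    · obtain ⟨p, hp, hmin⟩ := (isCompact_sphere (0 : Matrix (Fin n) (Fin n) ℂ) 1).exists_isMinOn hne
        hcont.continuousOn
      refine ⟨_, lt_of_le_of_ne (apply_nonneg N p) fun h0 => ?_, fun p' hp' => hmin hp'⟩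
      rw [hN p h0.symm] at hp
      simp at hp
  refine ⟨κ⁻¹, inv_pos.mpr hκ, fun M => ?_⟩
  by_cases hM : M = 0
  · simp [hM]
  · have hM' : ‖M‖ ≠ 0 := norm_ne_zero_iff.mpr hM
    have h1 := hb (((‖M‖⁻¹ : ℝ) : ℂ) • M) (by simp [norm_smul, hM'])
    rw [map_smul_eq_mul, Complex.norm_real, Real.norm_of_nonneg (by positivity)] at h1
    rw [le_inv_mul_iff₀ hκ, mul_comm, ← le_inv_mul_iff₀ (by positivity)]
    exact h1

/-- The Fuchsian bound in terms of the coefficients of `1 / (x - l)`. -/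
lemma fuchsian_bound_eq (q h l C : ℝ) {s : ℕ} (hs : 1 ≤ s) :
    C * q ^ (s - 1) * (qhMonomial q h l (s - 1))⁻¹ = C * poleCoeff q h l s := by
  obtain ⟨s, rfl⟩ := Nat.exists_eq_add_of_le' hs
  rw [qhMonomial_real, inv_inv, Nat.add_sub_cancel, poleCoeff, mul_assoc]

end

section

/-! ### The domains `V^{(q,h)}(l)` -/

/-- The distance from `l` to `h / (1 - q)`, the nonpositive fixed point of `x ↦ q x + h`. -/
lemma norm_ofReal_sub_pole {q h l : ℝ} (hq : 1 < q) (hh : 0 ≤ h) (hl : 0 ≤ l) :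
    ‖(l : ℂ) - (h : ℂ) / (1 - (q : ℂ))‖ = l - h / (1 - q) := by
  have : (l : ℂ) - (h : ℂ) / (1 - (q : ℂ)) = ((l - h / (1 - q) : ℝ) : ℂ) := by push_cast; ring
  rw [this, Complex.norm_real, Real.norm_of_nonneg]
  have : h / (1 - q) ≤ 0 := div_nonpos_of_nonneg_of_nonpos hh (by linarith)
  linarith

/-- On `V^{(q,h)}(l)` the nodes are bounded below by the nodes at `l`. -/
lemma qhNode_le_norm {q h l : ℝ} (hq : 1 ≤ q) (hh : 0 ≤ h) (hl : 0 ≤ l) {x : ℂ}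
    (hx : x ∈ V q h l) (k : ℕ) :
    qhNode q h l k ≤ ‖((q ^ k : ℝ) : ℂ) * x + ((h * qNat q k : ℝ) : ℂ)‖ := by
  unfold V at hx
  have hqk : 0 ≤ q ^ k := by positivity
  split_ifs at hx with h0 h1
  · subst h0
    have h2 : ‖(l : ℂ)‖ < ‖x‖ := hx
    rw [Complex.norm_real, Real.norm_of_nonneg hl] at h2
    simp only [qhNode, zero_mul, add_zero, Complex.ofReal_zero, norm_mul, Complex.norm_real,
      Real.norm_of_nonneg hqk]
    exact mul_le_mul_of_nonneg_left h2.le hqk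
  · subst h1
    have h2 : l < x.re := by simpa using hx
    refine le_trans ?_ (Complex.re_le_norm _)
    simp [qhNode]
    linarith
  -- the `k`-th iterate multiplies the distance to the fixed point by `q^k`
  · have hq' : 1 < q := lt_of_le_of_ne hq (Ne.symm h1)
    have h2 : ‖(l : ℂ) - (h : ℂ) / (1 - (q : ℂ))‖ < ‖x - (h : ℂ) / (1 - (q : ℂ))‖ := hx
    rw [norm_ofReal_sub_pole hq' hh hl] at h2
    have hw : h / (1 - q) ≤ 0 := div_nonpos_of_nonneg_of_nonpos hh (by linarith)
    have hk : h * qNat q k = h / (1 - q) * (1 - q ^ k) := by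
      have e1 : 1 - q ≠ 0 := by linarith
      have := pow_eq_qNat q k
      rw [this]
      field_simp
      ring
    have e : ((q ^ k : ℝ) : ℂ) * x + ((h * qNat q k : ℝ) : ℂ) =
        ((q ^ k : ℝ) : ℂ) * (x - (h : ℂ) / (1 - (q : ℂ))) - ((-(h / (1 - q)) : ℝ) : ℂ) := by
      rw [hk]; push_cast; ring
    rw [e, qhNode, hk]
    refine le_trans ?_ (norm_sub_norm_le _ _)
    rw [norm_mul, Complex.norm_real, Complex.norm_real, Real.norm_of_nonneg hqk,
      Real.norm_of_nonneg (by linarith)]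
    nlinarith [mul_le_mul_of_nonneg_left h2.le hqk]

lemma isOpen_V (q h : ℝ) (l : ℂ) : IsOpen (V q h l) := by
  unfold V
  split_ifs
  · exact isOpen_lt continuous_const continuous_norm
  · exact isOpen_lt continuous_const Complex.continuous_re
  · exact isOpen_lt continuous_const (continuous_id.sub continuous_const).norm

/-- Large real numbers lie in `V^{(q,h)}(l)`. -/
lemma ofReal_mem_V {q h l : ℝ} (hq : 1 ≤ q) (hh : 0 ≤ h) (hl : 0 ≤ l) {R : ℝ}
    (hR : l < R) : (R : ℂ) ∈ V q h (l : ℂ) := by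
  unfold V
  split_ifs with h0 h1
  · change ‖(l : ℂ)‖ < ‖(R : ℂ)‖
    rw [Complex.norm_real, Complex.norm_real, Real.norm_of_nonneg hl,
      Real.norm_of_nonneg (by linarith)]
    exact hR
  · simpa using hR
  · have hq' : 1 < q := lt_of_le_of_ne hq (Ne.symm h1)
    change ‖(l : ℂ) - (h : ℂ) / (1 - (q : ℂ))‖ < ‖(R : ℂ) - (h : ℂ) / (1 - (q : ℂ))‖
    rw [norm_ofReal_sub_pole hq' hh hl, norm_ofReal_sub_pole hq' hh (by linarith)]
    linarith

/-! ### Convergence of factorial series -/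

lemma node_ne_zero {q h μ : ℝ} (hq : 1 ≤ q) (hh : 0 ≤ h) (hμ : 0 < μ) {x : ℂ}
    (hx : x ∈ V q h (μ : ℂ)) (k : ℕ) :
    algebraMap ℝ ℂ (q ^ k) * x + algebraMap ℝ ℂ (h * qNat q k) ≠ 0 := by
  rw [← norm_pos_iff]
  exact (qhNode_pos hq hh hμ k).trans_le (qhNode_le_norm hq hh hμ.le hx k)

lemma norm_inv_node_le {q h μ : ℝ} (hq : 1 ≤ q) (hh : 0 ≤ h) (hμ : 0 < μ) {x : ℂ}
    (hx : x ∈ V q h (μ : ℂ)) (k : ℕ) :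
    ‖(algebraMap ℝ ℂ (q ^ k) * x + algebraMap ℝ ℂ (h * qNat q k))⁻¹‖ ≤ (qhNode q h μ k)⁻¹ := by
  rw [norm_inv]
  exact inv_anti₀ (qhNode_pos hq hh hμ k) (qhNode_le_norm hq hh hμ.le hx k)

lemma qhMonomial_real_pos {q h μ : ℝ} (hq : 1 ≤ q) (hh : 0 ≤ h) (hμ : 0 < μ) (s : ℕ) :
    0 < qhMonomial q h μ s := by
  rw [qhMonomial_real]
  exact inv_pos.mpr (Finset.prod_pos fun k _ => qhNode_pos hq hh hμ k)

lemma norm_qhMonomial_le {q h μ : ℝ} (hq : 1 ≤ q) (hh : 0 ≤ h) (hμ : 0 < μ) {x : ℂ}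
    (hx : x ∈ V q h (μ : ℂ)) (s : ℕ) : ‖qhMonomial q h x s‖ ≤ qhMonomial q h μ s := by
  rw [qhMonomial_eq_prod, norm_prod, qhMonomial_eq_prod]
  exact Finset.prod_le_prod (fun k _ => norm_nonneg _) fun k _ => norm_inv_node_le hq hh hμ hx k

lemma isNodeInverse_field {K : Type*} [Field K] [Algebra ℝ K] (q h : ℝ) {x : K}
    (hx : ∀ k, algebraMap ℝ K (q ^ k) * x + algebraMap ℝ K (h * qNat q k) ≠ 0) :
    IsNodeInverse q h
      fun k => (algebraMap ℝ K (q ^ k) * x + algebraMap ℝ K (h * qNat q k))⁻¹ := by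
  intro i j hij
  obtain ⟨d, rfl⟩ := Nat.exists_eq_add_of_le hij
  have hi := hx i
  have hj := hx (i + d)
  rw [Nat.add_sub_cancel_left]
  have e : algebraMap ℝ K (q ^ (i + d)) * x + algebraMap ℝ K (h * qNat q (i + d)) =
      algebraMap ℝ K (q ^ d) * (algebraMap ℝ K (q ^ i) * x + algebraMap ℝ K (h * qNat q i)) +
        algebraMap ℝ K (h * qNat q d) := by
    rw [qNat_add, pow_add]; simp only [map_mul, map_add]; ring
  simp only [Algebra.smul_def]
  generalize algebraMap ℝ K (q ^ (i + d)) * x + algebraMap ℝ K (h * qNat q (i + d)) = Dj at *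
  generalize algebraMap ℝ K (q ^ i) * x + algebraMap ℝ K (h * qNat q i) = Di at *
  field_simp
  rw [e, mul_comm Di]

lemma inv_sub_rec {K : Type*} [Field K] [Algebra ℝ K] (q h l : ℝ) {x : K}
    (hx : ∀ k, algebraMap ℝ K (q ^ k) * x + algebraMap ℝ K (h * qNat q k) ≠ 0)
    (hxl : x - algebraMap ℝ K l ≠ 0) (s : ℕ) :
    (x - algebraMap ℝ K l)⁻¹ =
      q ^ s • (algebraMap ℝ K (q ^ s) * x + algebraMap ℝ K (h * qNat q s))⁻¹ +
      qhNode q h l s • ((algebraMap ℝ K (q ^ s) * x + algebraMap ℝ K (h * qNat q s))⁻¹ *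
        (x - algebraMap ℝ K l)⁻¹) := by
  have hs := hx s
  have e : algebraMap ℝ K (q ^ s) * x + algebraMap ℝ K (h * qNat q s) =
      algebraMap ℝ K (q ^ s) * (x - algebraMap ℝ K l) + algebraMap ℝ K (qhNode q h l s) := by
    rw [qhNode]; simp only [map_mul, map_add]; ring
  simp only [Algebra.smul_def]
  generalize algebraMap ℝ K (q ^ s) * x + algebraMap ℝ K (h * qNat q s) = D at *
  field_simp
  rw [e, mul_comm]

lemma real_node_ne_zero {q h μ : ℝ} (hq : 1 ≤ q) (hh : 0 ≤ h) (hμ : 0 < μ) (k : ℕ) :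
    algebraMap ℝ ℝ (q ^ k) * μ + algebraMap ℝ ℝ (h * qNat q k) ≠ 0 :=
  (qhNode_pos hq hh hμ k).ne'

/-- The partial sums are bounded because the remainder of the expansion is nonnegative. -/
lemma sum_poleCoeff_le {q h l μ : ℝ} (hq : 1 ≤ q) (hh : 0 ≤ h) (hl : 0 ≤ l) (hlμ : l < μ)
    (S : Finset ℕ) : ∑ s ∈ S, poleCoeff q h l s * qhMonomial q h μ s ≤ (μ - l)⁻¹ := by
  have hμ : 0 < μ := hl.trans_lt hlμ
  obtain ⟨K, hK⟩ := S.exists_nat_subset_range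
  have hnn : ∀ s, 0 ≤ poleCoeff q h l s * qhMonomial q h μ s := fun s =>
    mul_nonneg (poleCoeff_nonneg hq hh hl s) (qhMonomial_real_pos hq hh hμ s).le
  refine (Finset.sum_le_sum_of_subset_of_nonneg
    (hK.trans (Finset.range_subset_range.mpr (Nat.le_succ K))) fun s _ _ => hnn s).trans ?_
  have e := pole_eq_sum (inv_sub_rec q h l (real_node_ne_zero hq hh hμ)
    (by simpa using sub_ne_zero.mpr hlμ.ne')) K
  simp only [← qhMonomial_eq_prod] at e
  simp only [smul_eq_mul, Algebra.algebraMap_self, RingHom.id_apply] at e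
  rw [e, le_add_iff_nonneg_right]
  exact mul_nonneg (Finset.prod_nonneg fun k _ => qhNode_nonneg hq hh hl k)
    (mul_nonneg (qhMonomial_real_pos hq hh hμ K).le (inv_nonneg.mpr (by linarith)))

lemma summable_poleCoeff {q h l μ : ℝ} (hq : 1 ≤ q) (hh : 0 ≤ h) (hl : 0 ≤ l) (hlμ : l < μ) :
    Summable fun s => poleCoeff q h l s * qhMonomial q h μ s :=
  summable_of_sum_le (fun s => mul_nonneg (poleCoeff_nonneg hq hh hl s)
    (qhMonomial_real_pos hq hh (hl.trans_lt hlμ) s).le) (sum_poleCoeff_le hq hh hl hlμ)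

/-- The products of the quotients of nodes tend to zero: the harmonic series diverges. -/
lemma tendsto_prod_node_mul_monomial {q h l μ : ℝ} (hq : 1 ≤ q) (hh : 0 ≤ h) (hl : 0 ≤ l)
    (hlμ : l < μ) :
    Tendsto (fun K => (∏ k ∈ Finset.range K, qhNode q h l k) * qhMonomial q h μ K) atTop (𝓝 0) := by
  have hμ : 0 < μ := hl.trans_lt hlμ
  set a := (μ - l) / (μ + h) with ha
  have ha0 : 0 < a := div_pos (by linarith) (by linarith)
  have hnn : ∀ K, 0 ≤ (∏ k ∈ Finset.range K, qhNode q h l k) * qhMonomial q h μ K := fun K =>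
    mul_nonneg (Finset.prod_nonneg fun k _ => qhNode_nonneg hq hh hl k)
      (qhMonomial_real_pos hq hh hμ K).le
  -- the quotient of the nodes of index `k` is at most `1 - a / (k + 1)`, and such a product is at
  -- most the inverse of `1 + ∑ a / (k + 1)`
  have hbound : ∀ K : ℕ, (∏ k ∈ Finset.range K, qhNode q h l k) * qhMonomial q h μ K *
      (1 + a * ∑ k ∈ Finset.range K, (1 : ℝ) / ((k : ℝ) + 1)) ≤ 1 := by
    intro K
    induction K with
    | zero => simp [qhMonomial]
    | succ K ih =>
      have hμK := qhNode_pos hq hh hμ K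
      have hρ : qhNode q h l K * (qhNode q h μ K)⁻¹ ≤ 1 - a * (1 / ((K : ℝ) + 1)) := by
        have h1 : qhNode q h l K = qhNode q h μ K - q ^ K * (μ - l) := by unfold qhNode; ring
        have h2 : qhNode q h μ K ≤ q ^ K * ((μ + h) * ((K : ℝ) + 1)) := by
          unfold qhNode
          have := mul_le_mul_of_nonneg_left (qNat_le_mul_pow hq K) hh
          have h3 : 0 < q ^ K := by positivity
          have h4 : 0 ≤ q ^ K * (μ * K + h) := by positivity
          nlinarith
        rw [h1, sub_mul, mul_inv_cancel₀ hμK.ne', sub_le_sub_iff_left, ha,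
          ← div_eq_mul_inv, div_mul_div_comm, mul_one, div_le_div_iff₀ (by positivity) hμK]
        have := mul_le_mul_of_nonneg_left h2 (by linarith : 0 ≤ μ - l)
        nlinarith
      have hρ0 : 0 ≤ qhNode q h l K * (qhNode q h μ K)⁻¹ :=
        mul_nonneg (qhNode_nonneg hq hh hl K) (inv_nonneg.mpr hμK.le)
      have hS : 0 ≤ ∑ k ∈ Finset.range K, (1 : ℝ) / ((k : ℝ) + 1) :=
        Finset.sum_nonneg fun k _ => by positivity
      rw [Finset.prod_range_succ, Finset.sum_range_succ, qhMonomial_succ]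
      set R := (∏ k ∈ Finset.range K, qhNode q h l k) * qhMonomial q h μ K with hR
      set S := ∑ k ∈ Finset.range K, (1 : ℝ) / ((k : ℝ) + 1)
      set t := (1 : ℝ) / ((K : ℝ) + 1)
      have ht : 0 ≤ t := by positivity
      have e : (∏ k ∈ Finset.range K, qhNode q h l k) * qhNode q h l K *
          (qhMonomial q h μ K * (algebraMap ℝ ℝ (q ^ K) * μ + algebraMap ℝ ℝ (h * qNat q K))⁻¹) *
          (1 + a * (S + t)) = R * ((qhNode q h l K * (qhNode q h μ K)⁻¹) * (1 + a * (S + t))) := by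
        rw [hR]
        change _ * _ * (_ * (qhNode q h μ K)⁻¹) * _ = _
        ring
      rw [e]
      refine le_trans (mul_le_mul_of_nonneg_left ?_ (hnn K)) ih
      refine (mul_le_mul_of_nonneg_right hρ (by positivity)).trans ?_
      have h5 : 0 ≤ a * t * (a * S) := by positivity
      nlinarith [sq_nonneg (a * t)]
  have hlim : Tendsto (fun K : ℕ => (1 + a * ∑ k ∈ Finset.range K, (1 : ℝ) / ((k : ℝ) + 1))⁻¹)
      atTop (𝓝 0) :=
    tendsto_inv_atTop_zero.comp (tendsto_atTop_add_const_left _ _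
      (Tendsto.const_mul_atTop ha0 Real.tendsto_sum_range_one_div_nat_succ_atTop))
  refine squeeze_zero hnn (fun K => ?_) hlim
  have hS : 0 ≤ ∑ k ∈ Finset.range K, (1 : ℝ) / ((k : ℝ) + 1) :=
    Finset.sum_nonneg fun k _ => by positivity
  rw [← one_div, le_div_iff₀ (by positivity)]
  exact hbound K

lemma hasSum_poleCoeff {q h l μ : ℝ} (hq : 1 ≤ q) (hh : 0 ≤ h) (hl : 0 ≤ l) (hlμ : l < μ) {x : ℂ}
    (hx : x ∈ V q h (μ : ℂ)) (hxl : x - (l : ℂ) ≠ 0) :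
    HasSum (fun s => (poleCoeff q h l s : ℂ) * qhMonomial q h x s) (x - (l : ℂ))⁻¹ := by
  have hμ : 0 < μ := hl.trans_lt hlμ
  have hsum : Summable fun s => (poleCoeff q h l s : ℂ) * qhMonomial q h x s := by
    refine Summable.of_norm_bounded (summable_poleCoeff hq hh hl hlμ) fun s => ?_
    rw [norm_mul, Complex.norm_real, Real.norm_of_nonneg (poleCoeff_nonneg hq hh hl s)]
    exact mul_le_mul_of_nonneg_left (norm_qhMonomial_le hq hh hμ hx s) (poleCoeff_nonneg hq hh hl s)
  rw [hsum.hasSum_iff_tendsto_nat]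
  rw [← tendsto_add_atTop_iff_nat 1]
  have e := fun K => pole_eq_sum (inv_sub_rec q h l (node_ne_zero hq hh hμ hx) hxl) K
  simp only [← qhMonomial_eq_prod] at e
  simp only [Complex.real_smul, Complex.coe_algebraMap] at e
  have e' : (fun K => ∑ s ∈ Finset.range (K + 1), (poleCoeff q h l s : ℂ) * qhMonomial q h x s) =
      fun K => (x - (l : ℂ))⁻¹ - ((∏ k ∈ Finset.range K, qhNode q h l k : ℝ) : ℂ) *
        (qhMonomial q h x K * (x - (l : ℂ))⁻¹) := by
    funext K
    exact eq_sub_of_add_eq (e K).symm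
  rw [e']
  conv => rhs; rw [← sub_zero (x - (l : ℂ))⁻¹]
  refine tendsto_const_nhds.sub (squeeze_zero_norm (fun K => ?_)
    (by simpa using (tendsto_prod_node_mul_monomial hq hh hl hlμ).mul_const ‖x - (l : ℂ)‖⁻¹))
  rw [norm_mul, norm_mul, norm_inv, Complex.norm_real,
    Real.norm_of_nonneg (Finset.prod_nonneg fun k _ => qhNode_nonneg hq hh hl k), ← mul_assoc]
  refine mul_le_mul_of_nonneg_right (mul_le_mul_of_nonneg_left (norm_qhMonomial_le hq hh hμ hx K)
    (Finset.prod_nonneg fun k _ => qhNode_nonneg hq hh hl k)) (inv_nonneg.mpr (norm_nonneg _))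

/-! ### Products of convergent factorial series -/

/-- The inverse of the node at a real number. -/
def realNodeInv (q h μ : ℝ) (k : ℕ) : ℝ := (qhNode q h μ k)⁻¹

lemma isNodeInverse_real {q h μ : ℝ} (hq : 1 ≤ q) (hh : 0 ≤ h) (hμ : 0 < μ) :
    IsNodeInverse q h (realNodeInv q h μ) :=
  isNodeInverse_field q h (real_node_ne_zero hq hh hμ)

lemma realNodeInv_nonneg {q h μ : ℝ} (hq : 1 ≤ q) (hh : 0 ≤ h) (hμ : 0 < μ) (k : ℕ) :
    0 ≤ realNodeInv q h μ k := inv_nonneg.mpr (qhNode_pos hq hh hμ k).le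

lemma prod_realNodeInv (q h μ : ℝ) (s : ℕ) :
    ∏ k ∈ Finset.range s, realNodeInv q h μ k = qhMonomial q h μ s :=
  (qhMonomial_eq_prod q h μ s).symm

lemma prodRemainder_real_nonneg {q h μ : ℝ} (hq : 1 ≤ q) (hh : 0 ≤ h) (hμ : 0 < μ) (s t K : ℕ) :
    0 ≤ prodRemainder q h (realNodeInv q h μ) s t K :=
  Finset.sum_nonneg fun _ _ => mul_nonneg (transferCoeff_nonneg hq hh _ _ _)
    (mul_nonneg (Finset.prod_nonneg fun k _ => realNodeInv_nonneg hq hh hμ k)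
      (Finset.prod_nonneg fun k _ => realNodeInv_nonneg hq hh hμ k))

/-- The partial sums are bounded because the remainder of the expansion is nonnegative. -/
lemma sum_structCoeff_le {q h μ : ℝ} (hq : 1 ≤ q) (hh : 0 ≤ h) (hμ : 0 < μ) (s t : ℕ)
    (S : Finset ℕ) : ∑ j ∈ S, structCoeff q h s t j * qhMonomial q h μ j ≤
      qhMonomial q h μ s * qhMonomial q h μ t := by
  obtain ⟨K, hK⟩ := S.exists_nat_subset_range
  have hnn : ∀ j, 0 ≤ structCoeff q h s t j * qhMonomial q h μ j := fun j =>
    mul_nonneg (structCoeff_nonneg hq hh s t j) (qhMonomial_real_pos hq hh hμ j).le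
  refine (Finset.sum_le_sum_of_subset_of_nonneg
    (hK.trans (Finset.range_subset_range.mpr (by omega : K ≤ s + K + 1)))
    fun j _ _ => hnn j).trans ?_
  have e := prod_mul_prod_eq (isNodeInverse_real hq hh hμ) s t K
  simp only [prod_realNodeInv, smul_eq_mul] at e
  rw [e, le_add_iff_nonneg_right]
  exact prodRemainder_real_nonneg hq hh hμ s t K

lemma prodRemainder_real_le {q h μ : ℝ} (hq : 1 ≤ q) (hh : 0 ≤ h) (hμ : 0 < μ) (s t K : ℕ) :
    prodRemainder q h (realNodeInv q h μ) s t K ≤ qhMonomial q h μ s * qhMonomial q h μ t := by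
  have e := prod_mul_prod_eq (isNodeInverse_real hq hh hμ) s t K
  simp only [prod_realNodeInv, smul_eq_mul] at e
  rw [e, le_add_iff_nonneg_left]
  exact Finset.sum_nonneg fun j _ => mul_nonneg (structCoeff_nonneg hq hh s t j)
    (qhMonomial_real_pos hq hh hμ j).le

/-- The remainder at `μ` is compared with the bounded remainder at `ν = μ / 2`, where every term is
larger by at least the quotient of the monomials of order `K + s`. -/
lemma tendsto_prodRemainder_real {q h μ : ℝ} (hq : 1 ≤ q) (hh : 0 ≤ h) (hμ : 0 < μ) (s t : ℕ) :
    Tendsto (fun K => prodRemainder q h (realNodeInv q h μ) s t K) atTop (𝓝 0) := by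
  have hν : 0 < μ / 2 := by positivity
  have hνμ : μ / 2 < μ := by linarith
  have hlim := ((tendsto_add_atTop_iff_nat s).mpr
    (tendsto_prod_node_mul_monomial hq hh hν.le hνμ)).mul_const
      (qhMonomial q h (μ / 2) s * qhMonomial q h (μ / 2) t)
  rw [zero_mul] at hlim
  refine squeeze_zero (prodRemainder_real_nonneg hq hh hμ s t) (fun K => ?_) hlim
  have hP : 0 ≤ ∏ k ∈ Finset.range (K + s), qhNode q h (μ / 2) k :=
    Finset.prod_nonneg fun k _ => qhNode_nonneg hq hh hν.le k
  have hm : 0 ≤ qhMonomial q h μ (K + s) := (qhMonomial_real_pos hq hh hμ _).le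
  refine le_trans ?_ (mul_le_mul_of_nonneg_left (prodRemainder_real_le hq hh hν s t K)
    (mul_nonneg hP hm))
  unfold prodRemainder
  rw [Finset.mul_sum]
  refine Finset.sum_le_sum fun i _ => ?_
  rw [prod_realNodeInv, prod_realNodeInv, smul_eq_mul, smul_eq_mul, add_comm s K]
  have e : (∏ k ∈ Finset.range (K + s), qhNode q h (μ / 2) k) *
      qhMonomial q h (μ / 2) (K + s) = 1 := by
    rw [qhMonomial_real]
    exact mul_inv_cancel₀ (Finset.prod_ne_zero_iff.mpr fun k _ => (qhNode_pos hq hh hν k).ne')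
  have e2 : (∏ k ∈ Finset.range (K + s), qhNode q h (μ / 2) k) * qhMonomial q h μ (K + s) *
      (transferCoeff q h s K i *
        (qhMonomial q h (μ / 2) (K + s) * ∏ l ∈ Finset.Ico i t, realNodeInv q h (μ / 2) l)) =
      transferCoeff q h s K i *
        (qhMonomial q h μ (K + s) * ∏ l ∈ Finset.Ico i t, realNodeInv q h (μ / 2) l) := by
    linear_combination (qhMonomial q h μ (K + s) * transferCoeff q h s K i *
      ∏ l ∈ Finset.Ico i t, realNodeInv q h (μ / 2) l) * e
  rw [e2]
  refine mul_le_mul_of_nonneg_left (mul_le_mul_of_nonneg_left ?_ hm)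
    (transferCoeff_nonneg hq hh s K i)
  exact Finset.prod_le_prod (fun l _ => realNodeInv_nonneg hq hh hμ l) fun l _ =>
    inv_anti₀ (qhNode_pos hq hh hν l) (qhNode_mono hq hνμ.le l)

lemma hasSum_structCoeff {q h μ : ℝ} (hq : 1 ≤ q) (hh : 0 ≤ h) (hμ : 0 < μ) {x : ℂ}
    (hx : x ∈ V q h (μ : ℂ)) (s t : ℕ) :
    HasSum (fun j => (structCoeff q h s t j : ℂ) * qhMonomial q h x j)
      (qhMonomial q h x s * qhMonomial q h x t) := by
  have hsumR : Summable fun j => structCoeff q h s t j * qhMonomial q h μ j :=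
    summable_of_sum_le (fun j => mul_nonneg (structCoeff_nonneg hq hh s t j)
      (qhMonomial_real_pos hq hh hμ j).le) (sum_structCoeff_le hq hh hμ s t)
  have hsum : Summable fun j => (structCoeff q h s t j : ℂ) * qhMonomial q h x j := by
    refine Summable.of_norm_bounded hsumR fun j => ?_
    rw [norm_mul, Complex.norm_real, Real.norm_of_nonneg (structCoeff_nonneg hq hh s t j)]
    exact mul_le_mul_of_nonneg_left (norm_qhMonomial_le hq hh hμ hx j)
      (structCoeff_nonneg hq hh s t j)
  rw [hsum.hasSum_iff_tendsto_nat, ← tendsto_add_atTop_iff_nat (s + 1)]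
  set u := fun k => (algebraMap ℝ ℂ (q ^ k) * x + algebraMap ℝ ℂ (h * qNat q k))⁻¹ with hu
  have e := fun K => prod_mul_prod_eq (isNodeInverse_field q h (node_ne_zero hq hh hμ hx)) s t K
  simp only [← qhMonomial_eq_prod, Complex.real_smul] at e
  have e' : (fun K => ∑ j ∈ Finset.range (K + (s + 1)),
      (structCoeff q h s t j : ℂ) * qhMonomial q h x j) =
      fun K => qhMonomial q h x s * qhMonomial q h x t - prodRemainder q h u s t K := by
    funext K
    rw [e K, add_sub_cancel_right, add_comm K, add_right_comm]
  rw [e']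
  conv => rhs; rw [← sub_zero (qhMonomial q h x s * qhMonomial q h x t)]
  refine tendsto_const_nhds.sub (squeeze_zero_norm (fun K => ?_)
    (tendsto_prodRemainder_real hq hh hμ s t))
  unfold prodRemainder
  refine (norm_sum_le _ _).trans (Finset.sum_le_sum fun i _ => ?_)
  rw [norm_smul, Real.norm_of_nonneg (transferCoeff_nonneg hq hh s K i), norm_mul, norm_prod,
    norm_prod, smul_eq_mul]
  refine mul_le_mul_of_nonneg_left ?_ (transferCoeff_nonneg hq hh s K i)
  have hun : ∀ k, ‖u k‖ ≤ realNodeInv q h μ k := fun k => norm_inv_node_le hq hh hμ hx k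
  exact mul_le_mul (Finset.prod_le_prod (fun k _ => norm_nonneg _) fun k _ => hun k)
    (Finset.prod_le_prod (fun k _ => norm_nonneg _) fun k _ => hun k)
    (Finset.prod_nonneg fun k _ => norm_nonneg _)
    (Finset.prod_nonneg fun k _ => realNodeInv_nonneg hq hh hμ k)

open scoped Matrix.Norms.Operator

variable {n : ℕ}

lemma summable_norm_qhMonomial_smul {q h μ : ℝ} (hq : 1 ≤ q) (hh : 0 ≤ h) (hμ : 0 < μ) {x : ℂ}
    (hx : x ∈ V q h (μ : ℂ)) {a : ℕ → Matrix (Fin n) (Fin n) ℂ}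
    (ha : Summable fun s => ‖a s‖ * qhMonomial q h μ s) :
    Summable fun s => ‖qhMonomial q h x s • a s‖ := by
  refine Summable.of_nonneg_of_le (fun s => norm_nonneg _) (fun s => ?_) ha
  rw [norm_smul, mul_comm]
  exact mul_le_mul_of_nonneg_left (norm_qhMonomial_le hq hh hμ hx s) (norm_nonneg _)

/-- The product of the sums of two convergent factorial series. -/
lemma hasSum_qhConv {q h μ : ℝ} (hq : 1 ≤ q) (hh : 0 ≤ h) (hμ : 0 < μ) {x : ℂ}
    (hx : x ∈ V q h (μ : ℂ)) {a b : ℕ → Matrix (Fin n) (Fin n) ℂ}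
    (ha : Summable fun s => ‖a s‖ * qhMonomial q h μ s)
    (hb : Summable fun s => ‖b s‖ * qhMonomial q h μ s) :
    HasSum (fun j => qhMonomial q h x j • qhConv q h a b j)
      (qhSum q h a x * qhSum q h b x) := by
  have ha' := summable_norm_qhMonomial_smul hq hh hμ hx ha
  have hb' := summable_norm_qhMonomial_smul hq hh hμ hx hb
  set f : ℕ × ℕ → ℕ → Matrix (Fin n) (Fin n) ℂ := fun p j =>
    ((structCoeff q h p.1 p.2 j : ℂ) * qhMonomial q h x j) • (a p.1 * b p.2) with hf
  have hfsum : ∀ p, HasSum (f p)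
      ((qhMonomial q h x p.1 * qhMonomial q h x p.2) • (a p.1 * b p.2)) := fun p =>
    (hasSum_structCoeff hq hh hμ hx p.1 p.2).smul_const _
  have hfn : ∀ p j, ‖f p j‖ ≤ (structCoeff q h p.1 p.2 j * qhMonomial q h μ j) *
      (‖a p.1‖ * ‖b p.2‖) := by
    intro p j
    rw [hf, norm_smul, norm_mul, Complex.norm_real,
      Real.norm_of_nonneg (structCoeff_nonneg hq hh _ _ j)]
    exact mul_le_mul (mul_le_mul_of_nonneg_left (norm_qhMonomial_le hq hh hμ hx j)
      (structCoeff_nonneg hq hh _ _ j)) (norm_mul_le _ _) (norm_nonneg _)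
      (mul_nonneg (structCoeff_nonneg hq hh _ _ j) (qhMonomial_real_pos hq hh hμ j).le)
  have hsumR : ∀ p : ℕ × ℕ, Summable fun j => structCoeff q h p.1 p.2 j * qhMonomial q h μ j :=
    fun p => summable_of_sum_le (fun j => mul_nonneg (structCoeff_nonneg hq hh _ _ j)
      (qhMonomial_real_pos hq hh hμ j).le) (sum_structCoeff_le hq hh hμ p.1 p.2)
  have hfns : ∀ p, Summable fun j => ‖f p j‖ := fun p =>
    Summable.of_nonneg_of_le (fun j => norm_nonneg _) (hfn p) ((hsumR p).mul_right _)
  have hsummable : Summable (Function.uncurry f) := by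
    refine Summable.of_norm ?_
    rw [summable_prod_of_nonneg fun _ => norm_nonneg _]
    refine ⟨hfns, ?_⟩
    have hab : Summable fun p : ℕ × ℕ =>
        (‖a p.1‖ * qhMonomial q h μ p.1) * (‖b p.2‖ * qhMonomial q h μ p.2) :=
      ha.mul_of_nonneg hb
        (fun s => mul_nonneg (norm_nonneg _) (qhMonomial_real_pos hq hh hμ s).le)
        (fun s => mul_nonneg (norm_nonneg _) (qhMonomial_real_pos hq hh hμ s).le)
    refine Summable.of_nonneg_of_le (fun p => tsum_nonneg fun j => norm_nonneg _) (fun p => ?_) hab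
    calc ∑' j, ‖f p j‖ ≤ ∑' j, (structCoeff q h p.1 p.2 j * qhMonomial q h μ j) *
          (‖a p.1‖ * ‖b p.2‖) := (hfns p).tsum_le_tsum (hfn p) ((hsumR p).mul_right _)
      _ = (∑' j, structCoeff q h p.1 p.2 j * qhMonomial q h μ j) * (‖a p.1‖ * ‖b p.2‖) :=
          tsum_mul_right
      _ ≤ (qhMonomial q h μ p.1 * qhMonomial q h μ p.2) * (‖a p.1‖ * ‖b p.2‖) := by
          refine mul_le_mul_of_nonneg_right ((hsumR p).tsum_le_of_sum_le ?_) (by positivity)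
          exact sum_structCoeff_le hq hh hμ p.1 p.2
      _ = _ := by ring
  have e1 : qhSum q h a x * qhSum q h b x = ∑' p : ℕ × ℕ, ∑' j, f p j := by
    refine (tsum_mul_tsum_of_summable_norm ha' hb').trans (tsum_congr fun p => ?_)
    rw [(hfsum p).tsum_eq, smul_mul_smul_comm]
  have e2 : ∀ j, HasSum (fun p => f p j) (qhMonomial q h x j • qhConv q h a b j) := by
    intro j
    have h1 : qhMonomial q h x j • qhConv q h a b j =
        ∑ p ∈ Finset.range (j + 1) ×ˢ Finset.range (j + 1), f p j := by
      rw [Finset.sum_product, qhConv, Finset.smul_sum]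
      refine Finset.sum_congr rfl fun s _ => ?_
      rw [Finset.smul_sum]
      refine Finset.sum_congr rfl fun t _ => ?_
      simp only [hf]
      rw [mul_comm, mul_smul, Complex.coe_smul]
    rw [h1]
    refine hasSum_sum_of_ne_finset_zero fun p hp => ?_
    simp only [hf]
    rw [structCoeff_eq_zero, Complex.ofReal_zero, zero_mul, zero_smul]
    simp only [Finset.mem_product, Finset.mem_range, not_and_or] at hp
    omega
  have e3 : qhSum q h a x * qhSum q h b x = ∑' p : (ℕ × ℕ) × ℕ, Function.uncurry f p :=
    e1.trans (hsummable.tsum_prod' fun p => (hfns p).of_norm).symm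
  have e4 : HasSum (fun p : ℕ × (ℕ × ℕ) => Function.uncurry f p.swap)
      (∑' p : (ℕ × ℕ) × ℕ, Function.uncurry f p) :=
    (Equiv.prodComm ℕ (ℕ × ℕ)).hasSum_iff.mpr hsummable.hasSum
  rw [e3]
  exact e4.prod_fiberwise e2

end

section

/-! ### The gauge transformation as a matrix of functions -/

open scoped Matrix.Norms.Operator

variable {n : ℕ}

lemma summable_of_pole_bound {q h l μ K : ℝ} (hq : 1 ≤ q) (hh : 0 ≤ h) (hl : 0 ≤ l) (hlμ : l < μ)
    {a : ℕ → Matrix (Fin n) (Fin n) ℂ} (ha : ∀ s, 1 ≤ s → ‖a s‖ ≤ K * poleCoeff q h l s) :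
    Summable fun s => ‖a s‖ * qhMonomial q h μ s := by
  rw [← summable_nat_add_iff 1]
  have h1 := ((summable_nat_add_iff 1).mpr (summable_poleCoeff hq hh hl hlμ)).mul_left K
  have hm := fun s => (qhMonomial_real_pos hq hh (hl.trans_lt hlμ) s).le
  refine Summable.of_nonneg_of_le (fun s => mul_nonneg (norm_nonneg _) (hm _)) (fun s => ?_) h1
  rw [← mul_assoc]
  exact mul_le_mul_of_nonneg_right (ha (s + 1) (by omega)) (hm _)

lemma qhSum_apply {q h : ℝ} {x : ℂ} {a : ℕ → Matrix (Fin n) (Fin n) ℂ}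
    (ha : Summable fun s => qhMonomial q h x s • a s) (i j : Fin n) :
    qhSum q h a x i j = ∑' s, qhMonomial q h x s * a s i j := by
  rw [qhSum]
  have h1 : Summable fun s => (qhMonomial q h x s • a s) i := Pi.summable.mp ha i
  have e1 : (∑' s, qhMonomial q h x s • a s) i = ∑' s, (qhMonomial q h x s • a s) i :=
    tsum_apply ha
  rw [e1]
  exact tsum_apply h1

lemma le_norm_of_mem_V {q h μ : ℝ} (hq : 1 ≤ q) (hh : 0 ≤ h) (hμ : 0 ≤ μ) {x : ℂ}
    (hx : x ∈ V q h (μ : ℂ)) : μ ≤ ‖x‖ := by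
  simpa [qhNode, qNat_zero] using qhNode_le_norm hq hh hμ hx 0

lemma sub_ne_zero_of_mem_V {q h l μ : ℝ} (hq : 1 ≤ q) (hh : 0 ≤ h) (hl : 0 ≤ l) (hlμ : l < μ)
    {x : ℂ} (hx : x ∈ V q h (μ : ℂ)) : x - (l : ℂ) ≠ 0 := by
  intro H
  have h1 := le_norm_of_mem_V hq hh (by linarith) hx
  rw [sub_eq_zero.mp H, Complex.norm_real, Real.norm_of_nonneg hl] at h1
  linarith

lemma shiftBack_eq (q h : ℝ) (x : ℂ) :
    shiftBack q h x = algebraMap ℝ ℂ q⁻¹ * (x - algebraMap ℝ ℂ h) := by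
  simp [shiftBack, div_eq_inv_mul]

lemma shiftBack_ne_zero {q h : ℝ} (hq : q ≠ 0) {x : ℂ} (hx : x - (h : ℂ) ≠ 0) :
    shiftBack q h x ≠ 0 :=
  div_ne_zero hx (by exact_mod_cast hq)

lemma shiftBack_sub_ne_zero {q h μ : ℝ} (hq : 1 ≤ q) (hh : 0 ≤ h) (hμ : 0 < μ) {x : ℂ}
    (hx : x ∈ V q h (μ : ℂ)) (hqh : ¬(q = 1 ∧ h = 0)) : shiftBack q h x - x ≠ 0 := by
  intro H
  have hq0 : (q : ℂ) ≠ 0 := by exact_mod_cast (by linarith : q ≠ 0)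
  have h1 : (1 - (q : ℂ)) * x = h := by
    rw [shiftBack] at H
    field_simp at H
    linear_combination H
  have hx0 : x ≠ 0 := by
    have := le_norm_of_mem_V hq hh hμ.le hx
    rw [← norm_pos_iff]; linarith
  by_cases hq1 : q = 1
  · subst hq1
    simp at h1
    exact hqh ⟨rfl, by exact_mod_cast h1.symm⟩
  · have hq1' : 1 - (q : ℂ) ≠ 0 := sub_ne_zero.mpr (by exact_mod_cast Ne.symm hq1)
    by_cases hh0 : h = 0
    · rw [hh0, Complex.ofReal_zero] at h1
      exact (mul_ne_zero hq1' hx0) h1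
    · unfold V at hx
      rw [if_neg hh0, if_neg hq1] at hx
      have h2 : ‖(μ : ℂ) - (h : ℂ) / (1 - (q : ℂ))‖ < ‖x - (h : ℂ) / (1 - (q : ℂ))‖ := hx
      have h3 : x - (h : ℂ) / (1 - (q : ℂ)) = 0 := by
        rw [sub_eq_zero, eq_div_iff hq1', mul_comm]; exact h1
      rw [h3, norm_zero] at h2
      exact absurd h2 (not_lt.mpr (norm_nonneg _))

/-- The shift acts on the sums of factorial series as on monomials. -/
lemma qhSum_shiftBack {q h μ : ℝ} (hq : 1 ≤ q) (hh : 0 ≤ h) (hμ : 0 < μ) (hhμ : h < μ) {x : ℂ}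
    (hx : x ∈ V q h (μ : ℂ)) {F : ℕ → Matrix (Fin n) (Fin n) ℂ}
    (hF : Summable fun s => ‖F s‖ * qhMonomial q h μ s)
    (hF' : Summable fun s => ‖qNatSMul q F s‖ * qhMonomial q h μ s) :
    qhSum q h F (shiftBack q h x) = qhSum q h F x -
      ((shiftBack q h x - x) / shiftBack q h x) • qhSum q h (qNatSMul q F) x := by
  have h1 : Summable fun s => qhMonomial q h x s • F s :=
    (summable_norm_qhMonomial_smul hq hh hμ hx hF).of_norm
  have h2 : Summable fun s => qhMonomial q h x s • qNatSMul q F s :=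
    (summable_norm_qhMonomial_smul hq hh hμ hx hF').of_norm
  have hx0 := sub_ne_zero_of_mem_V hq hh hh hhμ hx
  have e : ∀ s, qhMonomial q h (shiftBack q h x) s • F s = qhMonomial q h x s • F s -
      ((shiftBack q h x - x) / shiftBack q h x) • (qhMonomial q h x s • qNatSMul q F s) := by
    intro s
    rw [shiftBack_eq, qhMonomial_shift (by linarith) hx0 (node_ne_zero hq hh hμ hx), sub_smul,
      qNatSMul, smul_smul, smul_smul]
    congr 2
    rw [Complex.coe_algebraMap]
    ring
  rw [qhSum, tsum_congr e]
  refine (Summable.tsum_sub h1 (h2.const_smul _)).trans ?_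
  congr 1
  exact Summable.tsum_const_smul _ h2

/-- The gauge equation for the sums of the series. -/
lemma qhSum_gauge {q h μ : ℝ} (hq : 1 ≤ q) (hh : 0 ≤ h) (hμ : 0 < μ) (hhμ : h < μ) {x : ℂ}
    (hx : x ∈ V q h (μ : ℂ)) {A F : ℕ → Matrix (Fin n) (Fin n) ℂ}
    (hA : Summable fun s => ‖A s‖ * qhMonomial q h μ s)
    (hF : Summable fun s => ‖F s‖ * qhMonomial q h μ s)
    (hF' : Summable fun s => ‖qNatSMul q F s‖ * qhMonomial q h μ s)
    (hrec : IsGaugeRecursion q h A F) :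
    qhSum q h A x * qhSum q h F x + qhSum q h (qNatSMul q F) x =
      qhSum q h F (shiftBack q h x) * A 0 := by
  have hx0 := sub_ne_zero_of_mem_V hq hh hh hhμ hx
  have hpole : Summable fun s => ‖poleMatrix (n := n) q h h s‖ * qhMonomial q h μ s := by
    refine summable_of_pole_bound (K := 1) hq hh hh hhμ fun s _ => ?_
    rw [poleMatrix, norm_smul, Complex.norm_real, Real.norm_of_nonneg (poleCoeff_nonneg hq hh hh s)]
    have h4 := poleCoeff_nonneg hq hh hh s
    have h5 : ‖(1 : Matrix (Fin n) (Fin n) ℂ)‖ ≤ 1 := norm_one_le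
    nlinarith
  have hpoleSum : qhSum q h (poleMatrix q h h) x =
      (x - (h : ℂ))⁻¹ • (1 : Matrix (Fin n) (Fin n) ℂ) := by
    have h1 := (hasSum_poleCoeff hq hh hh hhμ hx hx0).smul_const (1 : Matrix (Fin n) (Fin n) ℂ)
    refine Eq.trans (tsum_congr fun s => ?_) h1.tsum_eq
    rw [poleMatrix, smul_smul, mul_comm]
  have hsum : ∀ {a : ℕ → Matrix (Fin n) (Fin n) ℂ},
      (Summable fun s => ‖a s‖ * qhMonomial q h μ s) →
      Summable fun s => qhMonomial q h x s • a s := fun ha =>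
    (summable_norm_qhMonomial_smul hq hh hμ hx ha).of_norm
  have hρ : (shiftBack q h x - x) / shiftBack q h x =
      ((1 - q : ℝ) : ℂ) - ((q * h : ℝ) : ℂ) * (x - (h : ℂ))⁻¹ := by
    rw [shiftBack_eq, shift_ratio (by linarith) hx0]; rfl
  rw [qhSum_shiftBack hq hh hμ hhμ hx hF hF', hρ]
  have hD := (hsum hF').hasSum
  have hR := (hasSum_qhConv hq hh hμ hx hpole hF').mul_right (A 0)
  have hL := (hasSum_qhConv hq hh hμ hx hA hF).add hD
  have hR' := (((hsum hF).hasSum.mul_right (A 0)).sub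
    ((hD.mul_right (A 0)).const_smul ((1 - q : ℝ) : ℂ))).add (hR.const_smul ((q * h : ℝ) : ℂ))
  rw [hpoleSum] at hR'
  have e : (fun s => qhMonomial q h x s • qhConv q h A F s + qhMonomial q h x s • qNatSMul q F s) =
      fun s => (qhMonomial q h x s • F s) * A 0 -
        ((1 - q : ℝ) : ℂ) • ((qhMonomial q h x s • qNatSMul q F s) * A 0) +
        ((q * h : ℝ) : ℂ) • ((qhMonomial q h x s •
          qhConv q h (poleMatrix q h h) (qNatSMul q F) s) * A 0) := by
    funext s
    have h1 := hrec s
    rw [← smul_add, show qNatSMul q F s = (qNat q s : ℂ) • F s from rfl, h1, smul_add, smul_sub]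
    simp only [smul_mul_assoc]
    rw [smul_comm (qhMonomial q h x s) ((1 - q : ℝ) : ℂ),
      smul_comm (qhMonomial q h x s) ((q * h : ℝ) : ℂ)]
  rw [← e] at hR'
  refine (hL.unique hR').trans ?_
  simp only [sub_smul, mul_smul, sub_mul, smul_mul_assoc, one_mul, qhSum]
  rw [← sub_add]

end

section

open scoped Matrix.Norms.Operator

variable {n : ℕ}

/-! ### The sum of the reducing series -/

lemma differentiableOn_qhMonomial {q h μ : ℝ} (hq : 1 ≤ q) (hh : 0 ≤ h) (hμ : 0 < μ) (s : ℕ) :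
    DifferentiableOn ℂ (fun x => qhMonomial q h x s) (V q h (μ : ℂ)) := by
  intro x hx
  refine DifferentiableAt.differentiableWithinAt ?_
  unfold qhMonomial
  refine DifferentiableAt.inv (by fun_prop) ?_
  exact Finset.prod_ne_zero_iff.mpr fun k _ => node_ne_zero hq hh hμ hx k

lemma norm_qhMonomial_mul_entry_le {q h μ : ℝ} (hq : 1 ≤ q) (hh : 0 ≤ h) (hμ : 0 < μ) {x : ℂ}
    (hx : x ∈ V q h (μ : ℂ)) (a : ℕ → Matrix (Fin n) (Fin n) ℂ) (i j : Fin n) (s : ℕ) :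
    ‖qhMonomial q h x s * a s i j‖ ≤ ‖a s‖ * qhMonomial q h μ s := by
  rw [norm_mul, mul_comm]
  exact mul_le_mul (norm_entry_le _ i j) (norm_qhMonomial_le hq hh hμ hx s) (norm_nonneg _)
    (norm_nonneg _)

lemma qhSum_entry_eqOn {q h μ : ℝ} (hq : 1 ≤ q) (hh : 0 ≤ h) (hμ : 0 < μ)
    {F : ℕ → Matrix (Fin n) (Fin n) ℂ} (hF : Summable fun s => ‖F s‖ * qhMonomial q h μ s)
    (i j : Fin n) : Set.EqOn (fun x => qhSum q h F x i j)
      (fun x => ∑' s, qhMonomial q h x s * F s i j) (V q h (μ : ℂ)) := fun _ hx =>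
  qhSum_apply (summable_norm_qhMonomial_smul hq hh hμ hx hF).of_norm i j

lemma differentiableOn_qhSum {q h μ : ℝ} (hq : 1 ≤ q) (hh : 0 ≤ h) (hμ : 0 < μ)
    {F : ℕ → Matrix (Fin n) (Fin n) ℂ} (hF : Summable fun s => ‖F s‖ * qhMonomial q h μ s)
    (i j : Fin n) : DifferentiableOn ℂ (fun x => qhSum q h F x i j) (V q h (μ : ℂ)) := by
  refine DifferentiableOn.congr ?_ (qhSum_entry_eqOn hq hh hμ hF i j)
  exact Complex.differentiableOn_tsum_of_summable_norm hF
    (fun s => (differentiableOn_qhMonomial hq hh hμ s).mul_const _) (isOpen_V q h μ)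
    fun s x hx => norm_qhMonomial_mul_entry_le hq hh hμ hx F i j s

lemma qhMonomial_one_zero (x : ℂ) (s : ℕ) : qhMonomial 1 0 x s = (x ^ s)⁻¹ := by
  simp [qhMonomial]

/-- The operator `δ` multiplies the coefficients of a convergent factorial series by `-[s]_q`. -/
lemma delta_qhSum {q h μ : ℝ} (hq : 1 ≤ q) (hh : 0 ≤ h) (hμ : 0 < μ) (hhμ : h < μ) {x : ℂ}
    (hx : x ∈ V q h (μ : ℂ)) {F : ℕ → Matrix (Fin n) (Fin n) ℂ}
    (hF : Summable fun s => ‖F s‖ * qhMonomial q h μ s)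
    (hF' : Summable fun s => ‖qNatSMul q F s‖ * qhMonomial q h μ s) (i j : Fin n) :
    delta q h (fun t => qhSum q h F t i j) x = -qhSum q h (qNatSMul q F) x i j := by
  unfold delta
  split_ifs with h10
  · obtain ⟨rfl, rfl⟩ := h10
    have hx0 : x ≠ 0 := by
      have := le_norm_of_mem_V hq hh hμ.le hx
      rw [← norm_pos_iff]; linarith
    have h1 := (qhSum_entry_eqOn hq hh hμ hF i j).eventuallyEq_of_mem
      ((isOpen_V 1 0 μ).mem_nhds hx)
    rw [h1.deriv_eq]
    have h2 := Complex.hasSum_deriv_of_summable_norm hF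
      (fun s => (differentiableOn_qhMonomial hq hh hμ s).mul_const (F s i j)) (isOpen_V 1 0 μ)
      (fun s x hx => norm_qhMonomial_mul_entry_le hq hh hμ hx F i j s) hx
    rw [qhSum_apply (summable_norm_qhMonomial_smul hq hh hμ hx hF').of_norm, ← tsum_neg]
    refine (h2.mul_left x).tsum_eq.symm.trans (tsum_congr fun s => ?_)
    have h3 : HasDerivAt (fun x : ℂ => qhMonomial 1 0 x s * F s i j)
        (-(s * x ^ (s - 1)) / (x ^ s) ^ 2 * F s i j) x := by
      simp only [qhMonomial_one_zero]
      exact (((hasDerivAt_pow s x).inv (pow_ne_zero _ hx0))).mul_const _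
    rw [h3.deriv, qhMonomial_one_zero]
    simp only [qNatSMul, qNat, if_true, Matrix.smul_apply, smul_eq_mul, Complex.ofReal_natCast]
    rcases s with _ | s
    · simp
    · rw [Nat.add_sub_cancel]
      field_simp
      ring
  · simp only []
    rw [qhSum_shiftBack hq hh hμ hhμ hx hF hF']
    have h1 := shiftBack_sub_ne_zero hq hh hμ hx h10
    have h2 := shiftBack_ne_zero (q := q) (by linarith) (sub_ne_zero_of_mem_V hq hh hh hhμ hx)
    simp only [Matrix.sub_apply, Matrix.smul_apply, smul_eq_mul]
    field_simp
    ring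

lemma norm_qhSum_sub_le {q h μ : ℝ} (hq : 1 ≤ q) (hh : 0 ≤ h) (hμ : 0 < μ) {x : ℂ}
    (hx : x ∈ V q h (μ : ℂ)) {F : ℕ → Matrix (Fin n) (Fin n) ℂ}
    (hF : Summable fun s => ‖F s‖ * qhMonomial q h μ s) :
    ‖qhSum q h F x - F 0‖ ≤ ∑' s, ‖F (s + 1)‖ * qhMonomial q h μ (s + 1) := by
  have h1 := summable_norm_qhMonomial_smul hq hh hμ hx hF
  have h2 : qhSum q h F x - F 0 = ∑' s, qhMonomial q h x (s + 1) • F (s + 1) := by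
    have h3 := h1.of_norm.tsum_eq_zero_add
    have h4 : qhMonomial q h x 0 • F 0 = F 0 := by simp [qhMonomial]
    rw [h4] at h3
    rw [sub_eq_iff_eq_add']
    exact h3
  rw [h2]
  refine tsum_of_norm_bounded ((summable_nat_add_iff 1).mpr hF).hasSum fun s => ?_
  rw [norm_smul, mul_comm]
  exact mul_le_mul_of_nonneg_left (norm_qhMonomial_le hq hh hμ hx _) (norm_nonneg _)

/-- A factorial series tangent to the identity has invertible sum on a small enough domain. -/
lemma isUnit_qhSum {q h l M μ : ℝ} (hq : 1 ≤ q) (hh : 0 ≤ h) (hl : 0 ≤ l) (hM : 0 ≤ M)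
    (hμ : l + M < μ) {x : ℂ} (hx : x ∈ V q h (μ : ℂ)) {F : ℕ → Matrix (Fin n) (Fin n) ℂ}
    (hF0 : F 0 = 1) (hF : ∀ s, 1 ≤ s → ‖F s‖ ≤ M * poleCoeff q h l s) :
    IsUnit (qhSum q h F x) := by
  have hlμ : l < μ := by linarith
  have hμ0 : 0 < μ := by linarith
  have hm := fun s => (qhMonomial_real_pos hq hh hμ0 s).le
  have h1 := norm_qhSum_sub_le hq hh hμ0 hx (summable_of_pole_bound hq hh hl hlμ hF)
  have hs := (summable_nat_add_iff 1).mpr (summable_poleCoeff hq hh hl hlμ)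
  have h2 : ∑' s, ‖F (s + 1)‖ * qhMonomial q h μ (s + 1) ≤ M * (μ - l)⁻¹ := by
    calc _ ≤ ∑' s, M * (poleCoeff q h l (s + 1) * qhMonomial q h μ (s + 1)) := by
          refine Summable.tsum_le_tsum (fun s => ?_) ((summable_nat_add_iff 1).mpr
            (summable_of_pole_bound hq hh hl hlμ hF)) (hs.mul_left _)
          rw [← mul_assoc]
          exact mul_le_mul_of_nonneg_right (hF _ (by omega)) (hm _)
      _ = M * ∑' s, poleCoeff q h l (s + 1) * qhMonomial q h μ (s + 1) := tsum_mul_left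
      _ ≤ M * (μ - l)⁻¹ := by
          refine mul_le_mul_of_nonneg_left ?_ hM
          refine (le_trans ?_ ((summable_poleCoeff hq hh hl hlμ).tsum_le_of_sum_le
            (a₂ := (μ - l)⁻¹) fun N => ?_))
          · rw [(summable_poleCoeff hq hh hl hlμ).tsum_eq_zero_add]
            have := mul_nonneg (poleCoeff_nonneg hq hh hl 0) (hm 0)
            linarith
          · exact sum_poleCoeff_le hq hh hl hlμ N
  have h3 : M * (μ - l)⁻¹ < 1 := by
    rw [← div_eq_mul_inv, div_lt_one (by linarith)]
    linarith
  rw [hF0] at h1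
  have h4 : ‖1 - qhSum q h F x‖ < 1 := by
    rw [norm_sub_rev]; linarith
  simpa using isUnit_one_sub_of_norm_lt_one h4

/-- The sum `F` of the reducing series satisfies `δ F = A F - F((x - h)/q) A₀`. -/
lemma delta_qhSum_gauge {q h l M K μ : ℝ} (hq : 1 ≤ q) (hh : 0 ≤ h) (hl : h ≤ l) (hμ : l < μ)
    {x : ℂ} (hx : x ∈ V q h (μ : ℂ)) {A F : ℕ → Matrix (Fin n) (Fin n) ℂ}
    (hA : ∀ s, 1 ≤ s → ‖A s‖ ≤ K * poleCoeff q h l s)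
    (hF : ∀ s, 1 ≤ s → qNat q s * ‖F s‖ ≤ M * poleCoeff q h l s)
    (hF1 : ∀ s, 1 ≤ s → ‖F s‖ ≤ M * poleCoeff q h l s)
    (hrec : IsGaugeRecursion q h A F) :
    (Matrix.of fun i j => delta q h (fun t => qhSum q h F t i j) x) =
      qhSum q h A x * qhSum q h F x - qhSum q h F (shiftBack q h x) * A 0 := by
  have hl0 : 0 ≤ l := hh.trans hl
  have hμ0 : 0 < μ := by linarith
  have h1 := summable_of_pole_bound hq hh hl0 hμ hA
  have h2 := summable_of_pole_bound hq hh hl0 hμ hF1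
  have h3 := summable_of_pole_bound (a := qNatSMul q F) (K := M) hq hh hl0 hμ fun s hs => by
    rw [qNatSMul, norm_smul, Complex.norm_real, Real.norm_of_nonneg (qNat_nonneg hq s)]
    exact hF s hs
  rw [← qhSum_gauge hq hh hμ0 (by linarith) hx h1 h2 h3 hrec]
  ext i j
  rw [Matrix.of_apply, delta_qhSum hq hh hμ0 (by linarith) hx h2 h3]
  simp

end

section

open scoped Matrix.Norms.Operator

variable {n m : ℕ} {r : Fin m → ℕ}

/-! ### Uniform bounds for the family -/

lemma gaugeOp_lower_bound_of_conj {q κ B : ℝ} {s : ℕ} (hκ : 0 ≤ κ) (hB : 1 ≤ B) (hqs : 0 ≤ qNat q s)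
    {P P' A₀ J : Matrix (Fin n) (Fin n) ℂ} (hPP' : P * P' = 1) (hP'P : P' * P = 1)
    (hP : P * J = A₀ * P) (hPB : ‖P‖ ≤ B) (hPB' : ‖P'‖ ≤ B)
    (hop : ∀ X, κ * (qNat q s * ‖X‖) ≤ ‖gaugeOp q s J X‖) (X : Matrix (Fin n) (Fin n) ℂ) :
    κ / B ^ 4 * (qNat q s * ‖X‖) ≤ ‖gaugeOp q s A₀ X‖ := by
  have hB0 : 0 ≤ B := by linarith
  have h3 : ∀ {U Y W : Matrix (Fin n) (Fin n) ℂ}, ‖U‖ ≤ B → ‖W‖ ≤ B →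
      ‖U * Y * W‖ ≤ B ^ 2 * ‖Y‖ := by
    intro U Y W hU hW
    calc ‖U * Y * W‖ ≤ ‖U * Y‖ * ‖W‖ := norm_mul_le _ _
      _ ≤ (B * ‖Y‖) * B := mul_le_mul ((norm_mul_le _ _).trans
          (mul_le_mul_of_nonneg_right hU (norm_nonneg _))) hW (norm_nonneg _) (by positivity)
      _ = B ^ 2 * ‖Y‖ := by ring
  have h1 := hop (P' * X * P)
  rw [gaugeOp_conj q s hPP' hP'P hP] at h1
  have h2 : ‖X‖ ≤ B ^ 2 * ‖P' * X * P‖ := by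
    have : X = P * (P' * X * P) * P' := by
      rw [mul_assoc P' X P, ← mul_assoc P, hPP', one_mul, mul_assoc, hPP', mul_one]
    conv_lhs => rw [this]
    exact h3 hPB hPB'
  have h4 : ‖P' * gaugeOp q s A₀ X * P‖ ≤ B ^ 2 * ‖gaugeOp q s A₀ X‖ := h3 hPB' hPB
  rw [div_mul_eq_mul_div, div_le_iff₀ (by positivity)]
  calc κ * (qNat q s * ‖X‖) ≤ κ * (qNat q s * (B ^ 2 * ‖P' * X * P‖)) := by gcongr
    _ = B ^ 2 * (κ * (qNat q s * ‖P' * X * P‖)) := by ring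
    _ ≤ B ^ 2 * (B ^ 2 * ‖gaugeOp q s A₀ X‖) := by
        refine mul_le_mul_of_nonneg_left (h1.trans h4) (by positivity)
    _ = _ := by ring

/-- The reducing series of a Fuchsian family satisfy bounds which are uniform in `(q, h)`. -/
theorem exists_uniform_bound (N : Seminorm ℂ (Matrix (Fin n) (Fin n) ℂ))
    (hN : ∀ M, N M = 0 → M = 0) (Lam : Set (ℝ × ℝ)) (hLam : Lam ⊆ Qplus)
    (hLamBounded : Bornology.IsBounded Lam) (C lam : ℝ) (hC : 0 ≤ C) (hlam : 0 ≤ lam)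
    (A : ℝ → ℝ → ℕ → Matrix (Fin n) (Fin n) ℂ) (hA : IsFuchsianFamily N C lam Lam A)
    (c : Fin m → ℂ) (hrpos : ∀ i, 0 < r i) (hr : ∑ i, r i = n)
    (hJres : ∀ q h : ℝ, (q, h) ∈ closure Lam → IsNonresonant q (normalForm hr c q))
    (P : ℝ → ℝ → GL (Fin n) ℂ)
    (hP : ∀ q h : ℝ, (q, h) ∈ Lam →
      (P q h : Matrix (Fin n) (Fin n) ℂ) * normalForm hr c q = A q h 0 * (P q h).val)
    (hPbounded : ∃ B : ℝ, ∀ q h : ℝ, (q, h) ∈ Lam → N (P q h : Matrix (Fin n) (Fin n) ℂ) ≤ B)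
    (hPinvBounded : ∃ B : ℝ, ∀ q h : ℝ, (q, h) ∈ Lam →
      N (((P q h)⁻¹ : GL (Fin n) ℂ) : Matrix (Fin n) (Fin n) ℂ) ≤ B) :
    ∃ l M K : ℝ, 0 ≤ M ∧ lam ≤ l ∧ ∀ q h : ℝ, (q, h) ∈ Lam →
      h ≤ l ∧ (∀ s, 1 ≤ s → ‖A q h s‖ ≤ K * poleCoeff q h l s) ∧
      ∀ F : ℕ → Matrix (Fin n) (Fin n) ℂ, F 0 = 1 → IsGaugeRecursion q h (A q h) F →
        ∀ s, 1 ≤ s → qNat q s * ‖F s‖ ≤ M * poleCoeff q h (l + M) s := by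
  have hcl : closure Lam ⊆ Qplus :=
    closure_minimal hLam (isClosed_Ici.prod isClosed_Ici)
  have hKc : IsCompact (Prod.fst '' closure Lam) :=
    hLamBounded.isCompact_closure.image continuous_fst
  have hK1 : Prod.fst '' closure Lam ⊆ Set.Ici 1 := by
    rintro _ ⟨p, hp, rfl⟩; exact (hcl hp).1
  have hJc : ContinuousOn (normalForm hr c) (Prod.fst '' closure Lam) :=
    (continuousOn_normalForm hr hrpos c).mono fun q hq =>
      Set.mem_Ioi.mpr (lt_of_lt_of_le one_pos (hK1 hq))
  obtain ⟨κ, hκ, hop⟩ := exists_gaugeOp_lower_bound hKc hK1 (normalForm hr c) hJc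
    (by rintro _ ⟨⟨q, h⟩, hp, rfl⟩; exact hJres q h hp)
    (fun q hq => isUnit_one_add_normalForm hr hrpos c (hK1 hq))
  obtain ⟨BJ, hBJ⟩ := hKc.exists_bound_of_continuousOn hJc
  obtain ⟨k, hk, hkN⟩ := exists_norm_le_seminorm N hN
  obtain ⟨B₁, hB₁⟩ := hPbounded
  obtain ⟨B₂, hB₂⟩ := hPinvBounded
  obtain ⟨R₀, hR₀⟩ := isBounded_iff_forall_norm_le.mp hLamBounded
  set R := max R₀ 0 with hRdef
  have hR0 : 0 ≤ R := le_max_right _ _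
  set B := max 1 (max (k * B₁) (k * B₂)) with hBdef
  have hB1 : 1 ≤ B := le_max_left _ _
  set b := max BJ 0 with hbdef
  have hb0 : 0 ≤ b := le_max_right _ _
  have hκ' : 0 < κ / B ^ 4 := by positivity
  set M := (k * C + R * R * (B ^ 2 * b)) / (κ / B ^ 4) with hM
  have hM0 : 0 ≤ M := by positivity
  -- `l = lam + R` is at least `h`, as the majorant estimate requires
  refine ⟨lam + R, M, k * C, hM0, by linarith, fun q h hqh => ?_⟩
  have hq : 1 ≤ q := (hLam hqh).1
  have hh : 0 ≤ h := (hLam hqh).2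
  have hnorm := (hR₀ _ hqh).trans (le_max_left R₀ 0)
  have hqR : q ≤ R := (le_abs_self q).trans ((norm_fst_le (q, h)).trans hnorm)
  have hhR : h ≤ R := (le_abs_self h).trans ((norm_snd_le (q, h)).trans hnorm)
  have hqK : q ∈ Prod.fst '' closure Lam := ⟨(q, h), subset_closure hqh, rfl⟩
  have hAs : ∀ s, 1 ≤ s → ‖A q h s‖ ≤ k * C * poleCoeff q h (lam + R) s := by
    intro s hs
    have h1 := hA q h hqh s hs
    rw [fuchsian_bound_eq _ _ _ _ hs] at h1
    calc ‖A q h s‖ ≤ k * N (A q h s) := hkN _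
      _ ≤ k * (C * poleCoeff q h lam s) := by gcongr
      _ ≤ k * (C * poleCoeff q h (lam + R) s) := by
          gcongr
          exact poleCoeff_mono hq hh hlam (by linarith) s
      _ = _ := by ring
  refine ⟨by linarith, hAs, fun F hF0 hF => ?_⟩
  have hPB : ‖(P q h : Matrix (Fin n) (Fin n) ℂ)‖ ≤ B :=
    ((hkN _).trans (mul_le_mul_of_nonneg_left (hB₁ q h hqh) hk.le)).trans
      ((le_max_left _ _).trans (le_max_right _ _))
  have hPB' : ‖(((P q h)⁻¹ : GL (Fin n) ℂ) : Matrix (Fin n) (Fin n) ℂ)‖ ≤ B :=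
    ((hkN _).trans (mul_le_mul_of_nonneg_left (hB₂ q h hqh) hk.le)).trans
      ((le_max_right _ _).trans (le_max_right _ _))
  have hPP' : (P q h : Matrix (Fin n) (Fin n) ℂ) *
      (((P q h)⁻¹ : GL (Fin n) ℂ) : Matrix (Fin n) (Fin n) ℂ) = 1 := Units.mul_inv _
  have hP'P : (((P q h)⁻¹ : GL (Fin n) ℂ) : Matrix (Fin n) (Fin n) ℂ) *
      (P q h : Matrix (Fin n) (Fin n) ℂ) = 1 := Units.inv_mul _
  have hA0 : ‖A q h 0‖ ≤ B ^ 2 * b := by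
    have e : A q h 0 = (P q h : Matrix (Fin n) (Fin n) ℂ) * normalForm hr c q *
        (((P q h)⁻¹ : GL (Fin n) ℂ) : Matrix (Fin n) (Fin n) ℂ) := by
      rw [hP q h hqh, mul_assoc, hPP', mul_one]
    rw [e]
    calc _ ≤ ‖(P q h : Matrix (Fin n) (Fin n) ℂ)‖ * ‖normalForm hr c q‖ *
          ‖(((P q h)⁻¹ : GL (Fin n) ℂ) : Matrix (Fin n) (Fin n) ℂ)‖ :=
        (norm_mul_le _ _).trans (mul_le_mul_of_nonneg_right (norm_mul_le _ _) (norm_nonneg _))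
      _ ≤ B * b * B := by
          have := (hBJ q hqK).trans (le_max_left BJ 0)
          gcongr
      _ = _ := by ring
  refine qNat_mul_norm_le hq hh (by linarith : h ≤ lam + R) (by positivity : 0 ≤ k * C)
    (by positivity : 0 ≤ B ^ 2 * b) hκ' ?_ hAs hA0 ?_ hF0
    ((isGaugeRecursion_iff q h (A q h) F).mp hF)
  · rw [hM, mul_div_cancel₀ _ hκ'.ne']
    gcongr
  · intro s hs X
    exact gaugeOp_lower_bound_of_conj hκ.le hB1 (qNat_nonneg hq s) hPP' hP'P (hP q h hqh) hPB hPB'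
      (hop q hqK s hs) X

end

section

/-! ### Iterated derivatives of quotients with respect to a parameter -/

/-- The numerators of the iterated derivatives of `u / v` with respect to the first variable: the
`k`-th derivative is `quotDerivNum u v k / v ^ (k + 1)`. -/
def quotDerivNum (u v : ℂ × ℂ → ℂ) : ℕ → ℂ × ℂ → ℂ
  | 0 => u
  | k + 1 => fun p => fderiv ℂ (quotDerivNum u v k) p (1, 0) * v p -
      (k + 1) * quotDerivNum u v k p * fderiv ℂ v p (1, 0)

lemma analyticOnNhd_quotDerivNum {u v : ℂ × ℂ → ℂ} {S : Set (ℂ × ℂ)} (hu : AnalyticOnNhd ℂ u S)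
    (hv : AnalyticOnNhd ℂ v S) (k : ℕ) : AnalyticOnNhd ℂ (quotDerivNum u v k) S := by
  have happ : ∀ {w : ℂ × ℂ → ℂ}, AnalyticOnNhd ℂ w S →
      AnalyticOnNhd ℂ (fun p => fderiv ℂ w p (1, 0)) S := fun hw p hp =>
    ((ContinuousLinearMap.apply ℂ ℂ ((1, 0) : ℂ × ℂ)).analyticAt _).comp (hw.fderiv p hp)
  induction k with
  | zero => exact hu
  | succ k ih =>
    exact ((happ ih).mul hv).sub ((analyticOnNhd_const.mul ih).mul (happ hv))

lemma hasDerivAt_fst {w : ℂ × ℂ → ℂ} {b x : ℂ} (hw : AnalyticAt ℂ w (b, x)) :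
    HasDerivAt (fun t => w (t, x)) (fderiv ℂ w (b, x) (1, 0)) b :=
  HasFDerivAt.comp_hasDerivAt (f := fun t => (t, x)) b hw.differentiableAt.hasFDerivAt
    ((hasDerivAt_id b).prodMk (hasDerivAt_const b x))

lemma iteratedDeriv_quot {u v : ℂ × ℂ → ℂ} {x : ℂ} (hu : ∀ b, AnalyticAt ℂ u (b, x))
    (hv : ∀ b, AnalyticAt ℂ v (b, x)) (k : ℕ) {b : ℂ} (hb : v (b, x) ≠ 0) :
    iteratedDeriv k (fun t => u (t, x) / v (t, x)) b =
      quotDerivNum u v k (b, x) / v (b, x) ^ (k + 1) := by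
  induction k generalizing b with
  | zero => simp [quotDerivNum]
  | succ k ih =>
    have hR : AnalyticAt ℂ (quotDerivNum u v k) (b, x) :=
      analyticOnNhd_quotDerivNum (S := Set.univ ×ˢ {x}) (fun p hp => by
        obtain ⟨p1, p2⟩ := p; obtain rfl : p2 = x := hp.2; exact hu p1) (fun p hp => by
        obtain ⟨p1, p2⟩ := p; obtain rfl : p2 = x := hp.2; exact hv p1) k (b, x) ⟨trivial, rfl⟩
    have hvd := hasDerivAt_fst (hv b)
    have hev : ∀ᶠ t in 𝓝 b, v (t, x) ≠ 0 := hvd.continuousAt.eventually_ne hb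
    have h1 : iteratedDeriv k (fun t => u (t, x) / v (t, x)) =ᶠ[𝓝 b]
        fun t => quotDerivNum u v k (t, x) / v (t, x) ^ (k + 1) :=
      hev.mono fun t ht => ih ht
    rw [iteratedDeriv_succ, h1.deriv_eq,
      ((hasDerivAt_fst hR).fun_div (hvd.fun_pow (k + 1)) (pow_ne_zero _ hb)).deriv]
    simp only [quotDerivNum, Nat.add_sub_cancel]
    field_simp
    push_cast
    ring

lemma eventually_codiscreteWithin_of_punctured {U : Set ℂ} {p : ℂ → Prop}
    (hp : ∀ x ∈ U, ∀ᶠ y in 𝓝[≠] x, y ∈ U → p y) : ∀ᶠ x in codiscreteWithin U, p x := by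
  refine mem_codiscreteWithin.mpr fun x hx => ?_
  rw [disjoint_principal_right]
  filter_upwards [hp x hx] with y hy hy'
  exact hy'.2 (hy hy'.1)

lemma punctured_of_eventually_codiscreteWithin {U : Set ℂ} {p : ℂ → Prop}
    (hp : ∀ᶠ x in codiscreteWithin U, p x) {x : ℂ} (hx : x ∈ U) :
    ∀ᶠ y in 𝓝[≠] x, y ∈ U → p y := by
  have h1 := mem_codiscreteWithin.mp hp x hx
  rw [disjoint_principal_right] at h1
  filter_upwards [h1] with y hy hyU
  by_contra H
  exact hy ⟨hyU, H⟩

/-! ### Characters as quotients of analytic functions -/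

/-- A presentation of the characters `e_b` on `Ω` as quotients of functions which are jointly
analytic in `b` and `x`, together with the functional equation `δ e_b = -[-b]_q e_b`, in which `δ`
is written out. Numerators and denominators have isolated zeros in `x`. The equation is not asked
for `(q, h) = (1, 0)`, where `δ` is a derivation. -/
structure CharQuotient (L : ℂ → ℂ) (q h : ℝ) (Ω : Set ℂ) where
  num : ℂ × ℂ → ℂ
  den : ℂ × ℂ → ℂ
  isOpen : IsOpen Ω
  num_analytic : AnalyticOnNhd ℂ num (Set.univ ×ˢ Ω)
  den_analytic : AnalyticOnNhd ℂ den (Set.univ ×ˢ Ω)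
  char_eq : ∀ b, ∀ x ∈ Ω, qhChar L q h b x = num (b, x) / den (b, x)
  num_ne : ∀ b, ∀ x ∈ Ω, ∀ᶠ y in 𝓝[≠] x, num (b, y) ≠ 0
  den_ne : ∀ b, ∀ x ∈ Ω, ∀ᶠ y in 𝓝[≠] x, den (b, y) ≠ 0
  shift : ¬(q = 1 ∧ h = 0) → ∀ x ∈ Ω, x ≠ h → ∀ b, den (b, x) ≠ 0 →
    qhChar L q h b (shiftBack q h x) =
      (1 - qBracket q (-b) * ((shiftBack q h x - x) / shiftBack q h x)) * qhChar L q h b x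

namespace CharQuotient

variable {L : ℂ → ℂ} {q h : ℝ} {Ω : Set ℂ}

lemma num_analyticAt (E : CharQuotient L q h Ω) {b x : ℂ} (hx : x ∈ Ω) :
    AnalyticAt ℂ E.num (b, x) :=
  E.num_analytic _ ⟨trivial, hx⟩

lemma den_analyticAt (E : CharQuotient L q h Ω) {b x : ℂ} (hx : x ∈ Ω) :
    AnalyticAt ℂ E.den (b, x) :=
  E.den_analytic _ ⟨trivial, hx⟩

lemma qhLog_eq (E : CharQuotient L q h Ω) (c : ℂ) (k : ℕ) {x : ℂ} (hx : x ∈ Ω)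
    (hd : E.den (c, x) ≠ 0) :
    qhLog L q h c k x =
      (k.factorial : ℂ)⁻¹ * (quotDerivNum E.num E.den k (c, x) / E.den (c, x) ^ (k + 1)) := by
  have e : (fun b => qhChar L q h b x) = fun b => E.num (b, x) / E.den (b, x) :=
    funext fun b => E.char_eq b x hx
  rw [qhLog, e, iteratedDeriv_quot (fun b => E.num_analyticAt hx)
    (fun b => E.den_analyticAt hx) k hd]

lemma meromorphicAt_qhLog (E : CharQuotient L q h Ω) (c : ℂ) (k : ℕ) {x : ℂ} (hx : x ∈ Ω) :
    MeromorphicAt (qhLog L q h c k) x := by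
  have hslice : ∀ {w : ℂ × ℂ → ℂ}, AnalyticAt ℂ w (c, x) → MeromorphicAt (fun y => w (c, y)) x :=
    fun hw => (hw.comp₂ analyticAt_const analyticAt_id).meromorphicAt
  have h1 : MeromorphicAt (fun y => (k.factorial : ℂ)⁻¹ *
      (quotDerivNum E.num E.den k (c, y) / E.den (c, y) ^ (k + 1))) x :=
    (MeromorphicAt.const _ _).mul ((hslice (analyticOnNhd_quotDerivNum E.num_analytic
      E.den_analytic k _ ⟨trivial, hx⟩)).div ((hslice (E.den_analyticAt hx)).pow _))
  refine h1.congr ?_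
  filter_upwards [E.den_ne c x hx, nhdsWithin_le_nhds (E.isOpen.mem_nhds hx)] with y hy hyΩ
  exact (E.qhLog_eq c k hyΩ hy).symm

lemma qhLog_zero_ne (E : CharQuotient L q h Ω) (c : ℂ) {x : ℂ} (hx : x ∈ Ω) :
    ∀ᶠ y in 𝓝[≠] x, qhLog L q h c 0 y ≠ 0 := by
  filter_upwards [E.den_ne c x hx, E.num_ne c x hx,
    nhdsWithin_le_nhds (E.isOpen.mem_nhds hx)] with y hy hy' hyΩ
  have : qhLog L q h c 0 y = qhChar L q h c y := by simp [qhLog]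
  rw [this, E.char_eq c y hyΩ]
  exact div_ne_zero hy' hy

lemma contDiffAt_qBracket_neg (hq : 0 < q) (k : ℕ) (c : ℂ) :
    ContDiffAt ℂ k (fun b => -qBracket q (-b)) c := by
  have hq0 : (q : ℂ) ≠ 0 := by exact_mod_cast hq.ne'
  unfold qBracket
  split_ifs
  · fun_prop
  · have : AnalyticAt ℂ (fun b : ℂ => (q : ℂ) ^ (-b)) c := by
      refine AnalyticAt.congr (f := fun b => Complex.exp (Complex.log q * (-b))) (by fun_prop) ?_
      exact Eventually.of_forall fun b => (Complex.cpow_def_of_ne_zero hq0 _).symm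
    exact ((this.contDiffAt.sub contDiffAt_const).div_const _).neg

/-- The entries of the normal form are the Taylor coefficients of `-[-c]_q`. -/
lemma iteratedDeriv_neg_qBracket_neg (hq : 0 < q) (c : ℂ) (j : ℕ) :
    (j.factorial : ℂ)⁻¹ * iteratedDeriv j (fun b => -qBracket q (-b)) c = normalCoeff q c j := by
  have hq0 : (q : ℂ) ≠ 0 := by exact_mod_cast hq.ne'
  rcases j with _ | j
  · simp [normalCoeff]
  by_cases hq1 : q = 1
  · have e : (fun b => -qBracket q (-b)) = fun b : ℂ => b := by
      funext b; simp [qBracket, hq1]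
    rw [e, normalCoeff, if_pos hq1, iteratedDeriv_succ', show deriv (fun b : ℂ => b) = fun _ => 1
      from funext fun b => deriv_id b, iteratedDeriv_const]
    rcases j with _ | j <;> simp
  · have hq1' : (q : ℂ) - 1 ≠ 0 := sub_ne_zero.mpr (by exact_mod_cast hq1)
    have hq1'' : 1 - (q : ℂ) ≠ 0 := sub_ne_zero.mpr (by exact_mod_cast Ne.symm hq1)
    have e : (fun b => -qBracket q (-b)) = fun b : ℂ =>
        -(1 - (q : ℂ))⁻¹ + (1 - (q : ℂ))⁻¹ * Complex.exp (-Complex.log q * b) := by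
      funext b
      rw [qBracket, if_neg hq1, Complex.cpow_def_of_ne_zero hq0,
        show Complex.log q * -b = -Complex.log q * b by ring]
      field_simp
      ring
    rw [e, normalCoeff, if_neg hq1, iteratedDeriv_const_add (by omega),
      iteratedDeriv_const_mul _ (by fun_prop), iteratedDeriv_cexp_const_mul,
      Complex.cpow_def_of_ne_zero hq0, Complex.ofReal_log hq.le]
    rw [show Complex.log q * -c = -Complex.log q * c by ring]
    field_simp

/-- The logarithms form a Jordan chain for `δ`: apply `∂_c^k / k!` to the functional equation of the
characters. -/
lemma delta_qhLog (E : CharQuotient L q h Ω) (hq : 0 < q) (hqh : ¬(q = 1 ∧ h = 0)) (c : ℂ)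
    (k : ℕ) {x : ℂ} (hx : x ∈ Ω)
    (hxh : x ≠ h) (hxs : shiftBack q h x - x ≠ 0) (hd : E.den (c, x) ≠ 0) :
    delta q h (qhLog L q h c k) x =
      ∑ j ∈ Finset.range (k + 1), normalCoeff q c j * qhLog L q h c (k - j) x := by
  have hs0 : shiftBack q h x ≠ 0 :=
    div_ne_zero (sub_ne_zero.mpr hxh) (by exact_mod_cast hq.ne')
  have hchar : AnalyticAt ℂ (fun b => qhChar L q h b x) c := by
    have e : (fun b => qhChar L q h b x) = fun b => E.num (b, x) / E.den (b, x) :=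
      funext fun b => E.char_eq b x hx
    rw [e]
    exact ((E.num_analyticAt hx).comp₂ analyticAt_id analyticAt_const).div
      ((E.den_analyticAt hx).comp₂ analyticAt_id analyticAt_const) hd
  have hden : ∀ᶠ b in 𝓝 c, E.den (b, x) ≠ 0 :=
    (hasDerivAt_fst (E.den_analyticAt hx)).continuousAt.eventually_ne hd
  set τ := (shiftBack q h x - x) / shiftBack q h x with hτ
  have hev : (fun b => qhChar L q h b (shiftBack q h x)) =ᶠ[𝓝 c]
      fun b => qhChar L q h b x + τ * ((-qBracket q (-b)) * qhChar L q h b x) := by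
    filter_upwards [hden] with b hb
    rw [E.shift hqh x hx hxh b hb]
    ring
  have hprod : ContDiffAt ℂ k (fun b => (-qBracket q (-b)) * qhChar L q h b x) c :=
    (contDiffAt_qBracket_neg hq k c).mul hchar.contDiffAt
  have h1 : qhLog L q h c k (shiftBack q h x) = qhLog L q h c k x +
      τ * ((k.factorial : ℂ)⁻¹ *
        iteratedDeriv k (fun b => (-qBracket q (-b)) * qhChar L q h b x) c) := by
    rw [qhLog, hev.iteratedDeriv_eq,
      iteratedDeriv_fun_add hchar.contDiffAt (contDiffAt_const.mul hprod),
      iteratedDeriv_const_mul _ hprod, qhLog]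
    ring
  have h2 : (k.factorial : ℂ)⁻¹ *
      iteratedDeriv k (fun b => (-qBracket q (-b)) * qhChar L q h b x) c =
      ∑ j ∈ Finset.range (k + 1), normalCoeff q c j * qhLog L q h c (k - j) x := by
    rw [iteratedDeriv_fun_mul (contDiffAt_qBracket_neg hq k c) hchar.contDiffAt, Finset.mul_sum]
    refine Finset.sum_congr rfl fun j hj => ?_
    have hjk : j ≤ k := by simpa [Nat.lt_succ_iff] using hj
    rw [← iteratedDeriv_neg_qBracket_neg hq, qhLog, Nat.cast_choose ℂ hjk]
    have := Nat.factorial_ne_zero k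
    have := Nat.factorial_ne_zero j
    have := Nat.factorial_ne_zero (k - j)
    field_simp
  rw [delta, if_neg hqh, h1, h2, hτ]
  field_simp
  ring

end CharQuotient

end

section

/-! ### The characters -/

lemma eventually_ne_of_exists_ne {f : ℂ → ℂ} {Ω : Set ℂ} (hf : DifferentiableOn ℂ f Ω)
    (hΩ : IsOpen Ω) (hΩc : IsPreconnected Ω) {x₀ : ℂ} (hx₀ : x₀ ∈ Ω) (h0 : f x₀ ≠ 0) {x : ℂ}
    (hx : x ∈ Ω) : ∀ᶠ y in 𝓝[≠] x, f y ≠ 0 := by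
  by_contra H
  exact h0 ((hf.analyticOnNhd hΩ).eqOn_zero_of_preconnected_of_frequently_eq_zero hΩc hx
    H hx₀)

lemma analyticAt_const_cpow {a : ℂ} (ha : a ≠ 0) (b : ℂ) : AnalyticAt ℂ (fun b => a ^ b) b :=
  AnalyticAt.congr (f := fun b => Complex.exp (Complex.log a * b)) (by fun_prop)
    (Eventually.of_forall fun b => (Complex.cpow_def_of_ne_zero ha b).symm)

lemma analyticAt_const_cpow_fst {a : ℂ} (ha : a ≠ 0) (p : ℂ × ℂ) :
    AnalyticAt ℂ (fun p : ℂ × ℂ => a ^ p.1) p :=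
  (analyticAt_const_cpow ha p.1).comp analyticAt_fst

section Gamma

lemma analyticAt_snd_comp {f : ℂ → ℂ} (hf : Differentiable ℂ f) (p : ℂ × ℂ) :
    AnalyticAt ℂ (fun p : ℂ × ℂ => f p.2) p :=
  (hf.analyticAt p.2).fun_comp analyticAt_snd

/-- The characters for `q = 1`, `h > 0`, with `1 / Γ` entire. -/
def gammaQuotient (L : ℂ → ℂ) {h : ℝ} (hh : 0 < h) : CharQuotient L 1 h Set.univ where
  num p := (h : ℂ) ^ p.1 * (Complex.Gamma (1 - p.2 / h))⁻¹
  den p := (Complex.Gamma (1 + p.1 - p.2 / h))⁻¹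
  isOpen := isOpen_univ
  num_analytic p _ := (analyticAt_const_cpow_fst (by exact_mod_cast hh.ne') p).mul
    (analyticAt_snd_comp (Complex.differentiable_one_div_Gamma.comp
      (f := fun x : ℂ => 1 - x / h) (by fun_prop)) p)
  den_analytic p _ :=
    (Complex.differentiable_one_div_Gamma.analyticAt _).fun_comp
      (f := fun p : ℂ × ℂ => 1 + p.1 - p.2 / h) ((analyticAt_const.add analyticAt_fst).sub
        (analyticAt_snd_comp (f := fun x => x / h) (by fun_prop) p))
  char_eq b x _ := by
    rw [qhChar, if_neg (lt_irrefl _), if_pos hh, div_inv_eq_mul]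
    ring
  num_ne b x _ := by
    have hh0 : (h : ℂ) ≠ 0 := by exact_mod_cast hh.ne'
    refine eventually_ne_of_exists_ne (f := fun y => (h : ℂ) ^ b * (Complex.Gamma (1 - y / h))⁻¹)
      (x₀ := 0) (Ω := Set.univ) ?_ isOpen_univ isPreconnected_univ
      trivial ?_ trivial
    · exact ((Complex.differentiable_one_div_Gamma.comp
        (f := fun x : ℂ => 1 - x / h) (by fun_prop)).const_mul ((h : ℂ) ^ b)).differentiableOn
    · simp [Complex.cpow_eq_zero_iff, hh0]
  den_ne b x _ := by
    have hh0 : (h : ℂ) ≠ 0 := by exact_mod_cast hh.ne'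
    -- at `x = h b` the argument of `Γ` is `1`
    refine eventually_ne_of_exists_ne (x₀ := h * b) (Ω := Set.univ) ?_ isOpen_univ
      isPreconnected_univ trivial ?_ trivial
    · exact (Complex.differentiable_one_div_Gamma.comp
        (f := fun x : ℂ => 1 + b - x / h) (by fun_prop)).differentiableOn
    · rw [mul_div_cancel_left₀ _ hh0, add_sub_cancel_right, Complex.Gamma_one]
      simp
  shift _ x _ hxh b hd := by
    have hh0 : (h : ℂ) ≠ 0 := by exact_mod_cast hh.ne'
    have hxh' : x - h ≠ 0 := sub_ne_zero.mpr hxh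
    have h1 : 1 - x / h ≠ 0 := by
      rw [sub_ne_zero, ne_comm, Ne, div_eq_one_iff_eq hh0]; exact hxh
    have h2 : 1 + b - x / h ≠ 0 := by
      intro H
      rw [H, Complex.Gamma_zero] at hd
      simp at hd
    have e1 : 1 + b - (x - h) / h = (1 + b - x / h) + 1 := by field_simp; ring
    have e2 : 1 - (x - h) / h = (1 - x / h) + 1 := by field_simp; ring
    simp only [qhChar, lt_irrefl, if_false, if_pos hh, shiftBack, Complex.ofReal_one, div_one,
      qBracket, if_true]
    rw [e1, e2, Complex.Gamma_add_one _ h1, Complex.Gamma_add_one _ h2]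
    have e3 : 1 - -b * ((x - h - x) / (x - h)) = (1 + b - x / h) / (1 - x / h) := by
      rw [eq_div_iff h1]
      field_simp
      ring
    rw [e3, mul_div_mul_comm]
    ring

end Gamma

section Pochhammer

variable {p : ℝ}

lemma multipliable_pochhammer (hp0 : 0 ≤ p) (hp1 : p < 1) (x : ℂ) :
    Multipliable fun j : ℕ => 1 - (p : ℂ) ^ j * x := by
  simp only [sub_eq_add_neg]
  refine multipliable_one_add_of_summable ?_
  refine ((summable_geometric_of_lt_one hp0 hp1).mul_right ‖x‖).congr fun j => ?_
  rw [norm_neg, norm_mul, norm_pow, Complex.norm_real, Real.norm_of_nonneg hp0]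

lemma pochhammerInf_eq (hp0 : 0 ≤ p) (hp1 : p < 1) (x : ℂ) :
    pochhammerInf p x = (1 - x) * pochhammerInf p (p * x) := by
  rw [pochhammerInf, tprod_eq_zero_mul']
  · rw [pow_zero, one_mul, pochhammerInf]
    congr 1
    exact tprod_congr fun j => by ring
  · refine (multipliable_pochhammer hp0 hp1 (p * x)).congr fun j => ?_
    ring

lemma differentiable_pochhammerInf (hp0 : 0 ≤ p) (hp1 : p < 1) :
    Differentiable ℂ (pochhammerInf p) := by
  intro x
  have hx : x ∈ Metric.ball (0 : ℂ) (‖x‖ + 1) := by simp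
  have h1 := Summable.hasProdLocallyUniformlyOn_nat_one_add (K := Metric.ball (0 : ℂ) (‖x‖ + 1))
    (f := fun (j : ℕ) (z : ℂ) => -((p : ℂ) ^ j * z)) Metric.isOpen_ball
    ((summable_geometric_of_lt_one hp0 hp1).mul_right (‖x‖ + 1))
    (Eventually.of_forall fun j z hz => by
      rw [norm_neg, norm_mul, norm_pow, Complex.norm_real, Real.norm_of_nonneg hp0]
      have : ‖z‖ ≤ ‖x‖ + 1 := by simpa using (mem_ball_zero_iff.mp hz).le
      gcongr) (fun j => by fun_prop)
  have h2 : DifferentiableOn ℂ (fun z => ∏' j : ℕ, (1 + -((p : ℂ) ^ j * z)))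
      (Metric.ball (0 : ℂ) (‖x‖ + 1)) :=
    (hasProdLocallyUniformlyOn_iff_tendstoLocallyUniformlyOn.mp h1).differentiableOn
      (Eventually.of_forall fun s => by fun_prop) Metric.isOpen_ball
  have e : pochhammerInf p = fun z => ∏' j : ℕ, (1 + -((p : ℂ) ^ j * z)) := by
    funext z; simp only [pochhammerInf, sub_eq_add_neg]
  rw [e]
  exact h2.differentiableAt (Metric.isOpen_ball.mem_nhds hx)

lemma pochhammerInf_zero (p : ℝ) : pochhammerInf p 0 = 1 := by simp [pochhammerInf]

/-- The characters for `q > 1`, `h > 0`. -/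
def pochhammerQuotient (L : ℂ → ℂ) {q h : ℝ} (hq : 1 < q) (hh : 0 < h) :
    CharQuotient L q h Set.univ where
  num p := ((h / (1 - q⁻¹) : ℝ) : ℂ) ^ p.1 *
    pochhammerInf q⁻¹ ((1 - (q : ℂ)⁻¹) * (p.2 / h) + (q : ℂ)⁻¹)
  den p := pochhammerInf q⁻¹
    (((q⁻¹ : ℝ) : ℂ) ^ p.1 * ((1 - (q : ℂ)⁻¹) * (p.2 / h) + (q : ℂ)⁻¹))
  isOpen := isOpen_univ
  num_analytic p _ := by
    have hp1 : q⁻¹ < 1 := inv_lt_one_of_one_lt₀ hq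
    refine (analyticAt_const_cpow_fst ?_ p).mul (analyticAt_snd_comp
      ((differentiable_pochhammerInf (by positivity) hp1).comp
        (f := fun x : ℂ => (1 - (q : ℂ)⁻¹) * (x / h) + (q : ℂ)⁻¹) (by fun_prop)) p)
    exact_mod_cast (div_pos hh (by linarith)).ne'
  den_analytic p _ := by
    have hp1 : q⁻¹ < 1 := inv_lt_one_of_one_lt₀ hq
    refine ((differentiable_pochhammerInf (by positivity) hp1).analyticAt _).fun_comp
      (f := fun p : ℂ × ℂ => ((q⁻¹ : ℝ) : ℂ) ^ p.1 * ((1 - (q : ℂ)⁻¹) * (p.2 / h) + (q : ℂ)⁻¹))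
      ((analyticAt_const_cpow_fst ?_ p).mul (analyticAt_snd_comp
        (f := fun x => (1 - (q : ℂ)⁻¹) * (x / h) + (q : ℂ)⁻¹) (by fun_prop) p))
    exact_mod_cast (by positivity : q⁻¹ ≠ 0)
  char_eq b x _ := by
    rw [qhChar, if_pos hq, if_pos hh, mul_div_assoc]
  num_ne b x _ := by
    have hp1 : q⁻¹ < 1 := inv_lt_one_of_one_lt₀ hq
    have hh0 : (h : ℂ) ≠ 0 := by exact_mod_cast hh.ne'
    have hp1' : 1 - (q : ℂ)⁻¹ ≠ 0 := sub_ne_zero.mpr (by exact_mod_cast hp1.ne')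
    have hd := differentiable_pochhammerInf (by positivity : 0 ≤ q⁻¹) hp1
    -- at this point the argument of the infinite product is `0`
    refine eventually_ne_of_exists_ne (f := fun y => ((h / (1 - q⁻¹) : ℝ) : ℂ) ^ b *
      pochhammerInf q⁻¹ ((1 - (q : ℂ)⁻¹) * (y / h) + (q : ℂ)⁻¹))
      (x₀ := -(q : ℂ)⁻¹ * h / (1 - (q : ℂ)⁻¹)) (Ω := Set.univ) ?_ isOpen_univ
      isPreconnected_univ trivial ?_ trivial
    · exact ((hd.comp (f := fun x : ℂ => (1 - (q : ℂ)⁻¹) * (x / h) + (q : ℂ)⁻¹)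
        (by fun_prop)).const_mul (((h / (1 - q⁻¹) : ℝ) : ℂ) ^ b)).differentiableOn
    · have e : (1 - (q : ℂ)⁻¹) * (-(q : ℂ)⁻¹ * h / (1 - (q : ℂ)⁻¹) / h) + (q : ℂ)⁻¹ = 0 := by
        rw [div_right_comm, mul_div_cancel₀ _ hp1', mul_div_cancel_right₀ _ hh0, neg_add_cancel]
      simp only [e, pochhammerInf_zero, mul_one, Ne, Complex.cpow_eq_zero_iff, not_and_or]
      left
      exact_mod_cast (div_pos hh (by linarith)).ne'
  den_ne b x _ := by
    have hp1 : q⁻¹ < 1 := inv_lt_one_of_one_lt₀ hq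
    have hh0 : (h : ℂ) ≠ 0 := by exact_mod_cast hh.ne'
    have hp1' : 1 - (q : ℂ)⁻¹ ≠ 0 := sub_ne_zero.mpr (by exact_mod_cast hp1.ne')
    have hd := differentiable_pochhammerInf (by positivity : 0 ≤ q⁻¹) hp1
    -- at this point the argument of the infinite product is `0`
    refine eventually_ne_of_exists_ne (x₀ := -(q : ℂ)⁻¹ * h / (1 - (q : ℂ)⁻¹)) (Ω := Set.univ) ?_
      isOpen_univ isPreconnected_univ trivial ?_ trivial
    · exact (hd.comp (f := fun x : ℂ => ((q⁻¹ : ℝ) : ℂ) ^ b *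
        ((1 - (q : ℂ)⁻¹) * (x / h) + (q : ℂ)⁻¹)) (by fun_prop)).differentiableOn
    · have e : (1 - (q : ℂ)⁻¹) * (-(q : ℂ)⁻¹ * h / (1 - (q : ℂ)⁻¹) / h) + (q : ℂ)⁻¹ = 0 := by
        rw [div_right_comm, mul_div_cancel₀ _ hp1', mul_div_cancel_right₀ _ hh0, neg_add_cancel]
      simp only [e, mul_zero, pochhammerInf_zero]
      exact one_ne_zero
  shift _ x _ hxh b hd := by
    have hp1 : q⁻¹ < 1 := inv_lt_one_of_one_lt₀ hq
    have hp0 : 0 ≤ q⁻¹ := by positivity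
    have hh0 : (h : ℂ) ≠ 0 := by exact_mod_cast hh.ne'
    have hq0 : (q : ℂ) ≠ 0 := by exact_mod_cast (by linarith : q ≠ 0)
    have hq1 : (q : ℂ) - 1 ≠ 0 := sub_ne_zero.mpr (by exact_mod_cast hq.ne')
    have hxh' : x - h ≠ 0 := sub_ne_zero.mpr hxh
    simp only [qhChar, if_pos hq, if_pos hh]
    set z := (1 - (q : ℂ)⁻¹) * (x / h) + (q : ℂ)⁻¹ with hz
    set a := ((q⁻¹ : ℝ) : ℂ) ^ b with ha
    have hab : (q : ℂ) ^ (-b) = a := by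
      rw [ha, Complex.cpow_neg, Complex.ofReal_inv, Complex.inv_cpow _ _ ?_]
      rw [Complex.arg_ofReal_of_nonneg (by linarith)]
      exact Real.pi_pos.ne
    have e1 : (1 - (q : ℂ)⁻¹) * (shiftBack q h x / h) + (q : ℂ)⁻¹ = ((q⁻¹ : ℝ) : ℂ) * z := by
      rw [hz, shiftBack]
      push_cast
      field_simp
      ring
    have hz1 : 1 - z = ((q : ℂ) - 1) * (h - x) / (q * h) := by
      rw [hz]; field_simp; ring
    have hz0 : 1 - z ≠ 0 := by
      rw [hz1]
      exact div_ne_zero (mul_ne_zero hq1 (sub_ne_zero.mpr (Ne.symm hxh))) (mul_ne_zero hq0 hh0)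
    have h1 := pochhammerInf_eq hp0 hp1 z
    have h2 := pochhammerInf_eq hp0 hp1 (a * z)
    have hd' : pochhammerInf q⁻¹ (a * z) ≠ 0 := hd
    rw [h2] at hd'
    have hd1 := left_ne_zero_of_mul hd'
    have hd2 := right_ne_zero_of_mul hd'
    rw [e1, h1, h2, ← mul_assoc a, mul_comm a, mul_assoc, qBracket, if_neg hq.ne', hab]
    have e3 : 1 - (a - 1) / ((q : ℂ) - 1) * ((shiftBack q h x - x) / shiftBack q h x) =
        (1 - a * z) / (1 - z) := by
      rw [hz1, hz, shiftBack]
      have hxh'' : (h : ℂ) - x ≠ 0 := sub_ne_zero.mpr (Ne.symm hxh)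
      field_simp
      ring
    rw [e3]
    generalize pochhammerInf q⁻¹ (((q⁻¹ : ℝ) : ℂ) * z) = Y
    generalize pochhammerInf q⁻¹ (((q⁻¹ : ℝ) : ℂ) * (a * z)) = Z at hd2 ⊢
    generalize ((h / (1 - q⁻¹) : ℝ) : ℂ) ^ b = w
    field_simp

end Pochhammer

end

section

/-! ### The theta function -/

section Theta

variable {q : ℝ}

lemma two_mul_ediv_two (n : ℤ) : 2 * (n * (n - 1) / 2) = n * (n - 1) :=
  Int.mul_ediv_cancel' (Int.even_mul_pred_self n).two_dvd

lemma theta_term_eq (hq : 0 < q) (w : ℂ) (n : ℤ) :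
    (-1 : ℂ) ^ n * (q : ℂ) ^ (-(n * (n - 1) / 2)) * Complex.exp w ^ n =
      jacobiTheta₂_term n ((Real.pi * Complex.I + w + Real.log q / 2) / (2 * Real.pi * Complex.I))
        (Complex.I * Real.log q / (2 * Real.pi)) := by
  have hπ : (Real.pi : ℂ) ≠ 0 := by exact_mod_cast Real.pi_ne_zero
  have h1 : (-1 : ℂ) ^ n = Complex.exp (n * (Real.pi * Complex.I)) := by
    rw [Complex.exp_int_mul, Complex.exp_pi_mul_I]
  have h2 : (q : ℂ) ^ (-(n * (n - 1) / 2)) =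
      Complex.exp (((-(n * (n - 1) / 2) : ℤ) : ℂ) * Real.log q) := by
    rw [Complex.exp_int_mul, ← Complex.ofReal_exp, Real.exp_log hq]
  rw [h1, h2, ← Complex.exp_int_mul, ← Complex.exp_add, ← Complex.exp_add, jacobiTheta₂_term]
  congr 1
  have h3 : (2 : ℂ) * ((n * (n - 1) / 2 : ℤ) : ℂ) = n * (n - 1) := by
    exact_mod_cast two_mul_ediv_two n
  push_cast
  have hI := Complex.I_sq
  field_simp
  rw [hI]
  linear_combination (-(Real.log q : ℂ)) * h3

/-- The series `Θ_q` is a Jacobi theta function in the variable `log x`. -/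
lemma theta_exp (hq : 0 < q) (w : ℂ) : theta q (Complex.exp w) =
    jacobiTheta₂ ((Real.pi * Complex.I + w + Real.log q / 2) / (2 * Real.pi * Complex.I))
      (Complex.I * Real.log q / (2 * Real.pi)) :=
  tsum_congr fun n => theta_term_eq hq w n

lemma theta_modulus_im_pos (hq : 1 < q) : 0 < (Complex.I * Real.log q / (2 * Real.pi)).im := by
  have e : Complex.I * Real.log q / (2 * Real.pi) =
      ((Real.log q / (2 * Real.pi) : ℝ) : ℂ) * Complex.I := by push_cast; ring
  rw [e, Complex.im_ofReal_mul, Complex.I_im, mul_one]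
  exact div_pos (Real.log_pos hq) (by positivity)

lemma differentiableAt_theta (hq : 1 < q) {x : ℂ} (hx : x ≠ 0) :
    DifferentiableAt ℂ (theta q) x := by
  have h1 : DifferentiableAt ℂ (fun y => Complex.log (y / x) + Complex.log x) x := by
    refine DifferentiableAt.add_const _ (DifferentiableAt.clog (by fun_prop) ?_)
    rw [div_self hx]; exact Complex.one_mem_slitPlane
  have h2 := (differentiableAt_jacobiTheta₂_fst ((Real.pi * Complex.I +
      (Complex.log (x / x) + Complex.log x) + Real.log q / 2) / (2 * Real.pi * Complex.I))
      (theta_modulus_im_pos hq)).comp x (f := fun y => (Real.pi * Complex.I +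
      (Complex.log (y / x) + Complex.log x) + Real.log q / 2) / (2 * Real.pi * Complex.I))
      (by fun_prop)
  refine h2.congr_of_eventuallyEq ?_
  filter_upwards [isOpen_compl_singleton.mem_nhds hx] with y hy
  have hy0 : y ≠ 0 := hy
  have e : Complex.exp (Complex.log (y / x) + Complex.log x) = y := by
    rw [Complex.exp_add, Complex.exp_log (div_ne_zero hy0 hx), Complex.exp_log hx,
      div_mul_cancel₀ _ hx]
  conv_lhs => rw [← e]
  exact theta_exp (by linarith) _

/-- The functional equation of `Θ_q`, by a shift of the index of summation. -/
lemma theta_div (hq : q ≠ 0) {x : ℂ} (hx : x ≠ 0) : theta q (x / q) = -(theta q x / x) := by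
  have hq0 : (q : ℂ) ≠ 0 := by exact_mod_cast hq
  have e : ∀ n : ℤ, (-1 : ℂ) ^ n * (q : ℂ) ^ (-(n * (n - 1) / 2)) * (x / q) ^ n =
      -x⁻¹ * ((-1 : ℂ) ^ (n + 1) * (q : ℂ) ^ (-((n + 1) * (n + 1 - 1) / 2)) * x ^ (n + 1)) := by
    intro n
    have h1 : (n + 1) * (n + 1 - 1) / 2 = n * (n - 1) / 2 + n := by
      have h2 := two_mul_ediv_two n
      have h3 := two_mul_ediv_two (n + 1)
      have h4 : (n + 1) * (n + 1 - 1) = n * (n - 1) + 2 * n := by ring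
      omega
    rw [h1, neg_add, zpow_add₀ hq0, div_zpow, zpow_add₀ hx, zpow_add₀ (by norm_num), zpow_neg _ n]
    field_simp
  have h5 := (Equiv.addRight (1 : ℤ)).tsum_eq fun n : ℤ =>
    (-1 : ℂ) ^ n * (q : ℂ) ^ (-(n * (n - 1) / 2)) * x ^ n
  simp only [Equiv.coe_addRight] at h5
  rw [theta, tsum_congr e, tsum_mul_left, h5, theta]
  ring

/-- All the terms of the series `Θ_q(-1)` are positive. -/
lemma theta_neg_one_ne_zero (hq : 1 < q) : theta q (-1) ≠ 0 := by
  have hq0 : 0 < q := by linarith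
  have h1 : Summable fun n : ℤ => (-1 : ℂ) ^ n * (q : ℂ) ^ (-(n * (n - 1) / 2)) * (-1) ^ n := by
    have h2 := (summable_jacobiTheta₂_term_iff ((Real.pi * Complex.I + Real.pi * Complex.I +
      Real.log q / 2) / (2 * Real.pi * Complex.I)) _).mpr (theta_modulus_im_pos hq)
    refine h2.congr fun n => ?_
    rw [← theta_term_eq hq0, Complex.exp_pi_mul_I]
  have e : ∀ n : ℤ, (-1 : ℂ) ^ n * (q : ℂ) ^ (-(n * (n - 1) / 2)) * (-1) ^ n =
      ((q ^ (-(n * (n - 1) / 2)) : ℝ) : ℂ) := by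
    intro n
    rw [mul_right_comm, ← mul_zpow]
    simp
  have h3 : Summable fun n : ℤ => q ^ (-(n * (n - 1) / 2)) := by
    rw [← Complex.summable_ofReal]
    exact h1.congr e
  rw [theta, tsum_congr e, ← Complex.ofReal_tsum]
  exact_mod_cast (h3.tsum_pos (fun n => (zpow_pos hq0 _).le) 0 (zpow_pos hq0 _)).ne'

/-- The characters for `q > 1`, `h = 0`. -/
def thetaQuotient (L : ℂ → ℂ) (hq : 1 < q) : CharQuotient L q 0 {0}ᶜ where
  num p := theta q p.2
  den p := theta q (((q : ℂ) ^ p.1)⁻¹ * p.2)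
  isOpen := isOpen_compl_singleton
  num_analytic p hp := by
    have h1 : DifferentiableOn ℂ (theta q) {0}ᶜ := fun x hx =>
      (differentiableAt_theta hq hx).differentiableWithinAt
    exact (h1.analyticAt (isOpen_compl_singleton.mem_nhds hp.2)).fun_comp analyticAt_snd
  den_analytic p hp := by
    have hq0 : (q : ℂ) ≠ 0 := by exact_mod_cast (by linarith : q ≠ 0)
    have hp0 : (q : ℂ) ^ p.1 ≠ 0 := by simp [Complex.cpow_eq_zero_iff, hq0]
    have h1 : DifferentiableOn ℂ (theta q) {0}ᶜ := fun x hx =>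
      (differentiableAt_theta hq hx).differentiableWithinAt
    refine (h1.analyticAt (isOpen_compl_singleton.mem_nhds ?_)).fun_comp
      (f := fun p : ℂ × ℂ => ((q : ℂ) ^ p.1)⁻¹ * p.2)
      (((analyticAt_const_cpow_fst hq0 p).inv hp0).mul analyticAt_snd)
    exact mul_ne_zero (inv_ne_zero hp0) hp.2
  char_eq b x _ := by rw [qhChar, if_pos hq, if_neg (lt_irrefl _)]
  num_ne b x hx := by
    refine eventually_ne_of_exists_ne (f := theta q) (x₀ := -1) (Ω := {0}ᶜ)
      (fun x hx => (differentiableAt_theta hq hx).differentiableWithinAt) isOpen_compl_singleton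
      (isConnected_compl_singleton_of_one_lt_rank (by simp) 0).isPreconnected (by simp)
      (theta_neg_one_ne_zero hq) hx
  den_ne b x hx := by
    have hq0 : (q : ℂ) ≠ 0 := by exact_mod_cast (by linarith : q ≠ 0)
    have hp0 : (q : ℂ) ^ b ≠ 0 := by simp [Complex.cpow_eq_zero_iff, hq0]
    refine eventually_ne_of_exists_ne (f := fun y => theta q (((q : ℂ) ^ b)⁻¹ * y))
      (x₀ := -(q : ℂ) ^ b) (Ω := {0}ᶜ) (fun y hy => ?_) isOpen_compl_singleton
      (isConnected_compl_singleton_of_one_lt_rank (by simp) 0).isPreconnected (by simpa using hp0)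
      ?_ hx
    · refine DifferentiableAt.differentiableWithinAt ?_
      exact (differentiableAt_theta hq (mul_ne_zero (inv_ne_zero hp0) hy)).comp y
        (f := fun y => ((q : ℂ) ^ b)⁻¹ * y) (by fun_prop)
    · rw [mul_neg, inv_mul_cancel₀ hp0]
      exact theta_neg_one_ne_zero hq
  shift _ x hx _ b _ := by
    have hx0 : x ≠ 0 := hx
    have hq' : q ≠ 0 := by linarith
    have hq0 : (q : ℂ) ≠ 0 := by exact_mod_cast hq'
    have hq1 : (q : ℂ) - 1 ≠ 0 := sub_ne_zero.mpr (by exact_mod_cast hq.ne')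
    have hp0 : (q : ℂ) ^ b ≠ 0 := by simp [Complex.cpow_eq_zero_iff, hq0]
    simp only [qhChar, if_pos hq, lt_irrefl, if_false, shiftBack, Complex.ofReal_zero, sub_zero]
    rw [← mul_div_assoc, theta_div hq' hx0, theta_div hq' (mul_ne_zero (inv_ne_zero hp0) hx0),
      qBracket, if_neg hq.ne', Complex.cpow_neg]
    have e : 1 - (((q : ℂ) ^ b)⁻¹ - 1) / ((q : ℂ) - 1) * ((x / q - x) / (x / q)) =
        ((q : ℂ) ^ b)⁻¹ := by
      field_simp
      ring
    rw [e]
    generalize theta q (((q : ℂ) ^ b)⁻¹ * x) = Y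
    generalize theta q x = Z
    generalize (q : ℂ) ^ b = a at *
    -- where the denominator vanishes both sides are `0` by the convention on division
    by_cases hY : Y = 0
    · simp [hY]
    · field_simp

end Theta

/-! ### The logarithm -/

section Log

variable {D : Set ℂ} {L : ℂ → ℂ}

lemma hasDerivAt_logBranch (hD : IsOpen D) (hLcont : ContinuousOn L D)
    (hLexp : ∀ x ∈ D, Complex.exp (L x) = x) {x : ℂ} (hx : x ∈ D) : HasDerivAt L x⁻¹ x := by
  have h1 := Complex.hasDerivAt_exp (L x)
  rw [hLexp x hx] at h1
  have hx0 : x ≠ 0 := by rw [← hLexp x hx]; exact Complex.exp_ne_zero _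
  exact h1.of_local_left_inverse (hLcont.continuousAt (hD.mem_nhds hx)) hx0
    (eventually_of_mem (hD.mem_nhds hx) hLexp)

/-- The characters for `(q, h) = (1, 0)`. -/
def logQuotient (hD : IsOpen D) (hLcont : ContinuousOn L D)
    (hLexp : ∀ x ∈ D, Complex.exp (L x) = x) : CharQuotient L 1 0 {x | -x ∈ D} where
  num p := Complex.exp (p.1 * L (-p.2))
  den _ := 1
  isOpen := hD.preimage continuous_neg
  num_analytic p hp := by
    have h1 : DifferentiableOn ℂ L D := fun x hx =>
      (hasDerivAt_logBranch hD hLcont hLexp hx).differentiableAt.differentiableWithinAt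
    refine Complex.differentiable_exp.analyticAt _ |>.fun_comp
      (f := fun p : ℂ × ℂ => p.1 * L (-p.2)) (analyticAt_fst.mul ?_)
    exact (h1.analyticAt (hD.mem_nhds hp.2)).fun_comp (f := fun p : ℂ × ℂ => -p.2)
      analyticAt_snd.neg
  den_analytic := analyticOnNhd_const
  char_eq b x _ := by rw [qhChar, if_neg (lt_irrefl _), if_neg (lt_irrefl _), div_one]
  num_ne b x _ := Eventually.of_forall fun y => Complex.exp_ne_zero _
  den_ne b x _ := Eventually.of_forall fun y => one_ne_zero
  shift h := absurd ⟨rfl, rfl⟩ h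

lemma qhLog_one_zero (L : ℂ → ℂ) (c : ℂ) (k : ℕ) (x : ℂ) : qhLog L 1 0 c k x =
    (k.factorial : ℂ)⁻¹ * (L (-x) ^ k * Complex.exp (L (-x) * c)) := by
  have e : (fun b => qhChar L 1 0 b x) = fun b => Complex.exp (L (-x) * b) := by
    funext b; rw [qhChar, if_neg (lt_irrefl _), if_neg (lt_irrefl _), mul_comm]
  rw [qhLog, e, iteratedDeriv_cexp_const_mul]

/-- The Jordan chain for `(q, h) = (1, 0)`, where only the first two coefficients are nonzero. -/
lemma hasDerivAt_qhLog_one_zero (hD : IsOpen D) (hLcont : ContinuousOn L D)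
    (hLexp : ∀ x ∈ D, Complex.exp (L x) = x) (c : ℂ) (k : ℕ) {x : ℂ} (hx : -x ∈ D) :
    HasDerivAt (qhLog L 1 0 c k)
      (x⁻¹ * ∑ j ∈ Finset.range (k + 1), normalCoeff 1 c j * qhLog L 1 0 c (k - j) x) x := by
  have hx0 : x ≠ 0 := by
    rintro rfl
    have := hLexp _ hx
    rw [neg_zero] at this
    exact Complex.exp_ne_zero _ this
  have h1 : HasDerivAt (fun y => L (-y)) x⁻¹ x := by
    have := (hasDerivAt_logBranch hD hLcont hLexp hx).comp x (hasDerivAt_neg x)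
    rw [inv_neg, neg_mul_neg, mul_one] at this
    exact this
  have h2 : HasDerivAt (qhLog L 1 0 c k) ((k.factorial : ℂ)⁻¹ *
      (k * L (-x) ^ (k - 1) * x⁻¹ * Complex.exp (L (-x) * c) +
        L (-x) ^ k * (Complex.exp (L (-x) * c) * (x⁻¹ * c)))) x := by
    rw [show qhLog L 1 0 c k = fun y => (k.factorial : ℂ)⁻¹ *
      (L (-y) ^ k * Complex.exp (L (-y) * c)) from funext fun y => qhLog_one_zero L c k y]
    exact ((h1.fun_pow k).mul (h1.mul_const c).cexp).const_mul _
  convert h2 using 1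
  have hc0 : normalCoeff 1 c 0 = c := by simp [normalCoeff, qBracket]
  have hc1 : normalCoeff 1 c 1 = 1 := by simp [normalCoeff]
  rcases k with _ | k
  · simp [hc0, qhLog_one_zero]
    ring
  · rw [Finset.sum_range_succ', Finset.sum_range_succ', Finset.sum_eq_zero]
    · have hk : (k.factorial : ℂ) ≠ 0 := by exact_mod_cast Nat.factorial_ne_zero k
      have hk1 : (k : ℂ) + 1 ≠ 0 := by exact_mod_cast Nat.succ_ne_zero k
      simp only [hc0, hc1, zero_add, qhLog_one_zero, Nat.add_sub_cancel,
        Nat.sub_zero, Nat.factorial_succ]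
      push_cast
      field_simp
    · intro j _; simp [normalCoeff]

end Log

end

section

/-! ### Solutions of the normal form -/

variable {n m : ℕ} {r : Fin m → ℕ}

lemma isOpen_solDomain {D : Set ℂ} (hD : IsOpen D) (q h : ℝ) (l : ℂ) :
    IsOpen (solDomain D q h l) := by
  unfold solDomain
  split_ifs
  · exact (isOpen_V q h l).inter (hD.preimage continuous_neg)
  · exact isOpen_V q h l

lemma solDomain_subset_V (D : Set ℂ) (q h : ℝ) (l : ℂ) : solDomain D q h l ⊆ V q h l := by
  unfold solDomain
  split_ifs
  · exact fun x hx => hx.1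
  · exact subset_rfl

section Normal

variable {D : Set ℂ} {L : ℂ → ℂ} {q h μ : ℝ}

/-- The characters are quotients of analytic functions on the domains of the solutions. -/
lemma exists_charQuotient (hD : IsOpen D) (hLcont : ContinuousOn L D)
    (hLexp : ∀ x ∈ D, Complex.exp (L x) = x) (hq : 1 ≤ q) (hh : 0 ≤ h) (hμ : 0 < μ) :
    ∃ Ω, solDomain D q h μ ⊆ Ω ∧ Nonempty (CharQuotient L q h Ω) := by
  rcases hq.eq_or_lt with rfl | hq
  · rcases hh.eq_or_lt with rfl | hh
    · refine ⟨{x | -x ∈ D}, ?_, ⟨logQuotient hD hLcont hLexp⟩⟩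
      rw [solDomain, if_pos ⟨rfl, rfl⟩]
      exact fun x hx => hx.2
    · exact ⟨_, Set.subset_univ _, ⟨gammaQuotient L hh⟩⟩
  · rcases hh.eq_or_lt with rfl | hh
    · refine ⟨_, fun x hx => ?_, ⟨thetaQuotient L hq⟩⟩
      have h1 := le_norm_of_mem_V hq.le le_rfl hμ.le (solDomain_subset_V _ _ _ _ hx)
      rw [Set.mem_compl_singleton_iff, ← norm_pos_iff]
      linarith
    · exact ⟨_, Set.subset_univ _, ⟨pochhammerQuotient L hq hh⟩⟩

lemma logBlock_eq (L : ℂ → ℂ) (q h : ℝ) (c : ℂ) (r : ℕ) (x : ℂ) :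
    logBlock L q h c r x = nilPoly r fun j => qhLog L q h c j x := rfl

lemma normalSol_apply (hr : ∑ i, r i = n) (c : Fin m → ℂ) (L : ℂ → ℂ) (q h : ℝ)
    (u v : (i : Fin m) × Fin (r i)) (x : ℂ) :
    normalSol hr c L q h x ((finSigmaFinEquiv.trans (finCongr hr)) u)
      ((finSigmaFinEquiv.trans (finCongr hr)) v) =
    if u.1 = v.1 ∧ (u.2 : ℕ) ≤ v.2 then qhLog L q h (c u.1) (v.2 - u.2) x else 0 := by
  obtain ⟨i, a⟩ := u
  obtain ⟨j, b⟩ := v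
  rw [normalSol, blockDiag_apply]
  by_cases hij : i = j
  · subst hij
    rw [Matrix.blockDiagonal'_apply_eq, logBlock_eq, nilPoly_apply]
    simp
  · rw [Matrix.blockDiagonal'_apply_ne _ _ _ hij, if_neg (by simp [hij])]

/-- A property of functions which holds for `0` and for the logarithms holds for the entries of the
solution of the normal form. -/
lemma normalSol_entry_induction (hr : ∑ i, r i = n) (c : Fin m → ℂ) {p : (ℂ → ℂ) → Prop}
    (h0 : p fun _ => 0) (hlog : ∀ i k, p (qhLog L q h (c i) k)) (i j : Fin n) :
    p fun x => normalSol hr c L q h x i j := by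
  obtain ⟨u, rfl⟩ := (finSigmaFinEquiv.trans (finCongr hr)).surjective i
  obtain ⟨v, rfl⟩ := (finSigmaFinEquiv.trans (finCongr hr)).surjective j
  simp only [normalSol_apply]
  by_cases huv : u.1 = v.1 ∧ (u.2 : ℕ) ≤ v.2
  · simp only [if_pos huv]; exact hlog _ _
  · simp only [if_neg huv]; exact h0

/-- The matrix `δ Y`. -/
def deltaMatrix (q h : ℝ) (Y : ℂ → Matrix (Fin n) (Fin n) ℂ) (x : ℂ) : Matrix (Fin n) (Fin n) ℂ :=
  Matrix.of fun i j => delta q h (fun t => Y t i j) x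

lemma deltaMatrix_normalSol (hr : ∑ i, r i = n) (hrpos : ∀ i, 0 < r i) (c : Fin m → ℂ) {x : ℂ}
    (hlog : ∀ i k, delta q h (qhLog L q h (c i) k) x =
      ∑ j ∈ Finset.range (k + 1), normalCoeff q (c i) j * qhLog L q h (c i) (k - j) x) :
    deltaMatrix q h (normalSol hr c L q h) x = normalForm hr c q * normalSol hr c L q h x := by
  have e : normalForm hr c q * normalSol hr c L q h x = blockDiag hr fun i => nilPoly (r i)
      fun k => ∑ j ∈ Finset.range (k + 1), normalCoeff q (c i) j * qhLog L q h (c i) (k - j) x := by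
    rw [normalForm_eq hr hrpos, normalSol, blockDiag_mul]
    congr
    funext i
    rw [logBlock_eq, nilPoly_mul]
  rw [e]
  ext i j
  obtain ⟨⟨i, a⟩, rfl⟩ := (finSigmaFinEquiv.trans (finCongr hr)).surjective i
  obtain ⟨⟨j, b⟩, rfl⟩ := (finSigmaFinEquiv.trans (finCongr hr)).surjective j
  have h0 : delta q h (fun _ => 0) x = 0 := by simp [delta]
  rw [deltaMatrix, Matrix.of_apply, blockDiag_apply]
  simp only [normalSol_apply]
  by_cases hij : i = j
  · subst hij
    rw [Matrix.blockDiagonal'_apply_eq, nilPoly_apply]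
    by_cases hab : (a : ℕ) ≤ b
    · simp only [hab, and_self, if_true]
      exact hlog i _
    · simp only [hab, and_false, if_false]
      exact h0
  · rw [Matrix.blockDiagonal'_apply_ne _ _ _ hij]
    simp only [hij, false_and, if_false]
    exact h0

lemma det_normalSol (hr : ∑ i, r i = n) (c : Fin m → ℂ) (x : ℂ) :
    (normalSol hr c L q h x).det = ∏ i, qhLog L q h (c i) 0 x ^ r i := by
  rw [normalSol, det_blockDiag]
  exact Finset.prod_congr rfl fun i _ => by rw [logBlock_eq, det_nilPoly]

lemma det_normalSol_ne_zero (hD : IsOpen D) (hLcont : ContinuousOn L D)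
    (hLexp : ∀ x ∈ D, Complex.exp (L x) = x) (hq : 1 ≤ q) (hh : 0 ≤ h) (hμ : 0 < μ)
    (hr : ∑ i, r i = n) (c : Fin m → ℂ) {x : ℂ} (hx : x ∈ solDomain D q h μ) :
    ∀ᶠ y in 𝓝[≠] x, (normalSol hr c L q h y).det ≠ 0 := by
  obtain ⟨Ω, hΩ, ⟨E⟩⟩ := exists_charQuotient hD hLcont hLexp hq hh hμ
  filter_upwards [eventually_all.mpr fun i => E.qhLog_zero_ne (c i) (hΩ hx)] with y hy
  rw [det_normalSol]
  exact Finset.prod_ne_zero_iff.mpr fun i _ => pow_ne_zero _ (hy i)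

lemma meromorphicAt_normalSol (hD : IsOpen D) (hLcont : ContinuousOn L D)
    (hLexp : ∀ x ∈ D, Complex.exp (L x) = x) (hq : 1 ≤ q) (hh : 0 ≤ h) (hμ : 0 < μ)
    (hr : ∑ i, r i = n) (c : Fin m → ℂ) {x : ℂ} (hx : x ∈ solDomain D q h μ) (i j : Fin n) :
    MeromorphicAt (fun x => normalSol hr c L q h x i j) x := by
  obtain ⟨Ω, hΩ, ⟨E⟩⟩ := exists_charQuotient hD hLcont hLexp hq hh hμ
  exact normalSol_entry_induction hr c (p := fun f => MeromorphicAt f x) (MeromorphicAt.const 0 x)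
    (fun i k => E.meromorphicAt_qhLog (c i) k (hΩ hx)) i j

lemma differentiableAt_normalSol (hD : IsOpen D) (hLcont : ContinuousOn L D)
    (hLexp : ∀ x ∈ D, Complex.exp (L x) = x) (hr : ∑ i, r i = n) (c : Fin m → ℂ) {x : ℂ}
    (hx : -x ∈ D) (i j : Fin n) :
    DifferentiableAt ℂ (fun x => normalSol hr c L 1 0 x i j) x :=
  normalSol_entry_induction hr c (p := fun f => DifferentiableAt ℂ f x)
    (differentiableAt_const 0)
    (fun i k => (hasDerivAt_qhLog_one_zero hD hLcont hLexp (c i) k hx).differentiableAt) i j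

/-- The matrix `E_{J₀}` is a solution of the system of constant matrix `J₀`. -/
lemma deltaMatrix_normalSol_eventually (hD : IsOpen D) (hLcont : ContinuousOn L D)
    (hLexp : ∀ x ∈ D, Complex.exp (L x) = x) (hq : 1 ≤ q) (hh : 0 ≤ h) (hμ : h < μ)
    (hr : ∑ i, r i = n) (hrpos : ∀ i, 0 < r i) (c : Fin m → ℂ) {x : ℂ}
    (hx : x ∈ solDomain D q h μ) : ∀ᶠ y in 𝓝[≠] x,
      deltaMatrix q h (normalSol hr c L q h) y = normalForm hr c q * normalSol hr c L q h y := by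
  have hW := nhdsWithin_le_nhds (s := {x}ᶜ) ((isOpen_solDomain hD q h μ).mem_nhds hx)
  by_cases hqh : q = 1 ∧ h = 0
  · obtain ⟨rfl, rfl⟩ := hqh
    filter_upwards [hW] with y hy
    rw [solDomain, if_pos ⟨rfl, rfl⟩] at hy
    have hy0 : y ≠ 0 := by
      have := le_norm_of_mem_V hq hh (by linarith) hy.1
      rw [← norm_pos_iff]; linarith
    refine deltaMatrix_normalSol hr hrpos c fun i k => ?_
    rw [delta, if_pos ⟨rfl, rfl⟩, (hasDerivAt_qhLog_one_zero hD hLcont hLexp (c i) k hy.2).deriv,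
      mul_inv_cancel_left₀ hy0]
  · obtain ⟨Ω, hΩ, ⟨E⟩⟩ := exists_charQuotient hD hLcont hLexp hq hh (hh.trans_lt hμ)
    filter_upwards [hW, eventually_all.mpr fun i => E.den_ne (c i) x (hΩ hx)] with y hy hyd
    have hyV := solDomain_subset_V _ _ _ _ hy
    refine deltaMatrix_normalSol hr hrpos c fun i k => ?_
    exact E.delta_qhLog (by linarith) hqh (c i) k (hΩ hy)
      (sub_ne_zero.mp (sub_ne_zero_of_mem_V hq hh hh hμ hyV))
      (shiftBack_sub_ne_zero hq hh (hh.trans_lt hμ) hyV hqh) (hyd i)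

end Normal

/-! ### Fundamental matrices -/

/-- The twisted Leibniz rule `δ(M G) = δ M G + M((x - h)/q) δ G`. -/
lemma deltaMatrix_mul {q h : ℝ} {M G : ℂ → Matrix (Fin n) (Fin n) ℂ} {x : ℂ}
    (hM : q = 1 ∧ h = 0 → ∀ i j, DifferentiableAt ℂ (fun t => M t i j) x)
    (hG : q = 1 ∧ h = 0 → ∀ i j, DifferentiableAt ℂ (fun t => G t i j) x) :
    deltaMatrix q h (fun t => M t * G t) x =
      deltaMatrix q h M x * G x + M (shiftBack q h x) * deltaMatrix q h G x := by
  ext i j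
  by_cases hqh : q = 1 ∧ h = 0
  · have hs : shiftBack q h x = x := by
      rw [hqh.1, hqh.2]; simp [shiftBack]
    simp only [deltaMatrix, delta, if_pos hqh, Matrix.of_apply, Matrix.add_apply,
      Matrix.mul_apply, hs]
    rw [deriv_fun_sum fun k _ => (hM hqh i k).fun_mul (hG hqh k j), Finset.mul_sum,
      ← Finset.sum_add_distrib]
    refine Finset.sum_congr rfl fun k _ => ?_
    rw [deriv_fun_mul (hM hqh i k) (hG hqh k j)]
    ring
  · simp only [deltaMatrix, delta, if_neg hqh, Matrix.of_apply, Matrix.add_apply,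
      Matrix.mul_apply]
    rw [← Finset.sum_sub_distrib, ← Finset.sum_add_distrib, Finset.sum_div, Finset.mul_sum]
    refine Finset.sum_congr rfl fun k _ => ?_
    ring

lemma deltaMatrix_const (q h : ℝ) (Q : Matrix (Fin n) (Fin n) ℂ) (x : ℂ) :
    deltaMatrix q h (fun _ => Q) x = 0 := by
  ext i j
  simp [deltaMatrix, delta]

lemma meromorphicAt_mul_entry {M G : ℂ → Matrix (Fin n) (Fin n) ℂ} {x : ℂ}
    (hM : ∀ i j, MeromorphicAt (fun t => M t i j) x)
    (hG : ∀ i j, MeromorphicAt (fun t => G t i j) x) (i j : Fin n) :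
    MeromorphicAt (fun t => (M t * G t) i j) x := by
  simp only [Matrix.mul_apply]
  exact MeromorphicAt.fun_sum fun k _ => (hM i k).fun_mul (hG k j)

/-- The domain meets its image under the shift. This is where the unboundedness of the domain `D` of
the logarithm enters. -/
lemma exists_mem_solDomain_shiftBack {D : Set ℂ} (hDunbounded : ∀ R : ℝ, ∃ x ∈ D, R < ‖x‖)
    {q h μ : ℝ} (hq : 1 ≤ q) (hh : 0 ≤ h) (hμ : 0 ≤ μ) :
    ∃ x, x ∈ solDomain D q h μ ∧ shiftBack q h x ∈ solDomain D q h μ := by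
  unfold solDomain
  split_ifs with hqh
  · obtain ⟨rfl, rfl⟩ := hqh
    obtain ⟨x, hx, hR⟩ := hDunbounded μ
    have h1 : -x ∈ V 1 0 (μ : ℂ) := by
      rw [V, if_pos rfl]
      simpa [abs_of_nonneg hμ] using hR
    have h2 : shiftBack 1 0 (-x) = -x := by simp [shiftBack]
    refine ⟨-x, ⟨h1, by simpa using hx⟩, ?_⟩
    rw [h2]
    exact ⟨h1, by simpa using hx⟩
  · refine ⟨((q * (μ + 1) + h : ℝ) : ℂ), ofReal_mem_V hq hh hμ (by nlinarith), ?_⟩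
    have h2 : shiftBack q h ((q * (μ + 1) + h : ℝ) : ℂ) = ((μ + 1 : ℝ) : ℂ) := by
      have : (q : ℂ) ≠ 0 := by exact_mod_cast (by linarith : q ≠ 0)
      rw [shiftBack]
      push_cast
      field_simp
      ring
    rw [h2]
    exact ofReal_mem_V hq hh hμ (by linarith)

lemma continuous_shiftBack (q h : ℝ) : Continuous (shiftBack q h) := by
  unfold shiftBack; fun_prop

section Fundamental

variable {D : Set ℂ} {L : ℂ → ℂ} {q h μ : ℝ} {F A : ℂ → Matrix (Fin n) (Fin n) ℂ}
  {A₀ : Matrix (Fin n) (Fin n) ℂ}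

/-- The defect of `F Q E R` from being a solution is `F((x - h)/q) (Q J₀ - A₀ Q) E R`. -/
lemma deltaMatrix_gauge_mul_normalSol (hD : IsOpen D) (hLcont : ContinuousOn L D)
    (hLexp : ∀ x ∈ D, Complex.exp (L x) = x) (hr : ∑ i, r i = n) (c : Fin m → ℂ)
    (hF : ∀ i j, DifferentiableOn ℂ (fun t => F t i j) (V q h μ))
    (hFδ : ∀ x ∈ V q h μ, deltaMatrix q h F x = A x * F x - F (shiftBack q h x) * A₀)
    (Q R : Matrix (Fin n) (Fin n) ℂ) {x : ℂ} (hx : x ∈ solDomain D q h μ)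
    (hE : deltaMatrix q h (normalSol hr c L q h) x =
      normalForm hr c q * normalSol hr c L q h x) :
    deltaMatrix q h (fun t => F t * Q * normalSol hr c L q h t * R) x =
      A x * (F x * Q * normalSol hr c L q h x * R) + F (shiftBack q h x) *
        (Q * normalForm hr c q - A₀ * Q) * normalSol hr c L q h x * R := by
  have hxV := solDomain_subset_V _ _ _ _ hx
  have hFx : ∀ i j, DifferentiableAt ℂ (fun t => F t i j) x := fun i j =>
    (hF i j).differentiableAt ((isOpen_V q h μ).mem_nhds hxV)
  have hmul : ∀ {M G : ℂ → Matrix (Fin n) (Fin n) ℂ},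
      (∀ i j, DifferentiableAt ℂ (fun t => M t i j) x) →
      (∀ i j, DifferentiableAt ℂ (fun t => G t i j) x) →
      ∀ i j, DifferentiableAt ℂ (fun t => (M t * G t) i j) x := by
    intro M G hM hG i j
    simp only [Matrix.mul_apply]
    exact DifferentiableAt.fun_sum fun k _ => (hM i k).fun_mul (hG k j)
  have hconst : ∀ (Q : Matrix (Fin n) (Fin n) ℂ) (i j),
      DifferentiableAt ℂ (fun _ : ℂ => Q i j) x := fun Q i j => differentiableAt_const _
  have hEd : q = 1 ∧ h = 0 →
      ∀ i j, DifferentiableAt ℂ (fun t => normalSol hr c L q h t i j) x := by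
    rintro ⟨rfl, rfl⟩
    rw [solDomain, if_pos ⟨rfl, rfl⟩] at hx
    exact differentiableAt_normalSol hD hLcont hLexp hr c hx.2
  have hFQ := hmul hFx (hconst Q)
  rw [deltaMatrix_mul (M := fun t => F t * Q * normalSol hr c L q h t) (G := fun _ => R)
      (fun h10 => hmul hFQ (hEd h10)) (fun _ => hconst R), deltaMatrix_const, mul_zero, add_zero,
    deltaMatrix_mul (M := fun t => F t * Q) (fun _ => hFQ) hEd, hE,
    deltaMatrix_mul (G := fun _ => Q) (fun _ => hFx) (fun _ => hconst Q), deltaMatrix_const,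
    mul_zero, add_zero, hFδ x hxV]
  noncomm_ring

lemma isFundamentalMatrix_gauge_mul_normalSol (hD : IsOpen D) (hLcont : ContinuousOn L D)
    (hLexp : ∀ x ∈ D, Complex.exp (L x) = x) (hq : 1 ≤ q) (hh : 0 ≤ h) (hμ : h < μ)
    (hr : ∑ i, r i = n) (hrpos : ∀ i, 0 < r i) (c : Fin m → ℂ)
    (hF : ∀ i j, DifferentiableOn ℂ (fun t => F t i j) (V q h μ))
    (hFu : ∀ x ∈ V q h μ, IsUnit (F x))
    (hFδ : ∀ x ∈ V q h μ, deltaMatrix q h F x = A x * F x - F (shiftBack q h x) * A₀)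
    {Q R : Matrix (Fin n) (Fin n) ℂ} (hQ : IsUnit Q) (hR : IsUnit R)
    (hQJ : Q * normalForm hr c q = A₀ * Q) :
    IsFundamentalMatrix q h A (solDomain D q h μ)
      (fun x => F x * Q * normalSol hr c L q h x * R) where
  meromorphic i j x hx := by
    have hFx : ∀ i j, MeromorphicAt (fun t => F t i j) x := fun i j =>
      ((hF i j).analyticAt
        ((isOpen_V q h μ).mem_nhds (solDomain_subset_V _ _ _ _ hx))).meromorphicAt
    have hE := fun i j => meromorphicAt_normalSol hD hLcont hLexp hq hh (hh.trans_lt hμ) hr c hx i j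
    have h1 := meromorphicAt_mul_entry (M := F) (G := fun _ => Q) hFx
      fun i j => MeromorphicAt.const _ _
    have h2 := meromorphicAt_mul_entry (M := fun t => F t * Q) (G := normalSol hr c L q h) h1 hE
    exact meromorphicAt_mul_entry (M := fun t => F t * Q * normalSol hr c L q h t)
      (G := fun _ => R) h2 (fun i j => MeromorphicAt.const _ _) i j
  equation := by
    refine eventually_codiscreteWithin_of_punctured fun x hx => ?_
    filter_upwards [deltaMatrix_normalSol_eventually hD hLcont hLexp hq hh hμ hr hrpos c hx.1]
      with y hy hyW
    have h1 := deltaMatrix_gauge_mul_normalSol hD hLcont hLexp hr c hF hFδ Q R hyW.1 hy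
    rw [hQJ, sub_self, mul_zero, zero_mul, zero_mul, add_zero] at h1
    exact h1
  det_ne_zero := by
    refine eventually_codiscreteWithin_of_punctured fun x hx => ?_
    filter_upwards [det_normalSol_ne_zero hD hLcont hLexp hq hh (hh.trans_lt hμ) hr c hx]
      with y hy hyW
    rw [Matrix.det_mul, Matrix.det_mul, Matrix.det_mul]
    have hd : ∀ {M : Matrix (Fin n) (Fin n) ℂ}, IsUnit M → M.det ≠ 0 := fun hM =>
      ((Matrix.isUnit_iff_isUnit_det _).mp hM).ne_zero
    exact mul_ne_zero (mul_ne_zero (mul_ne_zero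
      (hd (hFu y (solDomain_subset_V _ _ _ _ hyW))) (hd hQ)) hy) (hd hR)

/-- Conversely, if `F Q E` is a solution then `Q` conjugates `J₀` to `A₀`. -/
lemma conj_of_isFundamentalMatrix (hD : IsOpen D) (hDunbounded : ∀ R : ℝ, ∃ x ∈ D, R < ‖x‖)
    (hLcont : ContinuousOn L D)
    (hLexp : ∀ x ∈ D, Complex.exp (L x) = x) (hq : 1 ≤ q) (hh : 0 ≤ h) (hμ : h < μ)
    (hr : ∑ i, r i = n) (hrpos : ∀ i, 0 < r i) (c : Fin m → ℂ)
    (hF : ∀ i j, DifferentiableOn ℂ (fun t => F t i j) (V q h μ))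
    (hFu : ∀ x ∈ V q h μ, IsUnit (F x))
    (hFδ : ∀ x ∈ V q h μ, deltaMatrix q h F x = A x * F x - F (shiftBack q h x) * A₀)
    {Q : Matrix (Fin n) (Fin n) ℂ}
    (hY : IsFundamentalMatrix q h A (solDomain D q h μ)
      (fun x => F x * Q * normalSol hr c L q h x)) :
    Q * normalForm hr c q = A₀ * Q := by
  have hμ0 := hh.trans_lt hμ
  -- at a generic point of the domain `E` and `F((x - h)/q)` are invertible, so the defect vanishes
  -- only if `Q J₀ = A₀ Q`
  obtain ⟨x, hx⟩ := exists_mem_solDomain_shiftBack hDunbounded hq hh hμ0.le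
  have hopen : IsOpen {x | x ∈ solDomain D q h μ ∧ shiftBack q h x ∈ solDomain D q h μ} :=
    (isOpen_solDomain hD q h μ).inter
      ((isOpen_solDomain hD q h μ).preimage (continuous_shiftBack q h))
  have h1 := punctured_of_eventually_codiscreteWithin hY.equation hx
  have hW : ∀ᶠ y in 𝓝[≠] x, y ∈ {x | x ∈ solDomain D q h μ ∧ shiftBack q h x ∈ solDomain D q h μ} :=
    nhdsWithin_le_nhds (hopen.mem_nhds hx)
  obtain ⟨y, hy1, hyW, hy2, hy3⟩ := (h1.and (hW.and
    ((deltaMatrix_normalSol_eventually hD hLcont hLexp hq hh hμ hr hrpos c hx.1).and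
    (det_normalSol_ne_zero hD hLcont hLexp hq hh hμ0 hr c hx.1)))).exists
  have h4 : deltaMatrix q h (fun x => F x * Q * normalSol hr c L q h x) y =
      A y * (F y * Q * normalSol hr c L q h y) := hy1 hyW
  have h5 := deltaMatrix_gauge_mul_normalSol hD hLcont hLexp hr c hF hFδ Q 1 hyW.1 hy2
  simp only [mul_one] at h5
  rw [h4, left_eq_add] at h5
  have h6 : IsUnit (normalSol hr c L q h y) :=
    (Matrix.isUnit_iff_isUnit_det _).mpr (isUnit_iff_ne_zero.mpr hy3)
  have h7 := hFu _ (solDomain_subset_V _ _ _ _ hyW.2)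
  rw [h6.mul_left_eq_zero, h7.mul_right_eq_zero] at h5
  exact sub_eq_zero.mp h5

end Fundamental

end

section

/-! ### The commutant of the normal form -/

variable {r s : ℕ}

/-- The substitution of the nilpotent block in a power series. -/
def nilEval (r : ℕ) (f : PowerSeries ℂ) : Matrix (Fin r) (Fin r) ℂ :=
  nilPoly r fun j => PowerSeries.coeff j f

lemma nilEval_mul (r : ℕ) (f g : PowerSeries ℂ) :
    nilEval r (f * g) = nilEval r f * nilEval r g := by
  rw [nilEval, nilEval, nilEval, nilPoly_mul]
  congr
  funext k
  rw [PowerSeries.coeff_mul, Finset.Nat.sum_antidiagonal_eq_sum_range_succ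
    fun i j => PowerSeries.coeff i f * PowerSeries.coeff j g]

lemma nilEval_add (r : ℕ) (f g : PowerSeries ℂ) :
    nilEval r (f + g) = nilEval r f + nilEval r g := by
  simp [nilEval, nilPoly, add_smul, Finset.sum_add_distrib]

lemma nilEval_smul (r : ℕ) (z : ℂ) (f : PowerSeries ℂ) :
    nilEval r (z • f) = z • nilEval r f := by
  simp [nilEval, nilPoly, mul_smul, Finset.smul_sum]

lemma nilEval_one (r : ℕ) : nilEval r 1 = 1 := by
  ext i j
  rw [nilEval, nilPoly_apply, Matrix.one_apply]
  simp only [PowerSeries.coeff_one]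
  split_ifs <;> first | rfl | (exfalso; omega)

lemma nilEval_pow (r : ℕ) (f : PowerSeries ℂ) (k : ℕ) : nilEval r (f ^ k) = nilEval r f ^ k := by
  induction k with
  | zero => simp [nilEval_one]
  | succ k ih => rw [pow_succ, nilEval_mul, ih, pow_succ]

lemma nilEval_X_pow_mul {k : ℕ} (hk : r ≤ k) (f : PowerSeries ℂ) :
    nilEval r (PowerSeries.X ^ k * f) = 0 := by
  ext i j
  have := j.2
  rw [nilEval, nilPoly_apply]
  split_ifs
  · rw [PowerSeries.coeff_X_pow_mul', if_neg (by omega), Matrix.zero_apply]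
  · rfl

lemma pow_mul_eq_mul_pow {M : Matrix (Fin r) (Fin r) ℂ} {M' : Matrix (Fin s) (Fin s) ℂ}
    {b : Matrix (Fin r) (Fin s) ℂ} (hb : M * b = b * M') (k : ℕ) : M ^ k * b = b * M' ^ k := by
  induction k with
  | zero => simp
  | succ k ih => rw [pow_succ, pow_succ, Matrix.mul_assoc, hb, ← Matrix.mul_assoc, ih,
      Matrix.mul_assoc]

/-- A matrix which intertwines two blocks `f(N)` with `f'(0) ≠ 0` intertwines all blocks `g(N)`,
since `N` is a power series in `f(N) - f(0)`. -/
lemma nilEval_comm {f : PowerSeries ℂ} (hf : PowerSeries.coeff 1 f ≠ 0)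
    {b : Matrix (Fin r) (Fin s) ℂ} (hb : nilEval r f * b = b * nilEval s f) (g : PowerSeries ℂ) :
    nilEval r g * b = b * nilEval s g := by
  -- `f = f(0) + X v` with `v` invertible
  obtain ⟨v, hv⟩ : ∃ v, f = PowerSeries.X * v + PowerSeries.coeff 0 f • 1 := by
    refine ⟨PowerSeries.mk fun j => PowerSeries.coeff (j + 1) f, ?_⟩
    ext j
    rcases j with _ | j
    · simp
    · simp [PowerSeries.coeff_succ_X_mul, PowerSeries.coeff_one]
  have hv0 : PowerSeries.coeff 0 v ≠ 0 := by
    rw [hv] at hf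
    simpa [PowerSeries.coeff_one, PowerSeries.coeff_succ_X_mul 0] using hf
  have hsplit : ∀ w : PowerSeries ℂ, ∃ w', w = PowerSeries.coeff 0 w • 1 + PowerSeries.X * w' := by
    intro w
    refine ⟨PowerSeries.mk fun j => PowerSeries.coeff (j + 1) w, ?_⟩
    ext j
    rcases j with _ | j
    · simp
    · simp [PowerSeries.coeff_succ_X_mul, PowerSeries.coeff_one]
  have hXv : nilEval r (PowerSeries.X * v) * b = b * nilEval s (PowerSeries.X * v) := by
    rw [hv, nilEval_add, nilEval_add, nilEval_smul, nilEval_smul, nilEval_one, nilEval_one,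
      Matrix.add_mul, Matrix.mul_add, Matrix.smul_mul, Matrix.mul_smul, Matrix.one_mul,
      Matrix.mul_one] at hb
    simpa using hb
  have hpow : ∀ k, nilEval r ((PowerSeries.X * v) ^ k) * b =
      b * nilEval s ((PowerSeries.X * v) ^ k) := by
    intro k
    rw [nilEval_pow, nilEval_pow, pow_mul_eq_mul_pow hXv]
  -- descending induction on the order of vanishing of the power series
  have key : ∀ d k, r + s = k + d → ∀ g, nilEval r (PowerSeries.X ^ k * g) * b =
      b * nilEval s (PowerSeries.X ^ k * g) := by
    intro d
    induction d with
    | zero =>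
      intro k hk g
      rw [nilEval_X_pow_mul (by omega), nilEval_X_pow_mul (by omega)]
      simp
    | succ d ih =>
      intro k hk g
      have h1 : nilEval r (PowerSeries.X ^ k) * b = b * nilEval s (PowerSeries.X ^ k) := by
        obtain ⟨w, hw⟩ := hsplit (v ^ k)
        set z := PowerSeries.coeff 0 (v ^ k) with hz
        have hz0 : z ≠ 0 := by
          rw [hz, PowerSeries.coeff_zero_eq_constantCoeff_apply, map_pow]
          exact pow_ne_zero _ (by simpa using hv0)
        have e : PowerSeries.X ^ k = z⁻¹ • ((PowerSeries.X * v) ^ k +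
            (-1 : ℂ) • (PowerSeries.X ^ (k + 1) * w)) := by
          rw [mul_pow, hw, mul_add, mul_smul_comm, mul_one, pow_succ, mul_assoc, neg_one_smul,
            add_neg_cancel_right, smul_smul, inv_mul_cancel₀ hz0, one_smul]
        rw [e]
        simp only [nilEval_smul, nilEval_add, Matrix.smul_mul, Matrix.mul_smul, Matrix.add_mul,
          Matrix.mul_add, hpow, ih (k + 1) (by omega)]
      obtain ⟨g', hg'⟩ := hsplit g
      rw [hg', mul_add, mul_smul_comm, mul_one, ← mul_assoc, ← pow_succ]
      simp only [nilEval_smul, nilEval_add, Matrix.smul_mul, Matrix.mul_smul, Matrix.add_mul,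
        Matrix.mul_add, h1, ih (k + 1) (by omega)]
  simpa using key (r + s) 0 (by omega) g

/-- There is no intertwiner between blocks with distinct eigenvalues. -/
lemma eq_zero_of_nilEval_comm {f g : PowerSeries ℂ}
    (hfg : PowerSeries.coeff 0 f ≠ PowerSeries.coeff 0 g)
    {b : Matrix (Fin r) (Fin s) ℂ} (hb : nilEval r f * b = b * nilEval s g) : b = 0 := by
  set z := PowerSeries.coeff 0 g with hz
  have h1 : nilEval r (f + (-z) • 1) * b = b * nilEval s (g + (-z) • 1) := by
    simp only [nilEval_add, nilEval_smul, nilEval_one, Matrix.add_mul, Matrix.mul_add, hb,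
      Matrix.smul_mul, Matrix.mul_smul, Matrix.one_mul, Matrix.mul_one]
  -- `g(N) - g(0)` is nilpotent while `f(N) - g(0)` is invertible
  have h2 : nilEval s (g + (-z) • 1) ^ s = 0 := by
    have e : g + (-z) • 1 =
        PowerSeries.X * PowerSeries.mk fun j => PowerSeries.coeff (j + 1) g := by
      ext j
      rcases j with _ | j
      · simp [hz]
      · simp [PowerSeries.coeff_succ_X_mul, PowerSeries.coeff_one]
    rw [← nilEval_pow, e, mul_pow, nilEval_X_pow_mul le_rfl]
  have h3 := pow_mul_eq_mul_pow h1 s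
  rw [h2, Matrix.mul_zero] at h3
  have h4 : IsUnit (nilEval r (f + (-z) • 1) ^ s).det := by
    rw [Matrix.det_pow, nilEval, det_nilPoly, isUnit_iff_ne_zero]
    refine pow_ne_zero _ (pow_ne_zero _ ?_)
    have e : PowerSeries.coeff 0 (f + (-z) • 1) = PowerSeries.coeff 0 f - z := by
      simp [sub_eq_add_neg]
    rw [e]
    exact sub_ne_zero.mpr hfg
  rw [← Matrix.one_mul b, ← Matrix.nonsing_inv_mul _ h4, Matrix.mul_assoc, h3, Matrix.mul_zero]

section Blocks

variable {n m : ℕ} {r : Fin m → ℕ}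

/-- The block of index `(i, j)` of a matrix. -/
def subBlock (hr : ∑ i, r i = n) (B : Matrix (Fin n) (Fin n) ℂ) (i j : Fin m) :
    Matrix (Fin (r i)) (Fin (r j)) ℂ :=
  Matrix.of fun a b => B (finSigmaFinEquiv.trans (finCongr hr) ⟨i, a⟩)
    (finSigmaFinEquiv.trans (finCongr hr) ⟨j, b⟩)

lemma ext_subBlock (hr : ∑ i, r i = n) {B B' : Matrix (Fin n) (Fin n) ℂ}
    (hB : ∀ i j, subBlock hr B i j = subBlock hr B' i j) : B = B' := by
  ext u v
  obtain ⟨⟨i, a⟩, rfl⟩ := (finSigmaFinEquiv.trans (finCongr hr)).surjective u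
  obtain ⟨⟨j, b⟩, rfl⟩ := (finSigmaFinEquiv.trans (finCongr hr)).surjective v
  exact congrFun (congrFun (hB i j) a) b

lemma subBlock_blockDiag_mul (hr : ∑ i, r i = n)
    (G : (i : Fin m) → Matrix (Fin (r i)) (Fin (r i)) ℂ) (B : Matrix (Fin n) (Fin n) ℂ)
    (i j : Fin m) : subBlock hr (blockDiag hr G * B) i j = G i * subBlock hr B i j := by
  ext a b
  rw [subBlock, Matrix.of_apply, Matrix.mul_apply, Matrix.mul_apply,
    ← (finSigmaFinEquiv.trans (finCongr hr)).sum_comp, Fintype.sum_sigma,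
    Finset.sum_eq_single i]
  · refine Finset.sum_congr rfl fun a' _ => ?_
    rw [blockDiag_apply, Matrix.blockDiagonal'_apply_eq, subBlock, Matrix.of_apply]
  · intro i' _ hi'
    refine Finset.sum_eq_zero fun a' _ => ?_
    rw [blockDiag_apply, Matrix.blockDiagonal'_apply_ne _ _ _ hi'.symm, zero_mul]
  · simp

lemma subBlock_mul_blockDiag (hr : ∑ i, r i = n)
    (G : (i : Fin m) → Matrix (Fin (r i)) (Fin (r i)) ℂ) (B : Matrix (Fin n) (Fin n) ℂ)
    (i j : Fin m) : subBlock hr (B * blockDiag hr G) i j = subBlock hr B i j * G j := by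
  ext a b
  rw [subBlock, Matrix.of_apply, Matrix.mul_apply, Matrix.mul_apply,
    ← (finSigmaFinEquiv.trans (finCongr hr)).sum_comp, Fintype.sum_sigma,
    Finset.sum_eq_single j]
  · refine Finset.sum_congr rfl fun a' _ => ?_
    rw [blockDiag_apply, Matrix.blockDiagonal'_apply_eq, subBlock, Matrix.of_apply]
  · intro j' _ hj'
    refine Finset.sum_eq_zero fun a' _ => ?_
    rw [blockDiag_apply, Matrix.blockDiagonal'_apply_ne _ _ _ hj', mul_zero]
  · simp

lemma normalCoeff_one_ne_zero {q : ℝ} (hq : 1 ≤ q) (c : ℂ) : normalCoeff q c 1 ≠ 0 := by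
  have hq0 : (q : ℂ) ≠ 0 := by exact_mod_cast (by linarith : q ≠ 0)
  by_cases hq1 : q = 1
  · simp [normalCoeff, hq1]
  · have h1 : 1 - (q : ℂ) ≠ 0 := sub_ne_zero.mpr (by exact_mod_cast Ne.symm hq1)
    have h2 : (Real.log q : ℂ) ≠ 0 := by
      exact_mod_cast (Real.log_pos (lt_of_le_of_ne hq (Ne.symm hq1))).ne'
    have h3 : (q : ℂ) ^ (-c) ≠ 0 := by simp [Complex.cpow_eq_zero_iff, hq0]
    rw [normalCoeff, if_neg hq1]
    exact mul_ne_zero (div_ne_zero h3 h1) (div_ne_zero (pow_ne_zero _ (neg_ne_zero.mpr h2))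
      (by exact_mod_cast Nat.factorial_ne_zero _))

lemma cpow_neg_eq_of_qBracket_eq {q : ℝ} (hq1 : q ≠ 1) {c c' : ℂ}
    (h : qBracket q (-c) = qBracket q (-c')) : (q : ℂ) ^ (-c) = (q : ℂ) ^ (-c') := by
  have h1 : (q : ℂ) - 1 ≠ 0 := sub_ne_zero.mpr (by exact_mod_cast hq1)
  rw [qBracket, qBracket, if_neg hq1, if_neg hq1, div_left_inj' h1] at h
  exact sub_left_inj.mp h

lemma normalCoeff_eq_of_qBracket_eq {q : ℝ} {c c' : ℂ}
    (h : qBracket q (-c) = qBracket q (-c')) : normalCoeff q c = normalCoeff q c' := by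
  funext j
  rcases j with _ | j
  · rw [normalCoeff, h, normalCoeff]
  · rw [normalCoeff, normalCoeff]
    split_ifs with hq1
    · rfl
    · rfl
    · rw [cpow_neg_eq_of_qBracket_eq hq1 h]

/-- For `q > 1` and `h = 0` the character `e_c` depends on `q^c` only. -/
lemma qhLog_eq_of_qBracket_eq {L : ℂ → ℂ} {q h : ℝ} (hq : 1 ≤ q) (hh : 0 ≤ h) {c c' : ℂ}
    (hcc' : qBracket q (-c) = qBracket q (-c')) (hpos : 0 < h → c = c') (k : ℕ) (x : ℂ) :
    qhLog L q h c k x = qhLog L q h c' k x := by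
  rcases hh.eq_or_lt with rfl | hh
  · rcases hq.eq_or_lt with rfl | hq
    · simp only [qBracket, if_true, neg_inj] at hcc'
      rw [hcc']
    · have hq0 : (q : ℂ) ≠ 0 := by exact_mod_cast (by linarith : q ≠ 0)
      have h1 := cpow_neg_eq_of_qBracket_eq hq.ne' hcc'
      rw [Complex.cpow_neg, Complex.cpow_neg, inv_inj] at h1
      have h2 : (q : ℂ) ^ (c' - c) = 1 := by
        rw [Complex.cpow_sub _ _ hq0, h1, div_self]
        simp [Complex.cpow_eq_zero_iff, hq0]
      have e : (fun b => qhChar L q 0 b x) = fun b => qhChar L q 0 (b + (c' - c)) x := by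
        funext b
        simp only [qhChar, if_pos hq, lt_irrefl, if_false]
        rw [Complex.cpow_add _ _ hq0, h2, mul_one]
      have h3 : iteratedDeriv k (fun b => qhChar L q 0 (b + (c' - c)) x) c =
          iteratedDeriv k (fun b => qhChar L q 0 b x) c' := by
        rw [iteratedDeriv_comp_add_const k (fun b => qhChar L q 0 b x)]
        simp
      rw [qhLog, qhLog, e, h3, ← e]
  · rw [hpos hh]

/-- The solution `E_{J₀}(x)` commutes with the commutant of `J₀`: blocks of the commutant
intertwine the nilpotent matrices, of which the blocks of `E_{J₀}(x)` are polynomials. -/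
lemma commute_normalSol {L : ℂ → ℂ} {q h : ℝ} (hq : 1 ≤ q) (hh : 0 ≤ h) (hr : ∑ i, r i = n)
    (hrpos : ∀ i, 0 < r i) {c : Fin m → ℂ}
    (hc : 0 < h → ∀ i j, qBracket q (-c i) = qBracket q (-c j) → c i = c j)
    {B : Matrix (Fin n) (Fin n) ℂ} (hB : normalForm hr c q * B = B * normalForm hr c q) (x : ℂ) :
    normalSol hr c L q h x * B = B * normalSol hr c L q h x := by
  have hN : ∀ (r : ℕ) (a : ℕ → ℂ), nilPoly r a = nilEval r (PowerSeries.mk a) := by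
    intro r a; simp [nilEval]
  refine ext_subBlock hr fun i j => ?_
  have h1 := congrArg (fun M => subBlock hr M i j) hB
  simp only [normalForm_eq hr hrpos, subBlock_blockDiag_mul, subBlock_mul_blockDiag, hN] at h1
  simp only [normalSol, logBlock_eq, subBlock_blockDiag_mul, subBlock_mul_blockDiag, hN]
  -- blocks with the same eigenvalue have the same normal form and the same logarithms; there is no
  -- nonzero intertwiner between the others
  by_cases hij : qBracket q (-c i) = qBracket q (-c j)
  · have h2 : (fun k => qhLog L q h (c i) k x) = fun k => qhLog L q h (c j) k x :=
      funext fun k => qhLog_eq_of_qBracket_eq hq hh hij (fun hpos => hc hpos i j hij) k x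
    rw [normalCoeff_eq_of_qBracket_eq hij] at h1
    rw [h2]
    refine nilEval_comm ?_ h1 _
    rw [PowerSeries.coeff_mk]
    exact normalCoeff_one_ne_zero hq _
  · have h2 := eq_zero_of_nilEval_comm (by
      simpa [normalCoeff] using hij) h1
    rw [h2, Matrix.mul_zero, Matrix.zero_mul]

end Blocks

end

end QHDiff

end

theorem mainTheorem1
    -- the size `n`, a norm `N` on `n × n` matrices, a determination `L` of the logarithm on `D`
    (n : ℕ) (N : Seminorm ℂ (Matrix (Fin n) (Fin n) ℂ)) (hN : ∀ M, N M = 0 → M = 0)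
    (D : Set ℂ) (L : ℂ → ℂ) (hDopen : IsOpen D) (hDunbounded : ∀ R : ℝ, ∃ x ∈ D, R < ‖x‖)
    (hLcont : ContinuousOn L D) (hLexp : ∀ x ∈ D, Complex.exp (L x) = x)
    -- the family of systems
    (Lam : Set (ℝ × ℝ)) (hLam : Lam ⊆ QHDiff.Qplus) (hLamBounded : Bornology.IsBounded Lam)
    (C lam : ℝ) (hC : 0 ≤ C) (hlam : 0 ≤ lam)
    (A : ℝ → ℝ → ℕ → Matrix (Fin n) (Fin n) ℂ)
    (hA : QHDiff.IsFuchsianSystem N C lam Lam A)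
    (hAres : ∀ q h : ℝ, (q, h) ∈ Lam → QHDiff.IsNonresonant q (A q h 0))
    -- the normal form, non-resonant up to the closure of `Lam`
    (m : ℕ) (c : Fin m → ℂ) (r : Fin m → ℕ) (hrpos : ∀ i, 0 < r i) (hr : ∑ i, r i = n)
    (hc : ∀ i j, ∀ s : ℤ, s ≠ 0 → c i - c j ≠ (s : ℂ))
    (hJres : ∀ q h : ℝ, (q, h) ∈ closure Lam →
      QHDiff.IsNonresonant q (QHDiff.normalForm hr c q))
    -- the bounded conjugations with bounded inverses
    (P : ℝ → ℝ → GL (Fin n) ℂ)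
    (hP : ∀ q h : ℝ, (q, h) ∈ Lam →
      (P q h : Matrix (Fin n) (Fin n) ℂ) * QHDiff.normalForm hr c q = A q h 0 * (P q h).val)
    (hPbounded : ∃ B : ℝ, ∀ q h : ℝ, (q, h) ∈ Lam →
      N (P q h : Matrix (Fin n) (Fin n) ℂ) ≤ B)
    (hPinvBounded : ∃ B : ℝ, ∀ q h : ℝ, (q, h) ∈ Lam →
      N (((P q h)⁻¹ : GL (Fin n) ℂ) : Matrix (Fin n) (Fin n) ℂ) ≤ B) :
    (∀ q h : ℝ, (q, h) ∈ Lam →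
      ∃! F : ℕ → Matrix (Fin n) (Fin n) ℂ, QHDiff.IsReducingGauge q h (A q h) F) ∧
    ∀ F : ℝ → ℝ → ℕ → Matrix (Fin n) (Fin n) ℂ,
      (∀ q h : ℝ, (q, h) ∈ Lam → QHDiff.IsReducingGauge q h (A q h) (F q h)) →
      ∃ C' lam' : ℝ, 0 ≤ C' ∧ lam ≤ lam' ∧
        QHDiff.IsFuchsianFamily N C' lam' Lam F ∧
        ∀ q h : ℝ, (q, h) ∈ Lam →
          (∀ x ∈ QHDiff.V q h lam', Summable fun s => QHDiff.qhMonomial q h x s • F q h s) ∧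
          (∀ Q : GL (Fin n) ℂ,
            QHDiff.IsFundamentalMatrix q h (QHDiff.qhSum q h (A q h))
                (QHDiff.solDomain D q h lam')
                (fun x => QHDiff.qhSum q h (F q h) x * Q.val * QHDiff.normalSol hr c L q h x) ↔
              Q.val * QHDiff.normalForm hr c q = A q h 0 * Q.val) ∧
          (∀ Q : GL (Fin n) ℂ, Q.val * QHDiff.normalForm hr c q = A q h 0 * Q.val →
            QHDiff.IsFundamentalMatrix q h (QHDiff.qhSum q h (A q h))
              (QHDiff.solDomain D q h lam') (QHDiff.canonicalSol hr c L q h (F q h) Q)) ∧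
          ((0 < h → ∀ i j, QHDiff.qBracket q (-c i) = QHDiff.qBracket q (-c j) → c i = c j) →
            ∀ Q₁ Q₂ : GL (Fin n) ℂ,
              Q₁.val * QHDiff.normalForm hr c q = A q h 0 * Q₁.val →
              Q₂.val * QHDiff.normalForm hr c q = A q h 0 * Q₂.val →
              ∀ x ∈ QHDiff.solDomain D q h lam',
                QHDiff.canonicalSol hr c L q h (F q h) Q₁ x =
                  QHDiff.canonicalSol hr c L q h (F q h) Q₂ x) := by
  open scoped Matrix.Norms.Operator in
  obtain ⟨l, M, K, hM, hl, hbound⟩ := QHDiff.exists_uniform_bound N hN Lam hLam hLamBounded C lam hC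
    hlam A hA.2 c hrpos hr hJres P hP hPbounded hPinvBounded
  obtain ⟨k, hk, hkN⟩ := QHDiff.exists_seminorm_le N
  have hq : ∀ {q h : ℝ}, (q, h) ∈ Lam → 1 ≤ q := fun hqh => (hLam hqh).1
  have hh : ∀ {q h : ℝ}, (q, h) ∈ Lam → 0 ≤ h := fun hqh => (hLam hqh).2
  refine ⟨fun q h hqh => QHDiff.existsUnique_isReducingGauge (by linarith [hq hqh]) h _
    fun s hs => QHDiff.gaugeOp_injective_of_isNonresonant (hq hqh) (hAres q h hqh) hs, ?_⟩
  intro F hF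
  have hl0 : 0 ≤ l := hlam.trans hl
  -- the bounds hold with the parameter `l + M`; the sums are invertible beyond `l + 2 M`
  have hest : ∀ {q h : ℝ}, (q, h) ∈ Lam → ∀ s, 1 ≤ s →
      QHDiff.qNat q s * ‖F q h s‖ ≤ M * QHDiff.poleCoeff q h (l + M) s := fun {q h} hqh => by
    obtain ⟨h0, hrec⟩ := (QHDiff.isReducingGauge_iff (by linarith [hq hqh]) h _ _).mp (hF q h hqh)
    exact (hbound q h hqh).2.2 (F q h) h0 hrec
  have hest1 : ∀ {q h : ℝ}, (q, h) ∈ Lam → ∀ s, 1 ≤ s →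
      ‖F q h s‖ ≤ M * QHDiff.poleCoeff q h (l + M) s := fun {q h} hqh s hs => by
    refine le_trans ?_ (hest hqh s hs)
    have := QHDiff.one_le_qNat (hq hqh) hs
    nlinarith [norm_nonneg (F q h s)]
  refine ⟨k * M, l + M + M + 1, by positivity, by linarith, fun q h hqh s hs => ?_,
    fun q h hqh => ?_⟩
  · rw [QHDiff.fuchsian_bound_eq _ _ _ _ hs, mul_assoc]
    refine (hkN _).trans (mul_le_mul_of_nonneg_left ((hest1 hqh s hs).trans ?_) hk.le)
    exact mul_le_mul_of_nonneg_left
      (QHDiff.poleCoeff_mono (hq hqh) (hh hqh) (by positivity) (by linarith) s) hM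
  · have hq := hq hqh
    have hh := hh hqh
    obtain ⟨hhl, hAs, -⟩ := hbound q h hqh
    obtain ⟨h0, hrec⟩ := (QHDiff.isReducingGauge_iff (by linarith) h _ _).mp (hF q h hqh)
    have hlM : 0 ≤ l + M := by positivity
    have hμ : l + M < l + M + M + 1 := by linarith
    have hμ0 : 0 < l + M + M + 1 := by positivity
    have hhμ : h < l + M + M + 1 := by linarith
    have hK : ∀ s, 1 ≤ s → ‖A q h s‖ ≤ |K| * QHDiff.poleCoeff q h (l + M) s := fun s hs => by
      refine (hAs s hs).trans (mul_le_mul (le_abs_self K) ?_ ?_ (abs_nonneg K))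
      · exact QHDiff.poleCoeff_mono hq hh hl0 (by linarith) s
      · exact QHDiff.poleCoeff_nonneg hq hh hl0 s
    have hsum := QHDiff.summable_of_pole_bound hq hh hlM hμ (hest1 hqh)
    have hd := fun i j => QHDiff.differentiableOn_qhSum hq hh hμ0 hsum i j
    have hu : ∀ x ∈ QHDiff.V q h ((l + M + M + 1 : ℝ) : ℂ), IsUnit (QHDiff.qhSum q h (F q h) x) :=
      fun x hx => QHDiff.isUnit_qhSum hq hh hlM hM (by linarith) hx h0 (hest1 hqh)
    have hδ : ∀ x ∈ QHDiff.V q h ((l + M + M + 1 : ℝ) : ℂ),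
        QHDiff.deltaMatrix q h (QHDiff.qhSum q h (F q h)) x =
          QHDiff.qhSum q h (A q h) x * QHDiff.qhSum q h (F q h) x -
            QHDiff.qhSum q h (F q h) (QHDiff.shiftBack q h x) * A q h 0 := fun x hx =>
      QHDiff.delta_qhSum_gauge hq hh (by linarith) hμ hx hK (hest hqh) (hest1 hqh) hrec
    refine ⟨fun x hx => (QHDiff.summable_norm_qhMonomial_smul hq hh hμ0 hx hsum).of_norm,
      fun Q => ⟨fun hY => ?_, fun hQ => ?_⟩, fun Q hQ => ?_, fun hcc Q₁ Q₂ hQ₁ hQ₂ x _ => ?_⟩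
    · exact QHDiff.conj_of_isFundamentalMatrix hDopen hDunbounded hLcont hLexp hq hh hhμ hr hrpos c
        hd hu hδ hY
    · have h1 := QHDiff.isFundamentalMatrix_gauge_mul_normalSol hDopen hLcont hLexp hq hh hhμ hr
        hrpos c hd hu hδ Q.isUnit isUnit_one hQ
      simpa only [mul_one] using h1
    · have h1 := QHDiff.isFundamentalMatrix_gauge_mul_normalSol hDopen hLcont hLexp hq hh hhμ hr
        hrpos c hd hu hδ Q.isUnit (Q⁻¹).isUnit hQ
      have e : QHDiff.canonicalSol hr c L q h (F q h) Q = fun x =>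
          QHDiff.qhSum q h (F q h) x * Q.val * QHDiff.normalSol hr c L q h x * (Q⁻¹).val := by
        funext x
        simp only [QHDiff.canonicalSol, mul_assoc]
      rw [e]
      exact h1
    · -- `Q₁⁻¹ Q₂` commutes with the normal form
      have hB : QHDiff.normalForm hr c q * ((Q₁⁻¹).val * Q₂.val) =
          ((Q₁⁻¹).val * Q₂.val) * QHDiff.normalForm hr c q := by
        have h1 : (Q₁⁻¹).val * A q h 0 = QHDiff.normalForm hr c q * (Q₁⁻¹).val := by
          calc (Q₁⁻¹).val * A q h 0 = (Q₁⁻¹).val * (A q h 0 * Q₁.val) * (Q₁⁻¹).val := by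
                rw [mul_assoc, mul_assoc, Units.mul_inv, mul_one]
            _ = QHDiff.normalForm hr c q * (Q₁⁻¹).val := by
                rw [← hQ₁, ← mul_assoc, Units.inv_mul, one_mul]
        rw [mul_assoc, hQ₂, ← mul_assoc, ← mul_assoc, h1]
      have hE := QHDiff.commute_normalSol (L := L) hq hh hr hrpos hcc hB x
      have h2 : Q₁.val * ((Q₁⁻¹).val * Q₂.val) = Q₂.val := by
        rw [← mul_assoc, Units.mul_inv, one_mul]
      have h3 : Q₁.val * QHDiff.normalSol hr c L q h x * (Q₁⁻¹).val =
          Q₂.val * QHDiff.normalSol hr c L q h x * (Q₂⁻¹).val := by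
        calc _ = Q₁.val * (QHDiff.normalSol hr c L q h x * ((Q₁⁻¹).val * Q₂.val)) *
              (Q₂⁻¹).val := by
              simp only [mul_assoc, Units.mul_inv, mul_one]
          _ = _ := by rw [hE, ← mul_assoc, h2]
      rw [QHDiff.canonicalSol, QHDiff.canonicalSol, h3]
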